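/- Let $d\ge 1$ and let $I=[0,1]^d$. Let $Y_1,Y_2,\dots$ be i.i.d. continuous, centered, stationary random fields on $\mathbf{R}^d$ with covariance $\mathbb{E}\,Y_k(x)Y_k(y)=f(|x-y|)$. Assume that 1. $\mathbb{E}\,e^{\lambda Y_k(0)}<\infty$ for all $\lambda\in\mathbf{R}$; 2. for every $r\ge 2$ there is a constant $C_r$ such that $\mathbb{E}\,|Y_k(x)-Y_k(y)|^r\le C_r|x-y|^r$ for all $x,y\in\mathbf{R}^d$; 3. $f(t)=1+O(t)$ as $t\to 0^+$ (with $f(0)=1$), and $f(t)=O(t^{-\delta})$ as $t\to\infty$ for some $\delta>0$. Let $a_k>0$ satisfy $\lim_{k\to\infty}a_k=0$, $\sum_{k=1}^\infty a_k^2=\infty$ and $\sum_{k=1}^\infty a_k^3<\infty$, and let $$b_k=\exp\Big(\sum_{j=1}^k a_j^2+c_k\Big),\qquad c_k\in\mathbf{R},\quad \sup_{k\ge1}|c_k|<\infty .$$ Put $X_k(x)=a_kY_k(b_kx)$ and, for continuous $g:I\to\mathbf{C}$, $\beta\in\mathbf{C}$ and $n\ge 0$, $$\mu_n(g;\beta)=\int_I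 g(x)\,\frac{e^{\beta\sum_{k=1}^nX_k(x)}}{\mathbb{E}\,e^{\beta\sum_{k=1}^nX_k(x)}}\,dx .$$ Then there exist an open set $U\subset\mathbf{C}$ containing the interval $(0,\sqrt{2d})$ and random variables $\mu(g;\beta)$ such that the following hold. * For all $\beta\in U$, $n\ge 0$ and $x\in I$ the denominator $\mathbb{E}\,e^{\beta\sum_{k=1}^nX_k(x)}$ is nonzero, and for all $\beta\in U$ and $g\in C(I,\mathbf{C})$ the sequence $(\mu_n(g;\beta))_{n\ge0}$ is a martingale with respect to the filtration $\sigma(Y_1,\dots,Y_n)$. * For every compact $K\subset U$ there exists $p>1$ such that for all $\beta\in K$ and $g\in C(I,\mathbf{C})$ the martingale $\mu_n(g;\beta)$ converges in $L^p(\Omega)$ to $\mu(g;\beta)$ as $n\to\infty$. * For every fixed $g\in C(I,\mathbf{C})$, almost surely the maps $\beta\mapsto\mu_n(g;\beta)$ converge uniformly on compact subsets of $U$ to $\beta\mapsto\mu(g;\beta)$, and this limit is analytic on $U$. -/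

import Mathlib

open MeasureTheory ProbabilityTheory Filter Topology Asymptotics

/-- The closed unit cube `I = [0,1]^d` in Euclidean space `ℝ^d`. -/
def unitCube (d : ℕ) : Set (EuclideanSpace ℝ (Fin d)) :=
  {x | ∀ i, x i ∈ Set.Icc (0 : ℝ) 1}

/-- (Strict) stationarity of a random field `Z` on `ℝ^d`: for every shift `h`, the fields
`x ↦ Z (x + h)` and `x ↦ Z x` have the same law on `ℝ^d → ℝ` with the product σ-algebra,
that is, the same finite-dimensional distributions. -/
def IsStationaryField {Ω : Type*} [MeasurableSpace Ω] (P : Measure Ω) {d : ℕ}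
    (Z : Ω → EuclideanSpace ℝ (Fin d) → ℝ) : Prop :=
  ∀ h : EuclideanSpace ℝ (Fin d), IdentDistrib (fun ω x => Z ω (x + h)) Z P P

/-- The rescaled fields `X_k(x) = a_k Y_k(b_k x)`. -/
def dilatedField {Ω : Type*} {d : ℕ} (a b : ℕ → ℝ)
    (Y : ℕ → Ω → EuclideanSpace ℝ (Fin d) → ℝ) :
    ℕ → Ω → EuclideanSpace ℝ (Fin d) → ℝ :=
  fun k ω x => a k * Y k ω (b k • x)

/-- The sum of the first `n` fields, `X_0(x) + ⋯ + X_{n-1}(x)` (indices start at `0`). -/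
def fieldSum {Ω : Type*} {d : ℕ} (X : ℕ → Ω → EuclideanSpace ℝ (Fin d) → ℝ)
    (n : ℕ) (ω : Ω) (x : EuclideanSpace ℝ (Fin d)) : ℝ :=
  ∑ k ∈ Finset.range n, X k ω x

/-- The normalising factor `𝔼 exp(β (X_0(x) + ⋯ + X_{n-1}(x)))`, for complex `β`. -/
noncomputable def chaosNormalizer {Ω : Type*} [MeasurableSpace Ω] (P : Measure Ω) {d : ℕ}
    (X : ℕ → Ω → EuclideanSpace ℝ (Fin d) → ℝ)
    (n : ℕ) (β : ℂ) (x : EuclideanSpace ℝ (Fin d)) : ℂ :=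
  ∫ ω, Complex.exp (β * (fieldSum X n ω x : ℂ)) ∂P

/-- The chaos `μ_n(f; β)` of the first `n` fields, integrated against `f` over the unit cube. -/
noncomputable def chaos {Ω : Type*} [MeasurableSpace Ω] (P : Measure Ω) {d : ℕ}
    (X : ℕ → Ω → EuclideanSpace ℝ (Fin d) → ℝ)
    (n : ℕ) (f : EuclideanSpace ℝ (Fin d) → ℂ) (β : ℂ) (ω : Ω) : ℂ :=
  ∫ x in unitCube d,
    f x * (Complex.exp (β * (fieldSum X n ω x : ℂ)) / chaosNormalizer P X n β x)

/-- The filtration generated by the fields: at time `n` it is `σ(Y_0, …, Y_{n-1})`, the σ-algebra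
generated by all the random variables `Y_k(x)` with `k < n` and `x ∈ ℝ^d`. -/
def fieldFiltration {Ω : Type*} [mΩ : MeasurableSpace Ω] {d : ℕ}
    (Y : ℕ → Ω → EuclideanSpace ℝ (Fin d) → ℝ)
    (hY : ∀ k x, Measurable (fun ω => Y k ω x)) : Filtration ℕ mΩ where
  seq n := ⨆ k : ℕ, ⨆ _ : k < n, ⨆ x : EuclideanSpace ℝ (Fin d),
    MeasurableSpace.comap (fun ω => Y k ω x) inferInstance
  mono' _ _ hmn := iSup_mono fun _ => iSup_mono' fun hk => ⟨lt_of_lt_of_le hk hmn, le_rfl⟩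
  le' _ := iSup_le fun k => iSup_le fun _ => iSup_le fun x => (hY k x).comap_le

/-! Write W_n for the product of the normalised factors V_k = exp(β X_k) / 𝔼 exp(β X_k), and t_n =
∑_{k<n} a_k² for the `clock`. The core is that ∫ g W_n is Cauchy in L^p for some p = 2s > 1 close to
1, uniformly near every real subcritical β; the rest is martingale theory and Cauchy's integral
formula.

Mean squares need not stay bounded in the whole range of β, so the proof estimates s-th powers, 1/2
< s < 1, of energies ∬ Γ(x,y) W_n(x) conj(W_n(y)) with Γ of positive type. In conditional mean, one
step multiplies Γ by the covariance of V_k. Split V_k = 1 + u_k + h_k with u_k = β X_k linear and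
h_k quadratic. Completing the square bounds that covariance, in the order of positive kernels, by 1
+ R_k + (1 + a_k) Cov(u_k) (`StepSystem.cov_V_eq`). The kernel R_k has no spatial decay, but it is
O(a_k³), hence summable, and is absorbed multiplicatively into Γ (`futureKernel`). Cov(u_k) lives
near the diagonal, and its effect is bounded by the energy of |W| against `nearKernel`. Domination
in conditional mean passes to concave powers by Jensen (`integral_rpow_le_of_weighted`); this is
done once per unit of clock time, and the blocks are then summed (`energyProcess_block`,
`energyProcess_sum`).

The sum converges because the short-range energy at time t has s-th moment O(e^{-εt}). Truncate |W|
at level e^{lt} (`lintegral_shortRange_rpow_le`). For real β, 𝔼|W|^q grows at most like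
e^{q(q-1)β²t/2}, with no growth at q = 1. At s = 1/2, the part below the level is small when l <
(1-θ)d, by the volume of balls of radius e^{-(1-θ)t}; the part above is small when l > (1+η)β²/2.
Small η, θ > 0 allow both exactly when β² < 2d. The conditions are open, so they survive for s
slightly above 1/2 and for complex β nearby (`exists_subcritical_parameters`).

For the Cauchy property take Γ(x,y) = g(x) conj(g(y)) and add to the energy a martingale cross term,
so that its terminal value is |∫ g W_N - ∫ g W_M|². At time M only the pairing of W_M with
`futureKernel` - Γ is left, of size given by the tail of ∑ a_k³
(`StepSystem.integral_norm_sub_rpow_le`).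

For almost sure convergence, the L¹ norm over a circle of the martingale increments is a
submartingale in n. Doob's inequality, Borel–Cantelli and Cauchy's formula give uniform convergence
on a smaller disc (`ae_uniformCauchySeqOn_of_martingale`). -/

/-! ### Exponential moments of one real variable at complex parameters. -/

section ScalarExponentialMoments

variable {Ω : Type*} [MeasurableSpace Ω] {P : Measure Ω}

/-- The growth exponent of the `q`-th absolute moment of the chaos density. -/
noncomputable def momentExponent (q : ℝ) (β : ℂ) : ℝ :=
  (q ^ 2 * β.re ^ 2 - q * (β.re ^ 2 - β.im ^ 2)) / 2

/-- A real random variable all of whose exponential moments are finite. -/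
structure HasExpMoments (P : Measure Ω) (ξ : Ω → ℝ) : Prop where
  meas : Measurable ξ
  exp : ∀ l : ℝ, Integrable (fun ω => Real.exp (l * ξ ω)) P

namespace HasExpMoments

variable {ξ : Ω → ℝ}

lemma integrable_exp_abs (h : HasExpMoments P ξ) (R : ℝ) :
    Integrable (fun ω => Real.exp (R * |ξ ω|)) P := by
  refine ((h.exp R).add (h.exp (-R))).mono' ?_ (ae_of_all _ fun ω => ?_)
  · exact (Real.measurable_exp.comp ((measurable_norm.comp h.meas).const_mul R)).aestronglyMeasurable
  · rw [Real.norm_eq_abs, abs_of_pos (Real.exp_pos _)]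
    simp only [Pi.add_apply]
    rcases abs_cases (ξ ω) with ⟨h1, _⟩ | ⟨h1, _⟩ <;> rw [h1]
    · linarith [Real.exp_pos (-R * ξ ω)]
    · have : R * -ξ ω = -R * ξ ω := by ring
      rw [this]; linarith [Real.exp_pos (R * ξ ω)]

lemma integrable_pow_mul_exp (h : HasExpMoments P ξ) (n : ℕ) (R : ℝ) :
    Integrable (fun ω => |ξ ω| ^ n * Real.exp (R * |ξ ω|)) P := by
  refine ((h.integrable_exp_abs (R + 1)).const_mul (n.factorial : ℝ)).mono' ?_
    (ae_of_all _ fun ω => ?_)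
  · have := h.meas
    exact (((measurable_norm.comp this).pow_const n).mul
      (Real.measurable_exp.comp ((measurable_norm.comp this).const_mul R))).aestronglyMeasurable
  · rw [Real.norm_eq_abs, abs_of_nonneg (by positivity)]
    have h1 : |ξ ω| ^ n / n.factorial ≤ Real.exp |ξ ω| :=
      Real.pow_div_factorial_le_exp _ (abs_nonneg _) n
    rw [div_le_iff₀ (by positivity)] at h1
    calc |ξ ω| ^ n * Real.exp (R * |ξ ω|)
        ≤ (Real.exp |ξ ω| * n.factorial) * Real.exp (R * |ξ ω|) := by gcongr
      _ = n.factorial * Real.exp ((R + 1) * |ξ ω|) := by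
          rw [add_mul, one_mul, Real.exp_add]; ring

lemma integrable_cexp (h : HasExpMoments P ξ) (z : ℂ) :
    Integrable (fun ω => Complex.exp (z * ξ ω)) P := by
  refine (h.exp z.re).mono' ?_ (ae_of_all _ fun ω => ?_)
  · exact (Complex.measurable_exp.comp
      ((Complex.measurable_ofReal.comp h.meas).const_mul z)).aestronglyMeasurable
  · rw [Complex.norm_exp]; simp

lemma integrable_pow (h : HasExpMoments P ξ) (n : ℕ) : Integrable (fun ω => ξ ω ^ n) P := by
  refine (h.integrable_pow_mul_exp n 0).mono' (h.meas.pow_const n).aestronglyMeasurable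
    (ae_of_all _ fun ω => ?_)
  simp

lemma differentiable_complexMGF (h : HasExpMoments P ξ) :
    Differentiable ℂ (complexMGF ξ P) := by
  intro z
  have : integrableExpSet ξ P = Set.univ := by
    ext l; simp only [integrableExpSet, Set.mem_ofPred_eq, Set.mem_univ, iff_true]; exact h.exp l
  exact (hasDerivAt_complexMGF (by rw [this]; simp)).differentiableAt

/-- Second order expansion of the complex moment generating function. -/
lemma norm_complexMGF_sub_le [IsProbabilityMeasure P] (h : HasExpMoments P ξ)
    (hmean : ∫ ω, ξ ω ∂P = 0) (hvar : ∫ ω, ξ ω ^ 2 ∂P = 1) (R : ℝ) :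
    ∃ C, 0 ≤ C ∧ ∀ z : ℂ, ‖z‖ ≤ R → ‖complexMGF ξ P z - 1 - z ^ 2 / 2‖ ≤ C * ‖z‖ ^ 3 := by
  refine ⟨∫ ω, |ξ ω| ^ 3 * Real.exp (R * |ξ ω|) ∂P, integral_nonneg fun ω => by positivity,
    fun z hz => ?_⟩
  have i1 := h.integrable_cexp z
  have i2 : Integrable (fun ω => (ξ ω : ℂ)) P := by
    have := (h.integrable_pow 1).ofReal (𝕜 := ℂ); simpa using this
  have i3 : Integrable (fun ω => (ξ ω : ℂ) ^ 2) P := by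
    have := (h.integrable_pow 2).ofReal (𝕜 := ℂ); simpa using this
  have e2 : ∫ ω, (ξ ω : ℂ) ∂P = 0 := by rw [integral_complex_ofReal, hmean]; simp
  have e3 : ∫ ω, (ξ ω : ℂ) ^ 2 ∂P = 1 := by
    have : ∀ ω, (ξ ω : ℂ) ^ 2 = ((ξ ω ^ 2 : ℝ) : ℂ) := fun ω => by push_cast; rfl
    simp_rw [this]
    rw [integral_complex_ofReal, hvar]; simp
  have key : complexMGF ξ P z - 1 - z ^ 2 / 2
      = ∫ ω, (Complex.exp (z * ξ ω) - 1 - z * ξ ω - z ^ 2 / 2 * (ξ ω : ℂ) ^ 2) ∂P := by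
    have j1 : Integrable (fun ω => Complex.exp (z * ξ ω) - 1) P := i1.sub (integrable_const _)
    have j2 : Integrable (fun ω => Complex.exp (z * ξ ω) - 1 - z * ξ ω) P := j1.sub (i2.const_mul z)
    rw [integral_sub j2 (i3.const_mul _), integral_sub j1 (i2.const_mul z),
      integral_sub i1 (integrable_const _), integral_const_mul, integral_const_mul, e2, e3]
    simp [complexMGF]
  rw [key, ← integral_mul_const]
  refine norm_integral_le_of_norm_le ((h.integrable_pow_mul_exp 3 R).mul_const _)
    (ae_of_all _ fun ω => ?_)
  have := Complex.norm_exp_sub_sum_le_norm_mul_exp (z * ξ ω) 3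
  simp only [Finset.sum_range_succ, Finset.sum_range_zero, Nat.factorial] at this
  have e : Complex.exp (z * ξ ω) - 1 - z * ξ ω - z ^ 2 / 2 * (ξ ω : ℂ) ^ 2
      = Complex.exp (z * ξ ω) - (0 + (z * ξ ω) ^ 0 / ((1 : ℕ) : ℂ)
        + (z * ξ ω) ^ 1 / (((0 + 1) * 1 : ℕ) : ℂ) + (z * ξ ω) ^ 2 /
          (((1 + 1) * ((0 + 1) * 1) : ℕ) : ℂ)) := by
    push_cast; ring
  rw [e]
  refine this.trans ?_
  rw [norm_mul, Complex.norm_real, Real.norm_eq_abs]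
  have : Real.exp (‖z‖ * |ξ ω|) ≤ Real.exp (R * |ξ ω|) := by gcongr
  calc (‖z‖ * |ξ ω|) ^ 3 * Real.exp (‖z‖ * |ξ ω|)
      ≤ (‖z‖ * |ξ ω|) ^ 3 * Real.exp (R * |ξ ω|) := by gcongr
    _ = _ := by ring

/-- The quadratic remainder of `exp (z ξ)` in mean square. -/
lemma integral_norm_sq_remainder_le (h : HasExpMoments P ξ) (R : ℝ) :
    ∃ C, 0 ≤ C ∧ ∀ z : ℂ, ‖z‖ ≤ R →
      Integrable (fun ω => ‖Complex.exp (z * ξ ω) - 1 - z * ξ ω‖ ^ 2) P ∧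
      ∫ ω, ‖Complex.exp (z * ξ ω) - 1 - z * ξ ω‖ ^ 2 ∂P ≤ C * ‖z‖ ^ 4 := by
  refine ⟨∫ ω, |ξ ω| ^ 4 * Real.exp (2 * R * |ξ ω|) ∂P, integral_nonneg fun ω => by positivity,
    fun z hz => ?_⟩
  have hm : AEStronglyMeasurable (fun ω => ‖Complex.exp (z * ξ ω) - 1 - z * ξ ω‖ ^ 2) P := by
    have := Complex.measurable_ofReal.comp h.meas
    have h2 := (((Complex.measurable_exp.comp (this.const_mul z)).sub_const 1).sub
      (this.const_mul z))
    exact ((measurable_norm.comp h2).pow_const 2).aestronglyMeasurable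
  have hb : ∀ ω, ‖Complex.exp (z * ξ ω) - 1 - z * ξ ω‖ ^ 2
      ≤ |ξ ω| ^ 4 * Real.exp (2 * R * |ξ ω|) * ‖z‖ ^ 4 := by
    intro ω
    have := Complex.norm_exp_sub_sum_le_norm_mul_exp (z * ξ ω) 2
    simp only [Finset.sum_range_succ, Finset.sum_range_zero, Nat.factorial] at this
    have e : Complex.exp (z * ξ ω) - 1 - z * ξ ω
        = Complex.exp (z * ξ ω) - (0 + (z * ξ ω) ^ 0 / ((1 : ℕ) : ℂ)
          + (z * ξ ω) ^ 1 / (((0 + 1) * 1 : ℕ) : ℂ)) := by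
      push_cast; ring
    rw [e]
    refine (pow_le_pow_left₀ (norm_nonneg _) this 2).trans ?_
    rw [norm_mul, Complex.norm_real, Real.norm_eq_abs]
    have h1 : Real.exp (‖z‖ * |ξ ω|) ≤ Real.exp (R * |ξ ω|) := by gcongr
    calc ((‖z‖ * |ξ ω|) ^ 2 * Real.exp (‖z‖ * |ξ ω|)) ^ 2
        ≤ ((‖z‖ * |ξ ω|) ^ 2 * Real.exp (R * |ξ ω|)) ^ 2 := by gcongr
      _ = _ := by
        have : Real.exp (2 * R * |ξ ω|) = Real.exp (R * |ξ ω|) ^ 2 := by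
          rw [← Real.exp_nat_mul]; congr 1; push_cast; ring
        rw [this]; ring
  have hi := ((h.integrable_pow_mul_exp 4 (2 * R)).mul_const (‖z‖ ^ 4))
  refine ⟨hi.mono' hm (ae_of_all _ fun ω => ?_), ?_⟩
  · rw [Real.norm_eq_abs, abs_of_nonneg (by positivity)]; exact hb ω
  · rw [← integral_mul_const]
    refine integral_mono_of_nonneg (ae_of_all _ fun ω => by positivity) hi (ae_of_all _ hb)

lemma complexMGF_ofReal_ne_zero [IsProbabilityMeasure P] (h : HasExpMoments P ξ) (x : ℝ) :
    complexMGF ξ P x ≠ 0 := by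
  rw [complexMGF_ofReal]
  exact_mod_cast (mgf_pos (h.exp x)).ne'

/-- Near a real parameter the moment generating function is bounded away from zero along
bounded positive sequences tending to zero. -/
lemma exists_ball_le_norm_complexMGF [IsProbabilityMeasure P] (h : HasExpMoments P ξ)
    (β₀ : ℝ) {a : ℕ → ℝ} (ha : Tendsto a atTop (𝓝 0)) :
    ∃ ε > 0, ∃ c > 0, ∀ β ∈ Metric.ball (β₀ : ℂ) ε, ∀ k,
      c ≤ ‖complexMGF ξ P (β * a k)‖ := by
  -- Adding the limit 0 makes the set of amplitudes compact, so a minimum over it is attained and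
  -- the tube lemma gives one disc valid for all k.
  set K : Set ℝ := insert 0 (Set.range a)
  have hK : IsCompact K := ha.isCompact_insert_range
  set S : Set ℂ := (fun x : ℝ => ((β₀ * x : ℝ) : ℂ)) '' K
  have hcont : Continuous fun p : ℂ × ℝ => ‖complexMGF ξ P (p.1 * p.2)‖ := by
    have := h.differentiable_complexMGF.continuous
    fun_prop
  have hne : ∀ x ∈ K, 0 < ‖complexMGF ξ P ((β₀ : ℂ) * x)‖ := by
    intro x _
    have := h.complexMGF_ofReal_ne_zero (β₀ * x)
    push_cast at this
    exact norm_pos_iff.mpr this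
  have hKne : K.Nonempty := ⟨0, Set.mem_insert _ _⟩
  obtain ⟨x₀, hx₀, hmin⟩ := hK.exists_isMinOn hKne
    (f := fun x : ℝ => ‖complexMGF ξ P ((β₀ : ℂ) * x)‖)
    (hcont.comp (by fun_prop : Continuous fun x : ℝ => ((β₀ : ℂ), x))).continuousOn
  set c := ‖complexMGF ξ P ((β₀ : ℂ) * x₀)‖
  have hc : 0 < c := hne x₀ hx₀
  have hopen : IsOpen {p : ℂ × ℝ | c / 2 < ‖complexMGF ξ P (p.1 * p.2)‖} :=
    isOpen_lt continuous_const hcont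
  have hsub : ({(β₀ : ℂ)} : Set ℂ) ×ˢ K ⊆ {p : ℂ × ℝ | c / 2 < ‖complexMGF ξ P (p.1 * p.2)‖} := by
    rintro ⟨p, x⟩ ⟨hp, hx⟩
    simp only [Set.mem_singleton_iff] at hp
    subst hp
    have := hmin hx
    simp only [Set.mem_ofPred_eq] at this ⊢
    linarith
  obtain ⟨u, v, hu, -, hmu, hKv, huv⟩ := generalized_tube_lemma isCompact_singleton hK hopen hsub
  obtain ⟨ε, hε, hball⟩ := Metric.isOpen_iff.mp hu β₀ (hmu rfl)
  refine ⟨ε, hε, c / 2, by positivity, fun β hβ k => ?_⟩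
  have := huv (Set.mk_mem_prod (hball hβ) (hKv (Set.mem_insert_of_mem _ ⟨k, rfl⟩)))
  exact this.le

/-- A lower bound for the complex moment generating function, sharp to second order. -/
lemma exp_le_norm_complexMGF [IsProbabilityMeasure P] (h : HasExpMoments P ξ)
    (hmean : ∫ ω, ξ ω ∂P = 0) (hvar : ∫ ω, ξ ω ^ 2 ∂P = 1) (R : ℝ) {c : ℝ} (hc : 0 < c) :
    ∃ C, 0 ≤ C ∧ ∀ z : ℂ, ‖z‖ ≤ R → c ≤ ‖complexMGF ξ P z‖ →
      Real.exp ((z ^ 2).re / 2 - C * ‖z‖ ^ 3) ≤ ‖complexMGF ξ P z‖ := by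
  obtain ⟨C₀, hC₀, hexp⟩ := h.norm_complexMGF_sub_le hmean hvar R
  -- Below this radius C₀‖z‖ ≤ 1/2 and ‖z‖ ≤ 1/2, so the second order expansion is effective.
  set ρ : ℝ := 1 / (2 * (C₀ + 1)) with hρ
  have hρ0 : 0 < ρ := by positivity
  have hρC : ρ * (C₀ + 1) = 1 / 2 := by rw [hρ]; field_simp
  have hρ1 : ρ ≤ 1 / 2 := by nlinarith
  -- The first summand serves ‖z‖ < ρ. The second makes the exponent at most log c when ‖z‖ ≥ ρ,
  -- where the lower bound c suffices.
  set C₁ : ℝ := (5 * C₀ + 1) + (R ^ 2 + |Real.log c|) / ρ ^ 3 with hC₁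
  have hq : 0 ≤ (R ^ 2 + |Real.log c|) / ρ ^ 3 := by positivity
  have hC₁0 : 0 ≤ C₁ := by positivity
  refine ⟨C₁, hC₁0, fun z hz hcz => ?_⟩
  have hre : |(z ^ 2).re| ≤ ‖z‖ ^ 2 := by
    have := Complex.abs_re_le_norm (z ^ 2); rwa [norm_pow] at this
  set n := ‖z‖ with hn
  have hn0 : 0 ≤ n := norm_nonneg _
  rcases le_or_gt ρ n with hcase | hcase
  · refine le_trans ?_ hcz
    rw [← Real.le_log_iff_exp_le hc]
    have h1 : (R ^ 2 + |Real.log c|) ≤ C₁ * n ^ 3 := by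
      calc (R ^ 2 + |Real.log c|) = (R ^ 2 + |Real.log c|) / ρ ^ 3 * ρ ^ 3 := by field_simp
        _ ≤ C₁ * n ^ 3 := by
          have : ρ ^ 3 ≤ n ^ 3 := by gcongr
          have h5 : (R ^ 2 + |Real.log c|) / ρ ^ 3 ≤ C₁ := by rw [hC₁]; linarith
          gcongr
    have h2 := (abs_le.mp hre).2
    have h3 := neg_abs_le (Real.log c)
    have h4 : n ^ 2 ≤ R ^ 2 := by gcongr
    nlinarith
  · have hlow : 1 + (z ^ 2).re / 2 - C₀ * n ^ 3 ≤ ‖complexMGF ξ P z‖ := by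
      have h1 := hexp z hz
      have h2 : ‖1 + z ^ 2 / 2‖ ≤ ‖complexMGF ξ P z‖ + ‖complexMGF ξ P z - 1 - z ^ 2 / 2‖ := by
        have : 1 + z ^ 2 / 2 = complexMGF ξ P z - (complexMGF ξ P z - 1 - z ^ 2 / 2) := by ring
        rw [this]
        exact norm_sub_le _ _
      have h3 := Complex.re_le_norm (1 + z ^ 2 / 2)
      have h4 : (1 + z ^ 2 / 2).re = 1 + (z ^ 2).re / 2 := by
        simp
      linarith
    refine le_trans ?_ hlow
    set u := (z ^ 2).re / 2 with hu
    have hub : |u| ≤ n ^ 2 / 2 := by rw [hu, abs_div]; norm_num; linarith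
    have hn3 : 0 ≤ n ^ 3 := by positivity
    have hn2 : n ^ 2 ≤ 1 / 4 := by nlinarith
    have hCn : C₀ * n ≤ 1 / 2 := by nlinarith
    have hCn3 : C₀ * n ^ 3 ≤ 1 / 8 := by
      calc C₀ * n ^ 3 = (C₀ * n) * n ^ 2 := by ring
        _ ≤ 1 / 2 * (1 / 4) := by gcongr
        _ = 1 / 8 := by norm_num
    obtain ⟨hu1, hu2⟩ := abs_le.mp hub
    have hC₁5 : 5 * C₀ + 1 ≤ C₁ := by rw [hC₁]; linarith
    have hu3 : u ^ 2 ≤ n ^ 3 / 8 := by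
      have h6 : u ^ 2 ≤ (n ^ 2 / 2) ^ 2 := sq_le_sq' hu1 hu2
      have h7 : (n ^ 2 / 2) ^ 2 = n ^ 3 * n / 4 := by ring
      have : n ^ 3 * n ≤ n ^ 3 * (1 / 2) := by gcongr; linarith
      linarith
    -- Since exp(-y) ≥ 1 - y for y = u - C₁n³, this product inequality gives exp(y) ≤ 1 + u - C₀n³.
    have hprod : 1 ≤ (1 - (u - C₁ * n ^ 3)) * (1 + u - C₀ * n ^ 3) := by
      have h8 : -((C₀ + C₁) * n ^ 3 * (1 / 8)) ≤ (C₀ + C₁) * n ^ 3 * u := by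
        have : 0 ≤ (C₀ + C₁) * n ^ 3 := by positivity
        nlinarith
      have h9 : C₁ * n ^ 3 * (C₀ * n ^ 3) ≤ C₁ * n ^ 3 * (1 / 8) := by gcongr
      have h10 : (5 * C₀ + 1) * n ^ 3 ≤ C₁ * n ^ 3 := by gcongr
      have h11 : 0 ≤ C₀ * n ^ 3 := by positivity
      nlinarith
    have hpos : 0 < 1 + u - C₀ * n ^ 3 := by linarith
    have he := Real.add_one_le_exp (-(u - C₁ * n ^ 3))
    have : 1 ≤ Real.exp (-(u - C₁ * n ^ 3)) * (1 + u - C₀ * n ^ 3) := by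
      refine hprod.trans ?_
      gcongr
      linarith
    rw [Real.exp_neg, inv_mul_eq_div, le_div_iff₀ (Real.exp_pos _)] at this
    linarith

lemma mgf_le_exp [IsProbabilityMeasure P] (h : HasExpMoments P ξ)
    (hmean : ∫ ω, ξ ω ∂P = 0) (hvar : ∫ ω, ξ ω ^ 2 ∂P = 1) (R : ℝ) :
    ∃ C, 0 ≤ C ∧ ∀ x : ℝ, |x| ≤ R → mgf ξ P x ≤ Real.exp (x ^ 2 / 2 + C * |x| ^ 3) := by
  obtain ⟨C₀, hC₀, hexp⟩ := h.norm_complexMGF_sub_le hmean hvar R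
  refine ⟨C₀, hC₀, fun x hx => ?_⟩
  have h1 := hexp x (by simpa using hx)
  rw [complexMGF_ofReal] at h1
  have h2 : ((mgf ξ P x : ℝ) : ℂ) - 1 - (x : ℂ) ^ 2 / 2 = ((mgf ξ P x - 1 - x ^ 2 / 2 : ℝ) : ℂ) := by
    push_cast; ring
  rw [h2, Complex.norm_real, Complex.norm_real, Real.norm_eq_abs, Real.norm_eq_abs] at h1
  have h3 := (abs_le.mp h1).2
  have h4 := Real.add_one_le_exp (x ^ 2 / 2 + C₀ * |x| ^ 3)
  linarith

lemma norm_cexp_div_rpow (q : ℝ) (β w : ℂ) (y : ℝ) :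
    ‖Complex.exp (β * y) / w‖ ^ q = Real.exp (q * β.re * y) / ‖w‖ ^ q := by
  rw [norm_div, Complex.norm_exp, Real.div_rpow (Real.exp_pos _).le (norm_nonneg _),
    ← Real.exp_mul]
  congr 2
  simp; ring

/-- Absolute moments of the normalised exponential `exp(β a ξ) / 𝔼 exp(β a ξ)`. -/
lemma integral_norm_rpow_le [IsProbabilityMeasure P] (h : HasExpMoments P ξ)
    (hmean : ∫ ω, ξ ω ∂P = 0) (hvar : ∫ ω, ξ ω ^ 2 ∂P = 1) {R A c q : ℝ} (hq : 0 ≤ q)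
    (hc : 0 < c) :
    ∃ C, 0 ≤ C ∧ ∀ β : ℂ, ‖β‖ ≤ R → ∀ a : ℝ, 0 ≤ a → a ≤ A → c ≤ ‖complexMGF ξ P (β * a)‖ →
      Integrable (fun ω => ‖Complex.exp (β * a * ξ ω) / complexMGF ξ P (β * a)‖ ^ q) P ∧
      ∫ ω, ‖Complex.exp (β * a * ξ ω) / complexMGF ξ P (β * a)‖ ^ q ∂P
        ≤ Real.exp (momentExponent q β * a ^ 2 + C * a ^ 3) := by
  obtain ⟨C₁, hC₁, h1⟩ := h.exp_le_norm_complexMGF hmean hvar (R * A) hc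
  obtain ⟨C₂, hC₂, h2⟩ := h.mgf_le_exp hmean hvar (q * R * A)
  refine ⟨q * C₁ * |R| ^ 3 + C₂ * (q * |R|) ^ 3, by positivity, fun β hβ a ha haA hca => ?_⟩
  have hR : 0 ≤ R := (norm_nonneg _).trans hβ
  rw [abs_of_nonneg hR]
  simp_rw [norm_cexp_div_rpow]
  have e1 : ∀ ω, q * (β * (a : ℂ)).re * ξ ω = (q * β.re * a) * ξ ω := by
    intro ω; simp only [Complex.mul_re, Complex.ofReal_re, Complex.ofReal_im]; ring
  simp_rw [e1]
  refine ⟨(h.exp _).div_const _, ?_⟩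
  rw [integral_div]
  have hba : ‖β * (a : ℂ)‖ = ‖β‖ * a := by
    rw [norm_mul, Complex.norm_real, Real.norm_eq_abs, abs_of_nonneg ha]
  have g1 := h1 (β * a) (by rw [hba]; gcongr) hca
  have hx : |q * β.re * a| ≤ q * R * a := by
    rw [abs_mul, abs_mul, abs_of_nonneg hq, abs_of_nonneg ha]
    have := (Complex.abs_re_le_norm β).trans hβ
    gcongr
  have g2 := h2 (q * β.re * a) (hx.trans (by gcongr))
  have g3 : Real.exp (q * ((((β * a) ^ 2 : ℂ)).re / 2 - C₁ * ‖β * (a : ℂ)‖ ^ 3))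
      ≤ ‖complexMGF ξ P (β * a)‖ ^ q := by
    rw [mul_comm q, Real.exp_mul]
    exact Real.rpow_le_rpow (Real.exp_pos _).le g1 hq
  have e2 : (((β * a) ^ 2 : ℂ)).re = (β.re ^ 2 - β.im ^ 2) * a ^ 2 := by
    rw [pow_two]; simp; ring
  rw [e2, hba] at g3
  change mgf ξ P (q * β.re * a) / _ ≤ _
  rw [div_le_iff₀ ((Real.exp_pos _).trans_le g3)]
  refine g2.trans (le_trans ?_ (mul_le_mul_of_nonneg_left g3 (Real.exp_pos _).le))
  rw [← Real.exp_add]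
  refine Real.exp_le_exp.mpr ?_
  have g4 : C₂ * |q * β.re * a| ^ 3 ≤ C₂ * (q * R) ^ 3 * a ^ 3 := by
    calc C₂ * |q * β.re * a| ^ 3 ≤ C₂ * (q * R * a) ^ 3 := by gcongr
      _ = _ := by ring
  have g5 : q * C₁ * (‖β‖ * a) ^ 3 ≤ q * C₁ * R ^ 3 * a ^ 3 := by
    calc q * C₁ * (‖β‖ * a) ^ 3 ≤ q * C₁ * (R * a) ^ 3 := by gcongr
      _ = _ := by ring
  unfold momentExponent
  nlinarith

end HasExpMoments
end ScalarExponentialMoments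

section ScalarExponentialMoments
variable {Ω : Type*} [MeasurableSpace Ω] {P : Measure Ω}
namespace HasExpMoments

variable {ξ : Ω → ℝ}
-- The normaliser differs from 1 by O(‖z‖²), so dividing by it preserves the quadratic size of the
-- remainder; c bounds the division.
lemma integral_norm_sq_normalised_remainder_le [IsProbabilityMeasure P] (h : HasExpMoments P ξ)
    (hmean : ∫ ω, ξ ω ∂P = 0) (hvar : ∫ ω, ξ ω ^ 2 ∂P = 1) (R : ℝ) {c : ℝ} (hc : 0 < c) :
    ∃ C, 0 ≤ C ∧ ∀ z : ℂ, ‖z‖ ≤ R → c ≤ ‖complexMGF ξ P z‖ →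
      Integrable (fun ω => ‖Complex.exp (z * ξ ω) / complexMGF ξ P z - 1 - z * ξ ω‖ ^ 2) P ∧
      ∫ ω, ‖Complex.exp (z * ξ ω) / complexMGF ξ P z - 1 - z * ξ ω‖ ^ 2 ∂P ≤ C * ‖z‖ ^ 4 := by
  obtain ⟨C₀, hC₀, h0⟩ := h.norm_complexMGF_sub_le hmean hvar R
  obtain ⟨C₁, hC₁, h1⟩ := h.integral_norm_sq_remainder_le R
  set K : ℝ := 1 / 2 + C₀ * |R| with hK
  refine ⟨(2 * C₁ + 4 * K ^ 2 * (1 + R ^ 2)) / c ^ 2, by positivity, fun z hz hcz => ?_⟩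
  obtain ⟨h2, h3⟩ := h1 z hz
  have hR : 0 ≤ R := (norm_nonneg _).trans hz
  set φ := complexMGF ξ P z with hφ
  have hφ1 : ‖φ - 1‖ ≤ K * ‖z‖ ^ 2 := by
    have e : φ - 1 = (φ - 1 - z ^ 2 / 2) + z ^ 2 / 2 := by ring
    rw [e]
    refine (norm_add_le _ _).trans ?_
    have e2 : ‖z ^ 2 / 2‖ = ‖z‖ ^ 2 / 2 := by simp
    have e3 : C₀ * ‖z‖ ^ 3 ≤ C₀ * |R| * ‖z‖ ^ 2 := by
      rw [abs_of_nonneg hR]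
      calc C₀ * ‖z‖ ^ 3 = C₀ * ‖z‖ * ‖z‖ ^ 2 := by ring
        _ ≤ _ := by gcongr
    have := h0 z hz
    rw [e2, hK]; nlinarith
  have hφ0 : φ ≠ 0 := norm_pos_iff.mp (hc.trans_le hcz)
  have hb : ∀ ω, ‖Complex.exp (z * ξ ω) / φ - 1 - z * ξ ω‖ ^ 2 ≤
      (2 / c ^ 2) * ‖Complex.exp (z * ξ ω) - 1 - z * ξ ω‖ ^ 2
        + (4 * K ^ 2 * ‖z‖ ^ 4 / c ^ 2) * (1 + ‖z‖ ^ 2 * ξ ω ^ 2) := by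
    intro ω
    have e : Complex.exp (z * ξ ω) / φ - 1 - z * ξ ω
        = ((Complex.exp (z * ξ ω) - 1 - z * ξ ω) - (1 + z * ξ ω) * (φ - 1)) / φ := by
      field_simp; ring
    rw [e, norm_div, div_pow]
    have i1 : ‖(Complex.exp (z * ξ ω) - 1 - z * ξ ω) - (1 + z * ξ ω) * (φ - 1)‖ ^ 2
        ≤ 2 * ‖Complex.exp (z * ξ ω) - 1 - z * ξ ω‖ ^ 2
          + 4 * K ^ 2 * ‖z‖ ^ 4 * (1 + ‖z‖ ^ 2 * ξ ω ^ 2) := by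
      have j1 := norm_sub_le (Complex.exp (z * ξ ω) - 1 - z * ξ ω) ((1 + z * ξ ω) * (φ - 1))
      have j2 : ‖(1 + z * ξ ω) * (φ - 1)‖ ≤ (1 + ‖z‖ * |ξ ω|) * (K * ‖z‖ ^ 2) := by
        rw [norm_mul]
        have : ‖1 + z * (ξ ω : ℂ)‖ ≤ 1 + ‖z‖ * |ξ ω| := by
          refine (norm_add_le _ _).trans ?_
          simp
        gcongr
      set A := ‖Complex.exp (z * ξ ω) - 1 - z * ξ ω‖
      have hA : 0 ≤ A := norm_nonneg _
      have j3 := j1.trans (add_le_add_right j2 A)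
      have j4 := pow_le_pow_left₀ (norm_nonneg _) j3 2
      refine j4.trans ?_
      have j5 : (1 + ‖z‖ * |ξ ω|) ^ 2 ≤ 2 * (1 + ‖z‖ ^ 2 * ξ ω ^ 2) := by
        have : |ξ ω| ^ 2 = ξ ω ^ 2 := sq_abs _
        nlinarith [sq_nonneg (1 - ‖z‖ * |ξ ω|)]
      have j6 : ((1 + ‖z‖ * |ξ ω|) * (K * ‖z‖ ^ 2)) ^ 2
          ≤ 2 * (1 + ‖z‖ ^ 2 * ξ ω ^ 2) * (K * ‖z‖ ^ 2) ^ 2 := by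
        rw [mul_pow]; gcongr
      nlinarith [sq_nonneg (A - (1 + ‖z‖ * |ξ ω|) * (K * ‖z‖ ^ 2))]
    have i2 : c ^ 2 ≤ ‖φ‖ ^ 2 := by gcongr
    calc _ ≤ (2 * ‖Complex.exp (z * ξ ω) - 1 - z * ξ ω‖ ^ 2
          + 4 * K ^ 2 * ‖z‖ ^ 4 * (1 + ‖z‖ ^ 2 * ξ ω ^ 2)) / c ^ 2 := by gcongr
      _ = _ := by ring
  have hmeas : AEStronglyMeasurable
      (fun ω => ‖Complex.exp (z * ξ ω) / φ - 1 - z * ξ ω‖ ^ 2) P := by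
    have := Complex.measurable_ofReal.comp h.meas
    have h2 := ((((Complex.measurable_exp.comp (this.const_mul z)).div_const φ).sub_const 1).sub
      (this.const_mul z))
    exact ((measurable_norm.comp h2).pow_const 2).aestronglyMeasurable
  have hi1 := h2.const_mul (2 / c ^ 2)
  have hi2 : Integrable (fun ω => (4 * K ^ 2 * ‖z‖ ^ 4 / c ^ 2) * (1 + ‖z‖ ^ 2 * ξ ω ^ 2)) P :=
    ((integrable_const 1).add ((h.integrable_pow 2).const_mul _)).const_mul _
  refine ⟨(hi1.add hi2).mono' hmeas (ae_of_all _ fun ω => ?_), ?_⟩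
  · rw [Real.norm_eq_abs, abs_of_nonneg (by positivity)]; exact hb ω
  · refine (integral_mono_of_nonneg (ae_of_all _ fun ω => by positivity) (hi1.add hi2)
      (ae_of_all _ hb)).trans ?_
    have e1 : ∫ ω, (1 + ‖z‖ ^ 2 * ξ ω ^ 2) ∂P = 1 + ‖z‖ ^ 2 := by
      rw [integral_add (integrable_const _) ((h.integrable_pow 2).const_mul _),
        integral_const_mul, hvar]
      simp
    rw [integral_add' hi1 hi2, integral_const_mul, integral_const_mul, e1]
    have e2 : ‖z‖ ^ 2 ≤ R ^ 2 := by gcongr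
    calc 2 / c ^ 2 * ∫ ω, ‖Complex.exp (z * ξ ω) - 1 - z * ξ ω‖ ^ 2 ∂P
          + 4 * K ^ 2 * ‖z‖ ^ 4 / c ^ 2 * (1 + ‖z‖ ^ 2)
        ≤ 2 / c ^ 2 * (C₁ * ‖z‖ ^ 4) + 4 * K ^ 2 * ‖z‖ ^ 4 / c ^ 2 * (1 + R ^ 2) := by gcongr
      _ = _ := by ring

end HasExpMoments
end ScalarExponentialMoments

/-! ### Square-integrable random fields and kernels of positive type. -/

section RandomFields

open scoped ENNReal ComplexConjugate

set_option linter.unusedSectionVars false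

lemma measurable_uncurry_field {Ω E : Type*} {m : MeasurableSpace Ω} [MetricSpace E]
    [SecondCountableTopology E] [MeasurableSpace E] [BorelSpace E] {F : Ω → E → ℂ}
    (hc : ∀ ω, Continuous (F ω)) (hm : ∀ x, Measurable fun ω => F ω x) :
    Measurable (fun p : Ω × E => F p.1 p.2) :=
  (measurable_uncurry_of_continuous_of_measurable (u := fun x ω => F ω x) hc hm).comp
    measurable_swap

variable {Ω E : Type*} [mΩ : MeasurableSpace Ω] {P : Measure Ω} [IsProbabilityMeasure P]
  [MetricSpace E] [CompactSpace E] [SecondCountableTopology E] [MeasurableSpace E] [BorelSpace E]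
  {ν : Measure E} [IsProbabilityMeasure ν]

/-- A jointly measurable random field with uniformly bounded second moment. -/
structure L2Field (P : Measure Ω) (F : Ω → E → ℂ) : Prop where
  meas : Measurable (fun p : Ω × E => F p.1 p.2)
  bdd : ∃ c : ℝ≥0∞, c ≠ ∞ ∧ ∀ x, ∫⁻ ω, ‖F ω x‖ₑ ^ 2 ∂P ≤ c

namespace L2Field

variable {F G : Ω → E → ℂ}

lemma meas_right (hF : L2Field P F) (x : E) : Measurable fun ω => F ω x :=
  hF.meas.comp measurable_prodMk_right

lemma memLp (hF : L2Field P F) (x : E) : MemLp (fun ω => F ω x) 2 P := by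
  obtain ⟨c, hc, h⟩ := hF.bdd
  refine ⟨(hF.meas_right x).aestronglyMeasurable, ?_⟩
  rw [eLpNorm_lt_top_iff_lintegral_rpow_enorm_lt_top (by norm_num) (by norm_num)]
  simpa using (h x).trans_lt hc.lt_top

lemma integrable_mul_conj (hF : L2Field P F) (hG : L2Field P G) (x y : E) :
    Integrable (fun ω => F ω x * conj (G ω y)) P :=
  (hF.memLp x).integrable_mul (hG.memLp y).star

lemma exists_bound (hF : L2Field P F) : ∃ c : ℝ, 0 ≤ c ∧ ∀ x, ∫ ω, ‖F ω x‖ ^ 2 ∂P ≤ c := by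
  obtain ⟨c, hc, h⟩ := hF.bdd
  refine ⟨c.toReal, ENNReal.toReal_nonneg, fun x => ?_⟩
  rw [integral_eq_lintegral_of_nonneg_ae (ae_of_all _ fun ω => by positivity)
    ((hF.meas_right x).norm.pow_const 2).aestronglyMeasurable]
  refine ENNReal.toReal_mono hc ((lintegral_congr fun ω => ?_).trans_le (h x))
  rw [ENNReal.ofReal_pow (norm_nonneg _), ofReal_norm]

lemma of_bound (hc : ∀ ω, Continuous (F ω)) (hm : ∀ x, Measurable fun ω => F ω x) {c : ℝ}
    (hi : ∀ x, Integrable (fun ω => ‖F ω x‖ ^ 2) P) (h : ∀ x, ∫ ω, ‖F ω x‖ ^ 2 ∂P ≤ c) :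
    L2Field P F := by
  refine ⟨measurable_uncurry_field hc hm, ENNReal.ofReal c, ENNReal.ofReal_ne_top, fun x => ?_⟩
  have : ∫⁻ ω, ‖F ω x‖ₑ ^ 2 ∂P = ENNReal.ofReal (∫ ω, ‖F ω x‖ ^ 2 ∂P) := by
    rw [ofReal_integral_eq_lintegral_ofReal (hi x) (ae_of_all _ fun ω => by positivity)]
    refine lintegral_congr fun ω => ?_
    rw [ENNReal.ofReal_pow (norm_nonneg _), ofReal_norm]
  rw [this]
  exact ENNReal.ofReal_le_ofReal (h x)

lemma add (hF : L2Field P F) (hG : L2Field P G) : L2Field P fun ω x => F ω x + G ω x := by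
  obtain ⟨c, hc, h⟩ := hF.bdd
  obtain ⟨c', hc', h'⟩ := hG.bdd
  refine ⟨hF.meas.add hG.meas, 2 * (c + c'), by finiteness, fun x => ?_⟩
  have hb : ∀ ω, ‖F ω x + G ω x‖ₑ ^ 2 ≤ 2 * (‖F ω x‖ₑ ^ 2 + ‖G ω x‖ₑ ^ 2) := by
    intro ω
    have h1 : ‖F ω x + G ω x‖ ^ 2 ≤ 2 * (‖F ω x‖ ^ 2 + ‖G ω x‖ ^ 2) := by
      have := norm_add_le (F ω x) (G ω x)
      nlinarith [norm_nonneg (F ω x + G ω x), sq_nonneg (‖F ω x‖ - ‖G ω x‖)]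
    have h2 := ENNReal.ofReal_le_ofReal h1
    rwa [ENNReal.ofReal_mul (by norm_num), ENNReal.ofReal_add (by positivity) (by positivity),
      ENNReal.ofReal_pow (norm_nonneg _), ENNReal.ofReal_pow (norm_nonneg _),
      ENNReal.ofReal_pow (norm_nonneg _), ofReal_norm, ofReal_norm,
      ofReal_norm, ENNReal.ofReal_ofNat] at h2
  have m1 := (hF.meas_right x).enorm.pow_const 2
  refine (lintegral_mono hb).trans ?_
  rw [lintegral_const_mul' _ _ (by norm_num), lintegral_add_left m1]
  gcongr
  exacts [h x, h' x]

lemma const_mul (hF : L2Field P F) (r : ℂ) : L2Field P fun ω x => r * F ω x := by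
  obtain ⟨c, hc, h⟩ := hF.bdd
  refine ⟨hF.meas.const_mul r, ‖r‖ₑ ^ 2 * c, by finiteness, fun x => ?_⟩
  simp_rw [enorm_mul, mul_pow]
  rw [lintegral_const_mul' _ _ (by finiteness)]
  gcongr
  exact h x

lemma const (r : ℂ) : L2Field P (fun (_ : Ω) (_ : E) => r) :=
  ⟨measurable_const, ‖r‖ₑ ^ 2, by finiteness, fun x => by simp⟩

lemma memLp_prod_left (hF : L2Field P F) :
    MemLp (fun p : Ω × (E × E) => F p.1 p.2.1) 2 (P.prod (ν.prod ν)) := by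
  obtain ⟨c, hc, h⟩ := hF.bdd
  have hm : Measurable (fun p : Ω × (E × E) => F p.1 p.2.1) :=
    hF.meas.comp (measurable_fst.prodMk (measurable_fst.comp measurable_snd))
  refine ⟨hm.aestronglyMeasurable, ?_⟩
  rw [eLpNorm_lt_top_iff_lintegral_rpow_enorm_lt_top (by norm_num) (by norm_num)]
  refine lt_of_le_of_lt ?_ hc.lt_top
  rw [lintegral_prod_symm' _ (hm.enorm.pow_const _)]
  calc _ ≤ ∫⁻ _ : E × E, c ∂(ν.prod ν) := by
        refine lintegral_mono fun z => ?_
        simpa using h z.1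
    _ = c := by simp

lemma memLp_prod_right (hF : L2Field P F) :
    MemLp (fun p : Ω × (E × E) => F p.1 p.2.2) 2 (P.prod (ν.prod ν)) := by
  obtain ⟨c, hc, h⟩ := hF.bdd
  have hm : Measurable (fun p : Ω × (E × E) => F p.1 p.2.2) :=
    hF.meas.comp (measurable_fst.prodMk (measurable_snd.comp measurable_snd))
  refine ⟨hm.aestronglyMeasurable, ?_⟩
  rw [eLpNorm_lt_top_iff_lintegral_rpow_enorm_lt_top (by norm_num) (by norm_num)]
  refine lt_of_le_of_lt ?_ hc.lt_top
  rw [lintegral_prod_symm' _ (hm.enorm.pow_const _)]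
  calc _ ≤ ∫⁻ _ : E × E, c ∂(ν.prod ν) := by
        refine lintegral_mono fun z => ?_
        simpa using h z.2
    _ = c := by simp

/-- Cauchy–Schwarz on Ω × (E × E). This justifies exchanging expectation and kernel pairing; the
weight `B` plays the role of a bounded test variable measurable with respect to the past. -/
lemma integrable_prod (hF : L2Field P F) (hG : L2Field P G) {Γ : E × E → ℂ} (hΓ : Measurable Γ)
    {g : ℝ} (hg : ∀ z, ‖Γ z‖ ≤ g) {B : Ω → ℂ} (hB : Measurable B) {b : ℝ} (hb : ∀ ω, ‖B ω‖ ≤ b) :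
    Integrable (fun p : Ω × (E × E) => B p.1 * (Γ p.2 * (F p.1 p.2.1 * conj (G p.1 p.2.2))))
      (P.prod (ν.prod ν)) := by
  have h := (hF.memLp_prod_left (ν := ν)).integrable_mul (hG.memLp_prod_right (ν := ν)).star
  refine ((h.bdd_mul (c := g) (hΓ.comp measurable_snd).aestronglyMeasurable
    (ae_of_all _ fun p => hg _)).bdd_mul (c := b)
    (hB.comp measurable_fst).aestronglyMeasurable (ae_of_all _ fun p => hb _))

end L2Field

/-- The sesquilinear pairing of two fields through a kernel. -/
noncomputable def kernelPairing (ν : Measure E) (Γ : E × E → ℂ) (v w : E → ℂ) : ℂ :=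
  ∫ z, Γ z * (v z.1 * conj (w z.2)) ∂(ν.prod ν)

namespace L2Field

variable {F G : Ω → E → ℂ} {Γ : E × E → ℂ} {g b : ℝ} {B : Ω → ℂ}

lemma integral_mul_kernelPairing (hF : L2Field P F) (hG : L2Field P G) (hΓ : Measurable Γ)
    (hg : ∀ z, ‖Γ z‖ ≤ g) (hB : Measurable B) (hb : ∀ ω, ‖B ω‖ ≤ b) :
    ∫ ω, B ω * kernelPairing ν Γ (F ω) (G ω) ∂P
      = ∫ z, Γ z * ∫ ω, B ω * (F ω z.1 * conj (G ω z.2)) ∂P ∂(ν.prod ν) := by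
  have h := hF.integrable_prod (ν := ν) hG hΓ hg hB hb
  unfold kernelPairing
  simp_rw [← integral_const_mul]
  rw [integral_integral_swap h]
  refine integral_congr_ae (ae_of_all _ fun z => ?_)
  refine integral_congr_ae (ae_of_all _ fun ω => ?_)
  simp only; ring

lemma integrable_mul_kernelPairing (hF : L2Field P F) (hG : L2Field P G) (hΓ : Measurable Γ)
    (hg : ∀ z, ‖Γ z‖ ≤ g) (hB : Measurable B) (hb : ∀ ω, ‖B ω‖ ≤ b) :
    Integrable (fun ω => B ω * kernelPairing ν Γ (F ω) (G ω)) P := by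
  have h := (hF.integrable_prod (ν := ν) hG hΓ hg hB hb).integral_prod_left
  simpa only [kernelPairing, integral_const_mul] using h

lemma integrable_kernelPairing (hF : L2Field P F) (hG : L2Field P G) (hΓ : Measurable Γ)
    (hg : ∀ z, ‖Γ z‖ ≤ g) :
    Integrable (fun ω => kernelPairing ν Γ (F ω) (G ω)) P := by
  simpa using hF.integrable_mul_kernelPairing (ν := ν) hG hΓ hg (B := fun _ => 1)
    measurable_const (b := 1) (by simp)

lemma integrable_kernel_integral (hF : L2Field P F) (hG : L2Field P G) (hΓ : Measurable Γ)
    (hg : ∀ z, ‖Γ z‖ ≤ g) (hB : Measurable B) (hb : ∀ ω, ‖B ω‖ ≤ b) :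
    Integrable (fun z : E × E => Γ z * ∫ ω, B ω * (F ω z.1 * conj (G ω z.2)) ∂P) (ν.prod ν) := by
  have h := (hF.integrable_prod (ν := ν) hG hΓ hg hB hb).integral_prod_right
  refine h.congr (ae_of_all _ fun z => ?_)
  simp only [← integral_const_mul]
  refine integral_congr_ae (ae_of_all _ fun ω => ?_)
  simp only; ring

/-- The covariance kernel of a random field. -/
lemma measurable_cov (hF : L2Field P F) (hG : L2Field P G) :
    Measurable fun z : E × E => ∫ ω, F ω z.1 * conj (G ω z.2) ∂P := by
  have h : Measurable fun p : (E × E) × Ω => F p.2 p.1.1 * conj (G p.2 p.1.2) := by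
    have h1 : Measurable fun p : (E × E) × Ω => F p.2 p.1.1 :=
      hF.meas.comp (measurable_snd.prodMk (measurable_fst.comp measurable_fst))
    have h2 : Measurable fun p : (E × E) × Ω => G p.2 p.1.2 :=
      hG.meas.comp (measurable_snd.prodMk (measurable_snd.comp measurable_fst))
    exact h1.mul (Complex.continuous_conj.measurable.comp h2)
  exact (h.stronglyMeasurable.integral_prod_right (ν := P)).measurable

lemma norm_cov_le (hF : L2Field P F) (hG : L2Field P G) {c c' : ℝ}
    (hc : ∀ x, ∫ ω, ‖F ω x‖ ^ 2 ∂P ≤ c) (hc' : ∀ x, ∫ ω, ‖G ω x‖ ^ 2 ∂P ≤ c') (x y : E) :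
    ∫ ω, ‖F ω x‖ * ‖G ω y‖ ∂P ≤ (c + c') / 2 := by
  have i1 : Integrable (fun ω => ‖F ω x‖ ^ 2) P :=
    (memLp_two_iff_integrable_sq_norm (hF.memLp x).1).mp (hF.memLp x)
  have i2 : Integrable (fun ω => ‖G ω y‖ ^ 2) P :=
    (memLp_two_iff_integrable_sq_norm (hG.memLp y).1).mp (hG.memLp y)
  calc ∫ ω, ‖F ω x‖ * ‖G ω y‖ ∂P ≤ ∫ ω, (‖F ω x‖ ^ 2 + ‖G ω y‖ ^ 2) / 2 ∂P := by
        refine integral_mono_of_nonneg (ae_of_all _ fun ω => by positivity)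
          ((i1.add i2).div_const 2) (ae_of_all _ fun ω => ?_)
        simp only
        nlinarith [sq_nonneg (‖F ω x‖ - ‖G ω y‖)]
    _ ≤ (c + c') / 2 := by
        rw [integral_div, integral_add i1 i2]
        have := hc x; have := hc' y; linarith

end L2Field

/-- Bounded measurable kernels of positive type on continuous functions. -/
structure PosKernel (ν : Measure E) (Γ : E × E → ℂ) : Prop where
  meas : Measurable Γ
  bdd : ∃ g : ℝ, ∀ z, ‖Γ z‖ ≤ g
  pos : ∀ w : E → ℂ, Continuous w → 0 ≤ (kernelPairing ν Γ w w).re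

lemma integrable_kernelPairing_const {Γ : E × E → ℂ} (hΓ : Measurable Γ) {g : ℝ}
    (hg : ∀ z, ‖Γ z‖ ≤ g) {v w : E → ℂ} (hv : Continuous v) (hw : Continuous w) :
    Integrable (fun z => Γ z * (v z.1 * conj (w z.2))) (ν.prod ν) := by
  have h : Continuous fun z : E × E => v z.1 * conj (w z.2) := by fun_prop
  have hK : HasCompactSupport fun z : E × E => v z.1 * conj (w z.2) :=
    HasCompactSupport.of_compactSpace _
  exact (h.integrable_of_hasCompactSupport hK).bdd_mul (c := g) hΓ.aestronglyMeasurable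
    (ae_of_all _ hg)

namespace PosKernel

variable {Γ Γ' : E × E → ℂ}

lemma add (h : PosKernel ν Γ) (h' : PosKernel ν Γ') : PosKernel ν fun z => Γ z + Γ' z := by
  obtain ⟨g, hg⟩ := h.bdd
  obtain ⟨g', hg'⟩ := h'.bdd
  refine ⟨h.meas.add h'.meas, ⟨g + g', fun z => (norm_add_le _ _).trans (add_le_add (hg z) (hg' z))⟩,
    fun w hw => ?_⟩
  have e : kernelPairing ν (fun z => Γ z + Γ' z) w w
      = kernelPairing ν Γ w w + kernelPairing ν Γ' w w := by
    unfold kernelPairing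
    rw [← integral_add (integrable_kernelPairing_const h.meas hg hw hw)
      (integrable_kernelPairing_const h'.meas hg' hw hw)]
    simp_rw [add_mul]
  rw [e, Complex.add_re]
  exact add_nonneg (h.pos w hw) (h'.pos w hw)

lemma const_mul (h : PosKernel ν Γ) {r : ℝ} (hr : 0 ≤ r) : PosKernel ν fun z => (r : ℂ) * Γ z := by
  obtain ⟨g, hg⟩ := h.bdd
  refine ⟨h.meas.const_mul _, ⟨r * g, fun z => ?_⟩, fun w hw => ?_⟩
  · rw [norm_mul, Complex.norm_real, Real.norm_eq_abs, abs_of_nonneg hr]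
    gcongr; exact hg z
  · have e : kernelPairing ν (fun z => (r : ℂ) * Γ z) w w = r * kernelPairing ν Γ w w := by
      unfold kernelPairing
      rw [← integral_const_mul]
      simp_rw [mul_assoc]
    rw [e, Complex.re_ofReal_mul]
    exact mul_nonneg hr (h.pos w hw)

/-- Products with covariance kernels of continuous random fields. -/
lemma mul_cov (h : PosKernel ν Γ) {F : Ω → E → ℂ} (hF : L2Field P F)
    (hc : ∀ ω, Continuous (F ω)) :
    PosKernel ν fun z => Γ z * ∫ ω, F ω z.1 * conj (F ω z.2) ∂P := by
  obtain ⟨g, hg⟩ := h.bdd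
  obtain ⟨c, hc0, hFc⟩ := hF.exists_bound
  refine ⟨h.meas.mul (hF.measurable_cov hF), ⟨g * c, fun z => ?_⟩, fun w hw => ?_⟩
  · rw [norm_mul]
    have : ‖∫ ω, F ω z.1 * conj (F ω z.2) ∂P‖ ≤ c := by
      refine (norm_integral_le_integral_norm _).trans ?_
      have := hF.norm_cov_le hF hFc hFc z.1 z.2
      simp only [norm_mul, RCLike.norm_conj]
      linarith
    have hg0 : 0 ≤ g := (norm_nonneg _).trans (hg z)
    gcongr
    exact hg z
  · obtain ⟨M, hM⟩ : ∃ M, ∀ x, ‖w x‖ ≤ M := by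
      obtain ⟨M, hM⟩ := (isCompact_range hw).isBounded.exists_norm_le
      exact ⟨M, fun x => hM _ ⟨x, rfl⟩⟩
    have hwF : Measurable fun z : E × E => Γ z * (w z.1 * conj (w z.2)) :=
      h.meas.mul ((hw.measurable.comp measurable_fst).mul
        (Complex.continuous_conj.measurable.comp (hw.measurable.comp measurable_snd)))
    have hbd : ∀ z : E × E, ‖Γ z * (w z.1 * conj (w z.2))‖ ≤ g * (M * M) := by
      intro z
      rw [norm_mul, norm_mul, RCLike.norm_conj]
      have := (norm_nonneg _).trans (hg z)
      have := (norm_nonneg _).trans (hM z.1)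
      gcongr
      exacts [hg z, hM _, hM _]
    -- A Schur product theorem: by Fubini the product kernel pairs as the mean of pairings of `Γ`
    -- with the continuous random functions w·F(ω), each of nonnegative real part.
    have e : kernelPairing ν (fun z => Γ z * ∫ ω, F ω z.1 * conj (F ω z.2) ∂P) w w
        = ∫ ω, kernelPairing ν Γ (fun x => w x * F ω x) (fun x => w x * F ω x) ∂P := by
      have := hF.integral_mul_kernelPairing (ν := ν) hF hwF hbd (B := fun _ => 1)
        measurable_const (b := 1) (by simp)
      simp only [one_mul] at this
      unfold kernelPairing at this ⊢
      simp only [map_mul]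
      rw [show (fun z : E × E => (Γ z * ∫ ω, F ω z.1 * conj (F ω z.2) ∂P) * (w z.1 * conj (w z.2)))
        = fun z => Γ z * (w z.1 * conj (w z.2)) * ∫ ω, F ω z.1 * conj (F ω z.2) ∂P by
          funext z; ring, ← this]
      refine integral_congr_ae (ae_of_all _ fun ω => ?_)
      refine integral_congr_ae (ae_of_all _ fun z => ?_)
      simp only; ring
    have hint : Integrable
        (fun ω => kernelPairing ν Γ (fun x => w x * F ω x) (fun x => w x * F ω x)) P := by
      have := hF.integrable_kernelPairing (ν := ν) hF hwF hbd
      refine this.congr (ae_of_all _ fun ω => ?_)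
      unfold kernelPairing
      refine integral_congr_ae (ae_of_all _ fun z => ?_)
      simp only [map_mul]; ring
    rw [e, ← RCLike.re_eq_complex_re, ← integral_re hint]
    exact integral_nonneg fun ω => h.pos _ (hw.mul (hc ω))

/-- Rank one kernels. -/
lemma rankOne {g : E → ℂ} (hg : Continuous g) : PosKernel ν fun z => g z.1 * conj (g z.2) := by
  obtain ⟨M, hM⟩ := (isCompact_range hg).isBounded.exists_norm_le
  have hM' : ∀ x, ‖g x‖ ≤ M := fun x => hM _ ⟨x, rfl⟩
  refine ⟨by fun_prop, ⟨M * M, fun z => ?_⟩, fun w hw => ?_⟩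
  · rw [norm_mul, RCLike.norm_conj]
    have := (norm_nonneg _).trans (hM' z.1)
    gcongr <;> exact hM' _
  · have e : kernelPairing ν (fun z => g z.1 * conj (g z.2)) w w
        = (∫ x, g x * w x ∂ν) * conj (∫ x, g x * w x ∂ν) := by
      unfold kernelPairing
      rw [← integral_conj, ← integral_prod_mul]
      refine integral_congr_ae (ae_of_all _ fun z => ?_)
      simp only [map_mul]; ring
    rw [e, Complex.mul_conj]
    exact Complex.normSq_nonneg _

end PosKernel

end RandomFields

/-! ### Products of independent multiplicative steps and the covariance of one step. -/

section StepSystems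

open scoped ENNReal ComplexConjugate

set_option linter.unusedSectionVars false

variable {Ω E : Type*} [mΩ : MeasurableSpace Ω] {P : Measure Ω} [IsProbabilityMeasure P]
  [MetricSpace E] [CompactSpace E] [SecondCountableTopology E] [MeasurableSpace E] [BorelSpace E]
  {ν : Measure E} [IsProbabilityMeasure ν]

/-- The product `V 0 ⋯ V (n-1)` of random fields. -/
noncomputable def density (V : ℕ → Ω → E → ℂ) (n : ℕ) (ω : Ω) (x : E) : ℂ :=
  ∏ k ∈ Finset.range n, V k ω x

/-- The intrinsic time `a 0 ^ 2 + ⋯ + a (n-1) ^ 2`. -/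
noncomputable def clock (a : ℕ → ℝ) (n : ℕ) : ℝ := ∑ k ∈ Finset.range n, a k ^ 2

/-- Independent multiplicative steps `V k = 1 + u k + h k` with unit mean, where `u k` has
covariance controlled by a kernel, and `h k` is quadratically small. -/
structure StepSystem (P : Measure Ω) (𝓕 𝓖 : ℕ → MeasurableSpace Ω) (a : ℕ → ℝ) (C : ℝ)
    (near : ℕ → E × E → ℝ) (V u : ℕ → Ω → E → ℂ) : Prop where
  mono : Monotone 𝓕
  le : ∀ k, 𝓕 k ≤ mΩ
  le_succ : ∀ k, 𝓖 k ≤ 𝓕 (k + 1)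
  indep : ∀ k, Indep (𝓕 k) (𝓖 k) P
  a_pos : ∀ k, 0 < a k
  a_le : ∀ k, a k ≤ C
  V_cont : ∀ k ω, Continuous (V k ω)
  V_meas : ∀ k x, Measurable[𝓖 k] fun ω => V k ω x
  V_mean : ∀ k x, ∫ ω, V k ω x ∂P = 1
  V_int : ∀ k x, Integrable (fun ω => ‖V k ω x‖ ^ 2) P
  V_sq : ∀ k x, ∫ ω, ‖V k ω x‖ ^ 2 ∂P ≤ Real.exp (C * a k ^ 2)
  u_cont : ∀ k ω, Continuous (u k ω)
  u_meas : ∀ k x, Measurable[𝓖 k] fun ω => u k ω x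
  h_int : ∀ k x, Integrable (fun ω => ‖V k ω x - 1 - u k ω x‖ ^ 2) P
  h_sq : ∀ k x, ∫ ω, ‖V k ω x - 1 - u k ω x‖ ^ 2 ∂P ≤ C * a k ^ 4
  near_meas : ∀ m, Measurable (near m)
  near_nonneg : ∀ m z, 0 ≤ near m z
  near_le : ∀ m z, near m z ≤ C
  -- One kernel `near m` controls every later step, so a whole block of steps can be estimated from
  -- its starting time m.
  u_cov : ∀ m k, m ≤ k → ∀ x y, ‖∫ ω, u k ω x * conj (u k ω y) ∂P‖ ≤ C * a k ^ 2 * near m (x, y)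

/-- The kernel of the quadratic remainder. -/
noncomputable def remainderKernel (P : Measure Ω) (a : ℕ → ℝ) (V u : ℕ → Ω → E → ℂ) (k : ℕ)
    (z : E × E) : ℂ :=
  ((1 + 1 / a k : ℝ) : ℂ) *
    ∫ ω, (V k ω z.1 - 1 - u k ω z.1) * conj (V k ω z.2 - 1 - u k ω z.2) ∂P

namespace StepSystem

variable {𝓕 𝓖 : ℕ → MeasurableSpace Ω} {a : ℕ → ℝ} {C : ℝ} {near : ℕ → E × E → ℝ}
  {V u : ℕ → Ω → E → ℂ}

lemma G_le (hs : StepSystem P 𝓕 𝓖 a C near V u) (k : ℕ) : 𝓖 k ≤ mΩ :=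
  (hs.le_succ k).trans (hs.le _)

lemma C_pos (hs : StepSystem P 𝓕 𝓖 a C near V u) : 0 < C := (hs.a_pos 0).trans_le (hs.a_le 0)

lemma density_continuous (hs : StepSystem P 𝓕 𝓖 a C near V u) (n : ℕ) (ω : Ω) :
    Continuous (density V n ω) :=
  continuous_finsetProd _ fun k _ => hs.V_cont k ω

lemma density_measurable (hs : StepSystem P 𝓕 𝓖 a C near V u) (n : ℕ) (x : E) :
    Measurable[𝓕 n] fun ω => density V n ω x := by
  unfold density
  refine Finset.measurable_fun_prod _ fun k hk => ?_
  exact (hs.V_meas k x).mono ((hs.le_succ k).trans (hs.mono (Finset.mem_range.mp hk))) le_rfl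

lemma density_succ (n : ℕ) (ω : Ω) (x : E) :
    density V (n + 1) ω x = density V n ω x * V n ω x := Finset.prod_range_succ _ _

lemma integral_mul (hs : StepSystem P 𝓕 𝓖 a C near V u) {k : ℕ} {F G : Ω → ℂ}
    (hF : Measurable[𝓕 k] F) (hG : Measurable[𝓖 k] G) :
    ∫ ω, F ω * G ω ∂P = (∫ ω, F ω ∂P) * ∫ ω, G ω ∂P := by
  have hi : IndepFun F G P :=
    indep_of_indep_of_le_left (indep_of_indep_of_le_right (hs.indep k) hG.comap_le) hF.comap_le
  exact hi.integral_fun_mul_eq_mul_integral (hF.mono (hs.le k) le_rfl).aestronglyMeasurable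
    (hG.mono (hs.G_le k) le_rfl).aestronglyMeasurable

lemma integral_mul_real (hs : StepSystem P 𝓕 𝓖 a C near V u) {k : ℕ} {F G : Ω → ℝ}
    (hF : Measurable[𝓕 k] F) (hG : Measurable[𝓖 k] G) :
    ∫ ω, F ω * G ω ∂P = (∫ ω, F ω ∂P) * ∫ ω, G ω ∂P := by
  have hi : IndepFun F G P :=
    indep_of_indep_of_le_left (indep_of_indep_of_le_right (hs.indep k) hG.comap_le) hF.comap_le
  exact hi.integral_fun_mul_eq_mul_integral (hF.mono (hs.le k) le_rfl).aestronglyMeasurable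
    (hG.mono (hs.G_le k) le_rfl).aestronglyMeasurable

lemma lintegral_density_rpow_le (hs : StepSystem P 𝓕 𝓖 a C near V u) {q : ℝ} (hq : 0 ≤ q)
    {M : ℕ → ℝ≥0∞} (hM : ∀ k x, ∫⁻ ω, ‖V k ω x‖ₑ ^ q ∂P ≤ M k) (n : ℕ) (x : E) :
    ∫⁻ ω, ‖density V n ω x‖ₑ ^ q ∂P ≤ ∏ k ∈ Finset.range n, M k := by
  induction n with
  | zero => simp [density]
  | succ n ih =>
    simp_rw [density_succ, enorm_mul, ENNReal.mul_rpow_of_nonneg _ _ hq]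
    have h1 : Measurable[𝓕 n] fun ω => ‖density V n ω x‖ₑ ^ q :=
      (measurable_enorm.comp (hs.density_measurable n x)).pow_const q
    have h2 : Measurable[𝓖 n] fun ω => ‖V n ω x‖ₑ ^ q := (measurable_enorm.comp (hs.V_meas n x)).pow_const q
    rw [lintegral_mul_eq_lintegral_mul_lintegral_of_independent_measurableSpace (hs.le n)
      (hs.G_le n) (hs.indep n) h1 h2, Finset.prod_range_succ]
    gcongr
    exact hM n x

lemma V_field (hs : StepSystem P 𝓕 𝓖 a C near V u) (k : ℕ) : L2Field P (V k) :=
  .of_bound (hs.V_cont k) (fun x => (hs.V_meas k x).mono (hs.G_le k) le_rfl) (hs.V_int k) (hs.V_sq k)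

lemma h_field (hs : StepSystem P 𝓕 𝓖 a C near V u) (k : ℕ) :
    L2Field P fun ω x => V k ω x - 1 - u k ω x :=
  .of_bound (fun ω => ((hs.V_cont k ω).sub continuous_const).sub (hs.u_cont k ω))
    (fun x => (((hs.V_meas k x).mono (hs.G_le k) le_rfl).sub_const 1).sub
      ((hs.u_meas k x).mono (hs.G_le k) le_rfl)) (hs.h_int k) (hs.h_sq k)

lemma u_field (hs : StepSystem P 𝓕 𝓖 a C near V u) (k : ℕ) : L2Field P (u k) := by
  have := ((hs.V_field k).add (.const (-1))).add ((hs.h_field k).const_mul (-1))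
  convert this using 3
  ring

/-- Only finiteness for each fixed n: the bound is a product over the steps and may grow with n. -/
lemma density_field (hs : StepSystem P 𝓕 𝓖 a C near V u) (n : ℕ) : L2Field P (density V n) := by
  refine ⟨measurable_uncurry_field (hs.density_continuous n)
    fun x => (hs.density_measurable n x).mono (hs.le n) le_rfl, ?_⟩
  choose c hc hV using fun k => (hs.V_field k).bdd
  refine ⟨∏ k ∈ Finset.range n, c k, ENNReal.prod_ne_top fun k _ => hc k, fun x => ?_⟩
  have := hs.lintegral_density_rpow_le (q := 2) (by norm_num) (M := c)
    (fun k x => by simpa using hV k x) n x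
  simpa using this

lemma cov_step (hs : StepSystem P 𝓕 𝓖 a C near V u) {m k : ℕ} (hmk : m ≤ k) {B : Ω → ℂ}
    (hB : Measurable[𝓕 m] B) (x y : E) :
    ∫ ω, B ω * (density V (k + 1) ω x * conj (density V (k + 1) ω y)) ∂P
      = (∫ ω, B ω * (density V k ω x * conj (density V k ω y)) ∂P)
        * ∫ ω, V k ω x * conj (V k ω y) ∂P := by
  rw [← hs.integral_mul (k := k)]
  · refine integral_congr_ae (ae_of_all _ fun ω => ?_)
    simp only [density_succ, map_mul]; ring
  · exact (hB.mono (hs.mono hmk) le_rfl).mul ((hs.density_measurable k x).mul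
      (Complex.continuous_conj.measurable.comp (hs.density_measurable k y)))
  · exact (hs.V_meas k x).mul (Complex.continuous_conj.measurable.comp (hs.V_meas k y))

/-- Only the left factor advances, and the new step has mean one and is independent of everything
else: this is the martingale property in weak form. -/
lemma cov_step_left (hs : StepSystem P 𝓕 𝓖 a C near V u) {m n k : ℕ} (hmk : m ≤ k) (hnk : n ≤ k)
    {B : Ω → ℂ} (hB : Measurable[𝓕 m] B) (x y : E) :
    ∫ ω, B ω * (density V (k + 1) ω x * conj (density V n ω y)) ∂P
      = ∫ ω, B ω * (density V k ω x * conj (density V n ω y)) ∂P := by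
  have h := hs.integral_mul (k := k)
    (F := fun ω => B ω * (density V k ω x * conj (density V n ω y))) (G := fun ω => V k ω x)
    ((hB.mono (hs.mono hmk) le_rfl).mul ((hs.density_measurable k x).mul
      (Complex.continuous_conj.measurable.comp
        ((hs.density_measurable n y).mono (hs.mono hnk) le_rfl)))) (hs.V_meas k x)
  rw [hs.V_mean, mul_one] at h
  rw [← h]
  refine integral_congr_ae (ae_of_all _ fun ω => ?_)
  simp only [density_succ]; ring

/-- A crude growth bound, harmless because it is used only within a block, where the clock advances
by a bounded amount. -/
lemma integral_norm_step_le (hs : StepSystem P 𝓕 𝓖 a C near V u) {m k : ℕ} (hmk : m ≤ k)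
    {B : Ω → ℝ} (hB : Measurable[𝓕 m] B) (hB0 : ∀ ω, 0 ≤ B ω) (x y : E) :
    ∫ ω, B ω * (‖density V k ω x‖ * ‖density V k ω y‖) ∂P
      ≤ Real.exp (C * (clock a k - clock a m))
        * ∫ ω, B ω * (‖density V m ω x‖ * ‖density V m ω y‖) ∂P := by
  induction k, hmk using Nat.le_induction with
  | base => simp
  | succ k hk ih =>
    have h := hs.integral_mul_real (k := k)
      (F := fun ω => B ω * (‖density V k ω x‖ * ‖density V k ω y‖))
      (G := fun ω => ‖V k ω x‖ * ‖V k ω y‖)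
      ((hB.mono (hs.mono hk) le_rfl).mul ((measurable_norm.comp (hs.density_measurable k x)).mul
        (measurable_norm.comp (hs.density_measurable k y)))) ((measurable_norm.comp (hs.V_meas k x)).mul (measurable_norm.comp (hs.V_meas k y)))
    have e : ∫ ω, B ω * (‖density V (k + 1) ω x‖ * ‖density V (k + 1) ω y‖) ∂P
        = ∫ ω, (B ω * (‖density V k ω x‖ * ‖density V k ω y‖)) * (‖V k ω x‖ * ‖V k ω y‖) ∂P := by
      refine integral_congr_ae (ae_of_all _ fun ω => ?_)
      simp only [density_succ, norm_mul]; ring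
    rw [e, h]
    have hV := (hs.V_field k).norm_cov_le (hs.V_field k) (hs.V_sq k) (hs.V_sq k) x y
    have h0 : 0 ≤ ∫ ω, B ω * (‖density V k ω x‖ * ‖density V k ω y‖) ∂P :=
      integral_nonneg fun ω => mul_nonneg (hB0 ω) (by positivity)
    have hc : clock a (k + 1) = clock a k + a k ^ 2 := Finset.sum_range_succ _ _
    calc _ ≤ (∫ ω, B ω * (‖density V k ω x‖ * ‖density V k ω y‖) ∂P) * Real.exp (C * a k ^ 2) := by
          gcongr; linarith
      _ ≤ (Real.exp (C * (clock a k - clock a m))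
        * ∫ ω, B ω * (‖density V m ω x‖ * ‖density V m ω y‖) ∂P) * Real.exp (C * a k ^ 2) := by
          gcongr
      _ = _ := by
        rw [hc, show C * (clock a k + a k ^ 2 - clock a m)
          = C * (clock a k - clock a m) + C * a k ^ 2 by ring, Real.exp_add]
        ring

/-- Domination of the covariance of a step: completing the square in the mixed terms. -/
lemma cov_V_eq (hs : StepSystem P 𝓕 𝓖 a C near V u) (k : ℕ) :
    ∃ ξ : Ω → E → ℂ, L2Field P ξ ∧ (∀ ω, Continuous (ξ ω)) ∧ ∀ z : E × E,
      ∫ ω, V k ω z.1 * conj (V k ω z.2) ∂P = 1 + remainderKernel P a V u k z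
        + (1 + a k : ℝ) * (∫ ω, u k ω z.1 * conj (u k ω z.2) ∂P)
        - ∫ ω, ξ ω z.1 * conj (ξ ω z.2) ∂P := by
  have ha := hs.a_pos k
  -- With h = V - 1 - u and ξ = h/r - r u, one has (u+h)(u+h)* = (1+1/a)hh* + (1+a)uu* - ξξ*. The
  -- weight r² = a spends one of the four powers of a in Cov(h) to make the coefficient of Cov(u)
  -- only 1 + a.
  set r : ℝ := √(a k) with hr
  have hr0 : 0 < r := Real.sqrt_pos.mpr ha
  have hra : a k = r ^ 2 := (Real.sq_sqrt ha.le).symm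
  refine ⟨fun ω x => ((1 / r : ℝ) : ℂ) * (V k ω x - 1 - u k ω x) + ((-r : ℝ) : ℂ) * u k ω x,
    ((hs.h_field k).const_mul _).add ((hs.u_field k).const_mul _), fun ω => ?_, fun z => ?_⟩
  · have := hs.V_cont k ω
    have := hs.u_cont k ω
    fun_prop
  · obtain ⟨x, y⟩ := z
    unfold remainderKernel
    simp only
    have iV := (hs.V_field k).integrable_mul_conj (hs.V_field k) x y
    have ih := (hs.h_field k).integrable_mul_conj (hs.h_field k) x y
    have iu := (hs.u_field k).integrable_mul_conj (hs.u_field k) x y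
    have iξ := (((hs.h_field k).const_mul ((1 / r : ℝ) : ℂ)).add
      ((hs.u_field k).const_mul ((-r : ℝ) : ℂ))).integrable_mul_conj
      (((hs.h_field k).const_mul ((1 / r : ℝ) : ℂ)).add
      ((hs.u_field k).const_mul ((-r : ℝ) : ℂ))) x y
    have iVx : Integrable (fun ω => V k ω x) P := ((hs.V_field k).memLp x).integrable (by norm_num)
    have iVy : Integrable (fun ω => conj (V k ω y)) P :=
      (((hs.V_field k).memLp y).star).integrable (by norm_num)
    have mVy : ∫ ω, conj (V k ω y) ∂P = 1 := by rw [integral_conj, hs.V_mean]; simp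
    have e : ∫ ω, V k ω x * conj (V k ω y) ∂P =
        ∫ ω, (-1 + V k ω x + conj (V k ω y) + ((1 + 1 / a k : ℝ) : ℂ)
            * ((V k ω x - 1 - u k ω x) * conj (V k ω y - 1 - u k ω y))
          + ((1 + a k : ℝ) : ℂ) * (u k ω x * conj (u k ω y))
          - ((((1 / r : ℝ) : ℂ) * (V k ω x - 1 - u k ω x) + ((-r : ℝ) : ℂ) * u k ω x)
            * conj (((1 / r : ℝ) : ℂ) * (V k ω y - 1 - u k ω y) + ((-r : ℝ) : ℂ) * u k ω y))) ∂P := by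
      refine integral_congr_ae (ae_of_all _ fun ω => ?_)
      have hrc : (r : ℂ) ≠ 0 := by exact_mod_cast hr0.ne'
      simp only [map_add, map_sub, map_mul, Complex.conj_ofReal, map_one, hra]
      push_cast
      field_simp
      ring
    have i1 : Integrable (fun ω => -1 + V k ω x) P := (integrable_const _).add iVx
    have i2 : Integrable (fun ω => -1 + V k ω x + conj (V k ω y)) P := i1.add iVy
    have i3 : Integrable (fun ω => -1 + V k ω x + conj (V k ω y) + ((1 + 1 / a k : ℝ) : ℂ)
            * ((V k ω x - 1 - u k ω x) * conj (V k ω y - 1 - u k ω y))) P := i2.add (ih.const_mul _)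
    have i4 : Integrable (fun ω => -1 + V k ω x + conj (V k ω y) + ((1 + 1 / a k : ℝ) : ℂ)
            * ((V k ω x - 1 - u k ω x) * conj (V k ω y - 1 - u k ω y))
            + ((1 + a k : ℝ) : ℂ) * (u k ω x * conj (u k ω y))) P := i3.add (iu.const_mul _)
    rw [e, integral_sub i4 iξ, integral_add i3 (iu.const_mul _), integral_add i2 (ih.const_mul _),
      integral_add i1 iVy, integral_add (integrable_const _) iVx, hs.V_mean, mVy,
      integral_const_mul, integral_const_mul]
    simp

/-- The factor 1/a_k costs one power of the a_k⁴ coming from h; the cube that is left is what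
`a_cube` sums in the application. -/
lemma norm_remainderKernel_le (hs : StepSystem P 𝓕 𝓖 a C near V u) (k : ℕ) (z : E × E) :
    ‖remainderKernel P a V u k z‖ ≤ C * (1 + C) * a k ^ 3 := by
  have ha := hs.a_pos k
  have hC := hs.C_pos
  unfold remainderKernel
  rw [norm_mul, Complex.norm_real, Real.norm_eq_abs, abs_of_pos (by positivity)]
  have h1 : ‖∫ ω, (V k ω z.1 - 1 - u k ω z.1) * conj (V k ω z.2 - 1 - u k ω z.2) ∂P‖
      ≤ C * a k ^ 4 := by
    refine (norm_integral_le_integral_norm _).trans ?_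
    have := (hs.h_field k).norm_cov_le (hs.h_field k) (hs.h_sq k) (hs.h_sq k) z.1 z.2
    simp only [norm_mul, RCLike.norm_conj]
    linarith
  calc _ ≤ (1 + 1 / a k) * (C * a k ^ 4) := by gcongr
    _ = C * (1 + a k) * a k ^ 3 := by field_simp; ring
    _ ≤ _ := by
      have := hs.a_le k
      gcongr

lemma posKernel_mul_remainder (hs : StepSystem P 𝓕 𝓖 a C near V u) {Γ : E × E → ℂ}
    (hΓ : PosKernel ν Γ) (k : ℕ) : PosKernel ν fun z => Γ z * remainderKernel P a V u k z := by
  have ha := hs.a_pos k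
  have := (hΓ.mul_cov (hs.h_field k) fun ω =>
    ((hs.V_cont k ω).sub continuous_const).sub (hs.u_cont k ω)).const_mul
    (r := 1 + 1 / a k) (by positivity)
  convert this using 2
  unfold remainderKernel
  ring

end StepSystem

end StepSystems

/-! ### Concave moments under conditional domination, and the one-step energy inequality. -/

section Energy

open scoped ENNReal ComplexConjugate

set_option linter.unusedSectionVars false

/-- If `X` is dominated by `Z` in conditional mean, then its concave moments are dominated. -/
lemma integral_rpow_le_of_weighted {Ω : Type*} {m mΩ : MeasurableSpace Ω} {P : Measure Ω}
    [IsProbabilityMeasure P] (hm : m ≤ mΩ) {X Z : Ω → ℝ}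
    (hX0 : ∀ ω, 0 ≤ X ω) (hZ0 : ∀ ω, 0 ≤ Z ω) (hX : Integrable X P) (hZ : Integrable Z P)
    (hZm : Measurable[m] Z) {s : ℝ} (hs0 : 0 < s) (hs1 : s < 1)
    (h : ∀ B : Ω → ℝ, Measurable[m] B → (∀ ω, 0 ≤ B ω) → (∃ b, ∀ ω, B ω ≤ b) →
      ∫ ω, B ω * X ω ∂P ≤ ∫ ω, B ω * Z ω ∂P) :
    ∫ ω, X ω ^ s ∂P ≤ ∫ ω, Z ω ^ s ∂P := by
  have key : ∀ ε : ℝ, 0 < ε → ∫ ω, X ω ^ s ∂P ≤ ∫ ω, Z ω ^ s ∂P + ε ^ s := by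
    intro ε hε
    -- Conditional Jensen by hand: up to the factor s, this is the slope of x ↦ x^s at Z + ε. The
    -- shift by ε keeps the weight bounded.
    set B : Ω → ℝ := fun ω => (Z ω + ε) ^ (s - 1) with hB
    have hBm : Measurable[m] B := (hZm.add_const ε).pow_const _
    have hBm' : Measurable B := hBm.mono hm le_rfl
    have hB0 : ∀ ω, 0 ≤ B ω := fun ω => Real.rpow_nonneg (by linarith [hZ0 ω]) _
    have hBb : ∀ ω, B ω ≤ ε ^ (s - 1) := fun ω =>
      Real.rpow_le_rpow_of_nonpos hε (by linarith [hZ0 ω]) (by linarith)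
    have hmul : ∀ ω, B ω * (Z ω + ε) = (Z ω + ε) ^ s := by
      intro ω
      have : 0 < Z ω + ε := by linarith [hZ0 ω]
      rw [hB]; simp only
      nth_rewrite 2 [← Real.rpow_one (Z ω + ε)]
      rw [← Real.rpow_add this]; congr 1; ring
    have iBX : Integrable (fun ω => B ω * X ω) P :=
      hX.bdd_mul (c := ε ^ (s - 1)) hBm'.aestronglyMeasurable
        (ae_of_all _ fun ω => by rw [Real.norm_eq_abs, abs_of_nonneg (hB0 ω)]; exact hBb ω)
    have iBZ : Integrable (fun ω => B ω * Z ω) P :=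
      hZ.bdd_mul (c := ε ^ (s - 1)) hBm'.aestronglyMeasurable
        (ae_of_all _ fun ω => by rw [Real.norm_eq_abs, abs_of_nonneg (hB0 ω)]; exact hBb ω)
    have iB : Integrable B P := (integrable_const (ε ^ (s - 1))).mono' hBm'.aestronglyMeasurable
        (ae_of_all _ fun ω => by rw [Real.norm_eq_abs, abs_of_nonneg (hB0 ω)]; exact hBb ω)
    have iZs : Integrable (fun ω => (Z ω + ε) ^ s) P := by
      have := iBZ.add (iB.mul_const ε)
      refine this.congr (ae_of_all _ fun ω => ?_)
      simp only [Pi.add_apply]; rw [← hmul ω]; ring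
    -- The tangent line bound for the concave power at Z + ε, obtained from the weighted
    -- arithmetic–geometric mean inequality.
    have hpt : ∀ ω, X ω ^ s ≤ s * (B ω * X ω) + (1 - s) * (Z ω + ε) ^ s := by
      intro ω
      have hp : 0 < Z ω + ε := by linarith [hZ0 ω]
      have h1 := Real.geom_mean_le_arith_mean2_weighted hs0.le (by linarith : 0 ≤ 1 - s)
        (div_nonneg (hX0 ω) hp.le) zero_le_one (by ring : s + (1 - s) = 1)
      rw [Real.one_rpow, mul_one, mul_one, Real.div_rpow (hX0 ω) hp.le,
        div_le_iff₀ (by positivity)] at h1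
      refine h1.trans (le_of_eq ?_)
      have : B ω * X ω = X ω / (Z ω + ε) * (Z ω + ε) ^ s := by
        rw [← hmul ω]; field_simp
      rw [this]; ring
    have iR : Integrable (fun ω => s * (B ω * X ω) + (1 - s) * (Z ω + ε) ^ s) P :=
      (iBX.const_mul s).add (iZs.const_mul _)
    have hsub : ∀ ω, (Z ω + ε) ^ s ≤ Z ω ^ s + ε ^ s := fun ω =>
      Real.rpow_add_le_add_rpow (hZ0 ω) hε.le hs0.le hs1.le
    have iZ0 : Integrable (fun ω => Z ω ^ s) P := by
      refine iZs.mono' ((hZm.mono hm le_rfl).pow_const s).aestronglyMeasurable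
        (ae_of_all _ fun ω => ?_)
      rw [Real.norm_eq_abs, abs_of_nonneg (Real.rpow_nonneg (hZ0 ω) _)]
      exact Real.rpow_le_rpow (hZ0 ω) (by linarith) hs0.le
    calc ∫ ω, X ω ^ s ∂P ≤ ∫ ω, (s * (B ω * X ω) + (1 - s) * (Z ω + ε) ^ s) ∂P :=
          integral_mono_of_nonneg (ae_of_all _ fun ω => Real.rpow_nonneg (hX0 ω) _) iR
            (ae_of_all _ hpt)
      _ = s * ∫ ω, B ω * X ω ∂P + (1 - s) * ∫ ω, (Z ω + ε) ^ s ∂P := by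
          rw [integral_add (iBX.const_mul s) (iZs.const_mul _), integral_const_mul,
            integral_const_mul]
      _ ≤ s * ∫ ω, B ω * Z ω ∂P + (1 - s) * ∫ ω, (Z ω + ε) ^ s ∂P := by
          have := mul_le_mul_of_nonneg_left (h B hBm hB0 ⟨_, hBb⟩) hs0.le
          linarith
      _ ≤ s * ∫ ω, (Z ω + ε) ^ s ∂P + (1 - s) * ∫ ω, (Z ω + ε) ^ s ∂P := by
          have h1 : ∫ ω, B ω * Z ω ∂P ≤ ∫ ω, (Z ω + ε) ^ s ∂P := by
            refine integral_mono iBZ iZs fun ω => ?_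
            simp only
            rw [← hmul ω]
            exact mul_le_mul_of_nonneg_left (by linarith) (hB0 ω)
          have := mul_le_mul_of_nonneg_left h1 hs0.le
          linarith
      _ = ∫ ω, (Z ω + ε) ^ s ∂P := by ring
      _ ≤ ∫ ω, (Z ω ^ s + ε ^ s) ∂P := integral_mono iZs (iZ0.add (integrable_const _)) hsub
      _ = _ := by rw [integral_add iZ0 (integrable_const _)]; simp
  have ht : Tendsto (fun ε : ℝ => ∫ ω, Z ω ^ s ∂P + ε ^ s) (𝓝[>] 0)
      (𝓝 (∫ ω, Z ω ^ s ∂P + 0)) := by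
    refine Tendsto.const_add _ ?_
    have := (Real.continuousAt_rpow_const 0 s (Or.inr hs0.le)).tendsto
    rw [Real.zero_rpow hs0.ne'] at this
    exact this.mono_left nhdsWithin_le_nhds
  rw [add_zero] at ht
  exact ge_of_tendsto ht (eventually_nhdsWithin_of_forall fun ε hε => key ε hε)

variable {Ω E : Type*} [mΩ : MeasurableSpace Ω] {P : Measure Ω} [IsProbabilityMeasure P]
  [MetricSpace E] [CompactSpace E] [SecondCountableTopology E] [MeasurableSpace E] [BorelSpace E]
  {ν : Measure E} [IsProbabilityMeasure ν]

/-- The energy of `|w|` for a nonnegative kernel. -/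
noncomputable def absEnergy (ν : Measure E) (κ : E × E → ℝ) (w : E → ℂ) : ℝ :=
  ∫ z, κ z * (‖w z.1‖ * ‖w z.2‖) ∂(ν.prod ν)

lemma absEnergy_nonneg {κ : E × E → ℝ} (hκ : ∀ z, 0 ≤ κ z) (w : E → ℂ) :
    0 ≤ absEnergy ν κ w :=
  integral_nonneg fun z => mul_nonneg (hκ z) (by positivity)

namespace L2Field

variable {F G : Ω → E → ℂ} {g b : ℝ} {B : Ω → ℝ}

lemma integral_mul_re_kernelPairing {Γ : E × E → ℂ} (hF : L2Field P F) (hG : L2Field P G)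
    (hΓ : Measurable Γ) (hg : ∀ z, ‖Γ z‖ ≤ g) (hB : Measurable B) (hb : ∀ ω, |B ω| ≤ b) :
    ∫ ω, B ω * (kernelPairing ν Γ (F ω) (G ω)).re ∂P
      = (∫ z, Γ z * ∫ ω, (B ω : ℂ) * (F ω z.1 * conj (G ω z.2)) ∂P ∂(ν.prod ν)).re := by
  have hB' : Measurable fun ω => (B ω : ℂ) := Complex.measurable_ofReal.comp hB
  have hb' : ∀ ω, ‖(B ω : ℂ)‖ ≤ b := fun ω => by
    rw [Complex.norm_real]; exact hb ω
  rw [← hF.integral_mul_kernelPairing hG hΓ hg hB' hb', ← RCLike.re_eq_complex_re,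
    ← integral_re (hF.integrable_mul_kernelPairing hG hΓ hg hB' hb')]
  refine integral_congr_ae (ae_of_all _ fun ω => ?_)
  simp

lemma integrable_abs_prod (hF : L2Field P F) {κ : E × E → ℝ}
    (hκ : Measurable κ) (hκ0 : ∀ z, 0 ≤ κ z) (hg : ∀ z, κ z ≤ g) (hB : Measurable B)
    (hB0 : ∀ ω, 0 ≤ B ω) (hb : ∀ ω, B ω ≤ b) :
    Integrable (fun p : Ω × (E × E) => B p.1 * (κ p.2 * (‖F p.1 p.2.1‖ * ‖F p.1 p.2.2‖)))
      (P.prod (ν.prod ν)) := by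
  have h := (hF.integrable_prod (ν := ν) hF (Complex.measurable_ofReal.comp hκ)
    (g := g) (fun z => by simp [abs_of_nonneg (hκ0 z), hg z])
    (Complex.measurable_ofReal.comp hB)
    (b := b) (fun ω => by simp [abs_of_nonneg (hB0 ω), hb ω])).norm
  refine h.congr (ae_of_all _ fun p => ?_)
  simp [abs_of_nonneg (hκ0 p.2), abs_of_nonneg (hB0 p.1)]

lemma integral_mul_absEnergy (hF : L2Field P F) {κ : E × E → ℝ}
    (hκ : Measurable κ) (hκ0 : ∀ z, 0 ≤ κ z) (hg : ∀ z, κ z ≤ g) (hB : Measurable B)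
    (hB0 : ∀ ω, 0 ≤ B ω) (hb : ∀ ω, B ω ≤ b) :
    ∫ ω, B ω * absEnergy ν κ (F ω) ∂P
      = ∫ z, κ z * ∫ ω, B ω * (‖F ω z.1‖ * ‖F ω z.2‖) ∂P ∂(ν.prod ν) := by
  have h := hF.integrable_abs_prod (ν := ν) hκ hκ0 hg hB hB0 hb
  unfold absEnergy
  simp_rw [← integral_const_mul]
  rw [integral_integral_swap h]
  refine integral_congr_ae (ae_of_all _ fun z => ?_)
  refine integral_congr_ae (ae_of_all _ fun ω => ?_)
  simp only; ring

lemma integrable_absEnergy (hF : L2Field P F) {κ : E × E → ℝ}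
    (hκ : Measurable κ) (hκ0 : ∀ z, 0 ≤ κ z) (hg : ∀ z, κ z ≤ g) :
    Integrable (fun ω => absEnergy ν κ (F ω)) P := by
  have h := (hF.integrable_abs_prod (ν := ν) hκ hκ0 hg (B := fun _ => 1) measurable_const
    (fun _ => zero_le_one) (b := 1) (fun _ => le_rfl)).integral_prod_left
  simpa only [absEnergy, one_mul] using h

lemma integrable_abs_kernel_integral (hF : L2Field P F) {κ : E × E → ℝ}
    (hκ : Measurable κ) (hκ0 : ∀ z, 0 ≤ κ z) (hg : ∀ z, κ z ≤ g) (hB : Measurable B)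
    (hB0 : ∀ ω, 0 ≤ B ω) (hb : ∀ ω, B ω ≤ b) :
    Integrable (fun z : E × E => κ z * ∫ ω, B ω * (‖F ω z.1‖ * ‖F ω z.2‖) ∂P) (ν.prod ν) := by
  have h := (hF.integrable_abs_prod (ν := ν) hκ hκ0 hg hB hB0 hb).integral_prod_right
  refine h.congr (ae_of_all _ fun z => ?_)
  simp only [← integral_const_mul]
  refine integral_congr_ae (ae_of_all _ fun ω => ?_)
  simp only; ring

end L2Field

namespace StepSystem

variable {𝓕 𝓖 : ℕ → MeasurableSpace Ω} {a : ℕ → ℝ} {C : ℝ} {near : ℕ → E × E → ℝ}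
  {V u : ℕ → Ω → E → ℂ}

/-- Insert the formula of `cov_V_eq`. The square ξξ* enters with a minus sign and pairs
nonnegatively by Schur's theorem, so it is dropped. The remainder multiplies `Γ` and keeps its
positivity. The linear part is bounded in absolute value by `near m`, with |W_k| brought back to
time m by `integral_norm_step_le`. -/
lemma energy_succ (hs : StepSystem P 𝓕 𝓖 a C near V u) {Γ : E × E → ℂ} (hΓ : PosKernel ν Γ)
    {g : ℝ} (hg : ∀ z, ‖Γ z‖ ≤ g) {m k : ℕ} (hmk : m ≤ k) {B : Ω → ℝ} (hB : Measurable[𝓕 m] B)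
    (hB0 : ∀ ω, 0 ≤ B ω) {b : ℝ} (hb : ∀ ω, B ω ≤ b) :
    ∫ ω, B ω * (kernelPairing ν Γ (density V (k + 1) ω) (density V (k + 1) ω)).re ∂P
      ≤ ∫ ω, B ω * (kernelPairing ν (fun z => Γ z * (1 + remainderKernel P a V u k z))
          (density V k ω) (density V k ω)).re ∂P
        + (1 + C) * C * g * Real.exp (C * (clock a k - clock a m)) * a k ^ 2
          * ∫ ω, B ω * absEnergy ν (near m) (density V m ω) ∂P := by
  have hBm : Measurable B := hB.mono (hs.le m) le_rfl
  have hbabs : ∀ ω, |B ω| ≤ b := fun ω => by rw [abs_of_nonneg (hB0 ω)]; exact hb ω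
  have hBc : Measurable fun ω => (B ω : ℂ) := Complex.measurable_ofReal.comp hBm
  have hBcm : Measurable[𝓕 m] fun ω => (B ω : ℂ) := Complex.measurable_ofReal.comp hB
  have hbc : ∀ ω, ‖(B ω : ℂ)‖ ≤ b := fun ω => by rw [Complex.norm_real]; exact hbabs ω
  have hC := hs.C_pos
  have ha := hs.a_pos k
  obtain ⟨ξ, hξ, hξc, hcov⟩ := hs.cov_V_eq k
  have hW := hs.density_field k
  have hW' := hs.density_field (k + 1)
  have hWm := hs.density_field m
  have hu := hs.u_field k
  set H : E × E → ℂ := fun z =>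
    ∫ ω, (B ω : ℂ) * (density V k ω z.1 * conj (density V k ω z.2)) ∂P with hH
  have hub : ∀ z : E × E, ‖∫ ω, u k ω z.1 * conj (u k ω z.2) ∂P‖ ≤ C * a k ^ 2 * near m z :=
    fun z => hs.u_cov m k hmk z.1 z.2
  have hP1 : PosKernel ν fun z => Γ z * (1 + remainderKernel P a V u k z) := by
    have := hΓ.add (hs.posKernel_mul_remainder hΓ k)
    convert this using 2; ring
  have hP2 := hΓ.mul_cov (P := P) hu (hs.u_cont k)
  have hP3 := hΓ.mul_cov (P := P) hξ hξc
  obtain ⟨g1, hg1⟩ := hP1.bdd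
  obtain ⟨g2, hg2⟩ := hP2.bdd
  obtain ⟨g3, hg3⟩ := hP3.bdd
  have i1 : Integrable (fun z => (Γ z * (1 + remainderKernel P a V u k z)) * H z) (ν.prod ν) :=
    hW.integrable_kernel_integral (ν := ν) hW hP1.meas hg1 hBc hbc
  have i2 : Integrable (fun z => ((1 + a k : ℝ) : ℂ) *
      ((Γ z * ∫ ω, u k ω z.1 * conj (u k ω z.2) ∂P) * H z)) (ν.prod ν) :=
    (hW.integrable_kernel_integral (ν := ν) hW hP2.meas hg2 hBc hbc).const_mul _
  have i3 : Integrable (fun z => (Γ z * ∫ ω, ξ ω z.1 * conj (ξ ω z.2) ∂P) * H z) (ν.prod ν) :=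
    hW.integrable_kernel_integral (ν := ν) hW hP3.meas hg3 hBc hbc
  have i12 : Integrable (fun z => (Γ z * (1 + remainderKernel P a V u k z)) * H z
      + ((1 + a k : ℝ) : ℂ) * ((Γ z * ∫ ω, u k ω z.1 * conj (u k ω z.2) ∂P) * H z)) (ν.prod ν) :=
    i1.add i2
  rw [hW'.integral_mul_re_kernelPairing hW' hΓ.meas hg hBm hbabs,
    hW.integral_mul_re_kernelPairing hW hP1.meas hg1 hBm hbabs]
  have e : (fun z : E × E => Γ z * ∫ ω, (B ω : ℂ) *
        (density V (k + 1) ω z.1 * conj (density V (k + 1) ω z.2)) ∂P)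
      = fun z => (Γ z * (1 + remainderKernel P a V u k z)) * H z
        + ((1 + a k : ℝ) : ℂ) * ((Γ z * ∫ ω, u k ω z.1 * conj (u k ω z.2) ∂P) * H z)
        - (Γ z * ∫ ω, ξ ω z.1 * conj (ξ ω z.2) ∂P) * H z := by
    funext z
    rw [hs.cov_step hmk hBcm, hcov]
    simp only [hH]; ring
  rw [e, integral_sub i12 i3, integral_add i1 i2,
    integral_const_mul, Complex.sub_re, Complex.add_re, Complex.re_ofReal_mul]
  have h3 : 0 ≤ (∫ z, (Γ z * ∫ ω, ξ ω z.1 * conj (ξ ω z.2) ∂P) * H z ∂(ν.prod ν)).re := by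
    rw [← hW.integral_mul_re_kernelPairing hW hP3.meas hg3 hBm hbabs]
    exact integral_nonneg fun ω => mul_nonneg (hB0 ω) (hP3.pos _ (hs.density_continuous k ω))
  have hg0 : ∀ z : E × E, 0 ≤ g := fun z => (norm_nonneg _).trans (hg z)
  have h2 : (∫ z, (Γ z * ∫ ω, u k ω z.1 * conj (u k ω z.2) ∂P) * H z ∂(ν.prod ν)).re
      ≤ (C * g * Real.exp (C * (clock a k - clock a m)) * a k ^ 2)
          * ∫ ω, B ω * absEnergy ν (near m) (density V m ω) ∂P := by
    rw [hWm.integral_mul_absEnergy (hs.near_meas m) (hs.near_nonneg m) (hs.near_le m) hBm hB0 hb,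
      ← integral_const_mul]
    refine (Complex.re_le_norm _).trans (norm_integral_le_of_norm_le
      ((hWm.integrable_abs_kernel_integral (hs.near_meas m) (hs.near_nonneg m)
        (hs.near_le m) hBm hB0 hb).const_mul _) (ae_of_all _ fun z => ?_))
    rw [norm_mul, norm_mul]
    have hHz : ‖H z‖ ≤ Real.exp (C * (clock a k - clock a m))
        * ∫ ω, B ω * (‖density V m ω z.1‖ * ‖density V m ω z.2‖) ∂P := by
      refine le_trans ?_ (hs.integral_norm_step_le hmk hB hB0 z.1 z.2)
      refine (norm_integral_le_integral_norm _).trans (le_of_eq ?_)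
      refine integral_congr_ae (ae_of_all _ fun ω => ?_)
      simp [abs_of_nonneg (hB0 ω)]
    have hn := hs.near_nonneg m z
    have := hg0 z
    calc _ ≤ g * (C * a k ^ 2 * near m z) * (Real.exp (C * (clock a k - clock a m))
        * ∫ ω, B ω * (‖density V m ω z.1‖ * ‖density V m ω z.2‖) ∂P) := by
          gcongr
          exacts [hg z, hub z]
      _ = _ := by ring
  have hS : 0 ≤ ∫ ω, B ω * absEnergy ν (near m) (density V m ω) ∂P :=
    integral_nonneg fun ω => mul_nonneg (hB0 ω) (absEnergy_nonneg (hs.near_nonneg m) _)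
  have hE : Nonempty E := by
    by_contra hne
    rw [not_nonempty_iff] at hne
    have : (Set.univ : Set E) = ∅ := Set.univ_eq_empty_iff.mpr hne
    have h1 := measure_univ (μ := ν)
    rw [this, measure_empty] at h1
    exact zero_ne_one h1
  have hg00 : 0 ≤ g := hg0 (hE.some, hE.some)
  have ha1 := hs.a_le k
  have h4 : (1 + a k) * ((C * g * Real.exp (C * (clock a k - clock a m)) * a k ^ 2)
          * ∫ ω, B ω * absEnergy ν (near m) (density V m ω) ∂P)
      ≤ (1 + C) * ((C * g * Real.exp (C * (clock a k - clock a m)) * a k ^ 2)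
          * ∫ ω, B ω * absEnergy ν (near m) (density V m ω) ∂P) := by
    gcongr
  have h5 := mul_le_mul_of_nonneg_left h2 (by linarith : 0 ≤ 1 + a k)
  linarith

end StepSystem

end Energy

/-! ### Energy over a block of steps, with the remainder factors stored in the kernel. -/

section EnergyBlocks

open scoped ENNReal ComplexConjugate

set_option linter.unusedSectionVars false

lemma integrable_rpow_of_lt_one {Ω : Type*} {mΩ : MeasurableSpace Ω} {P : Measure Ω}
    [IsFiniteMeasure P] {X : Ω → ℝ} (hX0 : ∀ ω, 0 ≤ X ω) (hX : Integrable X P) {s : ℝ}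
    (hs0 : 0 < s) (hs1 : s < 1) : Integrable (fun ω => X ω ^ s) P := by
  refine ((integrable_const (1 : ℝ)).add hX).mono'
    (hX.1.aemeasurable.pow_const s).aestronglyMeasurable (ae_of_all _ fun ω => ?_)
  rw [Real.norm_eq_abs, abs_of_nonneg (Real.rpow_nonneg (hX0 ω) _)]
  simp only [Pi.add_apply]
  rcases le_total (X ω) 1 with h | h
  · have := Real.rpow_le_one (hX0 ω) h hs0.le
    linarith [hX0 ω]
  · have := Real.rpow_le_rpow_of_exponent_le h hs1.le
    rw [Real.rpow_one] at this
    linarith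

variable {Ω E : Type*} [mΩ : MeasurableSpace Ω] {P : Measure Ω} [IsProbabilityMeasure P]
  [MetricSpace E] [CompactSpace E] [SecondCountableTopology E] [MeasurableSpace E] [BorelSpace E]
  {ν : Measure E} [IsProbabilityMeasure ν]

lemma measurable_kernelPairing {m : MeasurableSpace Ω} {F G : Ω → E → ℂ} {Γ : E × E → ℂ}
    (hΓ : Measurable Γ) (hFc : ∀ ω, Continuous (F ω)) (hF : ∀ x, Measurable[m] fun ω => F ω x)
    (hGc : ∀ ω, Continuous (G ω)) (hG : ∀ x, Measurable[m] fun ω => G ω x) :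
    Measurable[m] fun ω => kernelPairing ν Γ (F ω) (G ω) := by
  have h1 := measurable_uncurry_field (m := m) hFc hF
  have h2 := measurable_uncurry_field (m := m) hGc hG
  have h : Measurable[m.prod inferInstance]
      fun p : Ω × (E × E) => Γ p.2 * (F p.1 p.2.1 * conj (G p.1 p.2.2)) :=
    (hΓ.comp measurable_snd).mul
      ((h1.comp (measurable_fst.prodMk (measurable_fst.comp measurable_snd))).mul
        (Complex.continuous_conj.measurable.comp
          (h2.comp (measurable_fst.prodMk (measurable_snd.comp measurable_snd)))))
  exact (h.stronglyMeasurable.integral_prod_right (ν := ν.prod ν)).measurable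

lemma measurable_absEnergy {m : MeasurableSpace Ω} {F : Ω → E → ℂ} {κ : E × E → ℝ}
    (hκ : Measurable κ) (hFc : ∀ ω, Continuous (F ω)) (hF : ∀ x, Measurable[m] fun ω => F ω x) :
    Measurable[m] fun ω => absEnergy ν κ (F ω) := by
  have h1 := measurable_uncurry_field (m := m) hFc hF
  have h : Measurable[m.prod inferInstance]
      fun p : Ω × (E × E) => κ p.2 * (‖F p.1 p.2.1‖ * ‖F p.1 p.2.2‖) :=
    (hκ.comp measurable_snd).mul
      ((measurable_norm.comp
          (h1.comp (measurable_fst.prodMk (measurable_fst.comp measurable_snd)))).mul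
        (measurable_norm.comp
          (h1.comp (measurable_fst.prodMk (measurable_snd.comp measurable_snd)))))
  exact (h.stronglyMeasurable.integral_prod_right (ν := ν.prod ν)).measurable

/-- The kernel `Γ` multiplied by the remainder factors of the steps `n, …, N - 1`. -/
noncomputable def futureKernel (P : Measure Ω) (a : ℕ → ℝ) (V u : ℕ → Ω → E → ℂ)
    (Γ : E × E → ℂ) (N n : ℕ) (z : E × E) : ℂ :=
  Γ z * ∏ k ∈ Finset.Ico n N, (1 + remainderKernel P a V u k z)

/-- Real processes whose increments after time `M` are orthogonal to the past. -/
structure WeakMartingaleFrom (P : Measure Ω) (𝓕 : ℕ → MeasurableSpace Ω) (M : ℕ)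
    (L : ℕ → Ω → ℝ) : Prop where
  meas : ∀ n, M ≤ n → Measurable[𝓕 n] (L n)
  int : ∀ n, Integrable (L n) P
  mart : ∀ m k, M ≤ m → m ≤ k → ∀ B : Ω → ℝ, Measurable[𝓕 m] B → (∀ ω, 0 ≤ B ω) →
    (∃ b, ∀ ω, B ω ≤ b) → ∫ ω, B ω * L (k + 1) ω ∂P = ∫ ω, B ω * L k ω ∂P

namespace StepSystem

variable {𝓕 𝓖 : ℕ → MeasurableSpace Ω} {a : ℕ → ℝ} {C : ℝ} {near : ℕ → E × E → ℝ}
  {V u : ℕ → Ω → E → ℂ} {Γ : E × E → ℂ} {g : ℝ}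

lemma futureKernel_eq_mul {n N : ℕ} (h : n < N) (z : E × E) :
    futureKernel P a V u Γ N n z
      = futureKernel P a V u Γ N (n + 1) z * (1 + remainderKernel P a V u n z) := by
  unfold futureKernel
  rw [← Finset.prod_Ioo_mul_eq_prod_Ico h, ← Finset.Ico_succ_left_eq_Ioo]
  simp only [Nat.succ_eq_succ, Nat.succ_eq_add_one]
  ring

lemma futureKernel_self (N : ℕ) (z : E × E) : futureKernel P a V u Γ N N z = Γ z := by
  simp [futureKernel]

lemma posKernel_mul_one_add (hs : StepSystem P 𝓕 𝓖 a C near V u) (hΓ : PosKernel ν Γ) (k : ℕ) :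
    PosKernel ν fun z => Γ z * (1 + remainderKernel P a V u k z) := by
  have := hΓ.add (hs.posKernel_mul_remainder hΓ k)
  convert this using 2; ring

lemma posKernel_future (hs : StepSystem P 𝓕 𝓖 a C near V u) (hΓ : PosKernel ν Γ) {n N : ℕ}
    (h : n ≤ N) : PosKernel ν (futureKernel P a V u Γ N n) := by
  induction N, h using Nat.le_induction with
  | base =>
    have e : futureKernel P a V u Γ n n = Γ := by funext z; simp [futureKernel]
    rwa [e]
  | succ N hN ih =>
    have := hs.posKernel_mul_one_add ih N
    convert this using 2 with z
    unfold futureKernel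
    rw [Finset.prod_Ico_succ_top hN]; ring

/-- Expanding the product one factor at a time writes the difference as a sum of positive kernels.
This keeps the energy process nonnegative once the cross term is included. -/
lemma posKernel_future_sub (hs : StepSystem P 𝓕 𝓖 a C near V u) (hΓ : PosKernel ν Γ) {n N : ℕ}
    (h : n ≤ N) : PosKernel ν fun z => futureKernel P a V u Γ N n z - Γ z := by
  induction N, h using Nat.le_induction with
  | base =>
    have := hΓ.const_mul (r := 0) le_rfl
    convert this using 2 with z
    rw [futureKernel_self]; simp
  | succ N hN ih =>
    have := ih.add (hs.posKernel_mul_remainder (hs.posKernel_future hΓ hN) N)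
    convert this using 2 with z
    unfold futureKernel
    rw [Finset.prod_Ico_succ_top hN]; ring

lemma sum_norm_remainder_le (hs : StepSystem P 𝓕 𝓖 a C near V u) (n N : ℕ) (z : E × E) :
    ∑ k ∈ Finset.Ico n N, ‖remainderKernel P a V u k z‖
      ≤ C * (1 + C) * ∑ k ∈ Finset.Ico n N, a k ^ 3 := by
  rw [Finset.mul_sum]
  exact Finset.sum_le_sum fun k _ => hs.norm_remainderKernel_le k z

lemma norm_futureKernel_le (hs : StepSystem P 𝓕 𝓖 a C near V u) (hg : ∀ z, ‖Γ z‖ ≤ g) (n N : ℕ)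
    (z : E × E) :
    ‖futureKernel P a V u Γ N n z‖
      ≤ g * Real.exp (C * (1 + C) * ∑ k ∈ Finset.Ico n N, a k ^ 3) := by
  unfold futureKernel
  rw [norm_mul, norm_prod]
  have h1 : ∏ k ∈ Finset.Ico n N, ‖1 + remainderKernel P a V u k z‖
      ≤ Real.exp (C * (1 + C) * ∑ k ∈ Finset.Ico n N, a k ^ 3) := by
    refine le_trans ?_ (Real.exp_le_exp.mpr (hs.sum_norm_remainder_le n N z))
    rw [Real.exp_sum]
    refine Finset.prod_le_prod (fun _ _ => norm_nonneg _) fun k _ => ?_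
    refine (norm_add_le _ _).trans ?_
    rw [norm_one, add_comm]
    exact Real.add_one_le_exp _
  have h0 : 0 ≤ g := (norm_nonneg _).trans (hg z)
  have h2 : 0 ≤ ∏ k ∈ Finset.Ico n N, ‖1 + remainderKernel P a V u k z‖ :=
    Finset.prod_nonneg fun _ _ => norm_nonneg _
  exact mul_le_mul (hg z) h1 h2 h0

lemma norm_futureKernel_sub_le (hs : StepSystem P 𝓕 𝓖 a C near V u) (hg : ∀ z, ‖Γ z‖ ≤ g)
    (n N : ℕ) (z : E × E) :
    ‖futureKernel P a V u Γ N n z - Γ z‖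
      ≤ g * (Real.exp (C * (1 + C) * ∑ k ∈ Finset.Ico n N, a k ^ 3) - 1) := by
  unfold futureKernel
  have e : Γ z * ∏ k ∈ Finset.Ico n N, (1 + remainderKernel P a V u k z) - Γ z
      = Γ z * (∏ k ∈ Finset.Ico n N, (1 + remainderKernel P a V u k z) - 1) := by ring
  rw [e, norm_mul]
  have h0 : 0 ≤ g := (norm_nonneg _).trans (hg z)
  have h1 := Finset.norm_prod_one_add_sub_one_le (Finset.Ico n N)
    (fun k => remainderKernel P a V u k z)
  have h2 := Real.exp_le_exp.mpr (hs.sum_norm_remainder_le n N z)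
  exact mul_le_mul (hg z) (by linarith) (norm_nonneg _) h0

lemma clock_mono (hs : StepSystem P 𝓕 𝓖 a C near V u) : StrictMono (clock a) :=
  strictMono_nat_of_lt_succ fun n => by
    have : clock a (n + 1) = clock a n + a n ^ 2 := Finset.sum_range_succ _ _
    have h := hs.a_pos n
    rw [this]; nlinarith

lemma nonneg_of_bound [Nonempty E] (hg : ∀ z : E × E, ‖Γ z‖ ≤ g) : 0 ≤ g :=
  (norm_nonneg _).trans (hg (Classical.arbitrary E, Classical.arbitrary E))

/-- Iterates `energy_succ` with the terminal time N fixed. The future kernel at n + 1 times the n-th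
remainder factor is the future kernel at n, so the remainders leave no error term; only the
short-range contributions add up, to the clock increment. -/
lemma energy_block [Nonempty E] (hs : StepSystem P 𝓕 𝓖 a C near V u) (hΓ : PosKernel ν Γ)
    (hg : ∀ z, ‖Γ z‖ ≤ g) {A : ℝ} (hA : ∀ n N, ∑ k ∈ Finset.Ico n N, a k ^ 3 ≤ A) {m n N : ℕ}
    (hmn : m ≤ n) (hnN : n ≤ N) {T : ℝ} (hT : clock a n - clock a m ≤ T)
    {B : Ω → ℝ} (hB : Measurable[𝓕 m] B)
    (hB0 : ∀ ω, 0 ≤ B ω) {b : ℝ} (hb : ∀ ω, B ω ≤ b) :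
    ∫ ω, B ω * (kernelPairing ν (futureKernel P a V u Γ N n)
        (density V n ω) (density V n ω)).re ∂P
      ≤ ∫ ω, B ω * (kernelPairing ν (futureKernel P a V u Γ N m)
          (density V m ω) (density V m ω)).re ∂P
        + (1 + C) * C * (g * Real.exp (C * (1 + C) * A)) * Real.exp (C * T)
          * (clock a n - clock a m)
          * ∫ ω, B ω * absEnergy ν (near m) (density V m ω) ∂P := by
  have hC := hs.C_pos
  have hg0 := nonneg_of_bound hg
  have hS : 0 ≤ ∫ ω, B ω * absEnergy ν (near m) (density V m ω) ∂P :=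
    integral_nonneg fun ω => mul_nonneg (hB0 ω) (absEnergy_nonneg (hs.near_nonneg m) _)
  induction n, hmn using Nat.le_induction with
  | base => simp
  | succ n hn ih =>
    have hc : clock a (n + 1) = clock a n + a n ^ 2 := Finset.sum_range_succ _ _
    have hTn : clock a n - clock a m ≤ T := by
      have := hs.clock_mono.monotone (Nat.le_succ n); linarith
    have ih' := ih (by omega) hTn
    have hstep := hs.energy_succ (hs.posKernel_future hΓ hnN)
      (hs.norm_futureKernel_le hg (n + 1) N) hn hB hB0 hb
    have e : (fun z => futureKernel P a V u Γ N (n + 1) z * (1 + remainderKernel P a V u n z))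
        = futureKernel P a V u Γ N n := by
      funext z; exact (futureKernel_eq_mul (by omega) z).symm
    rw [e] at hstep
    have hbound : (1 + C) * C * (g * Real.exp (C * (1 + C) *
          ∑ k ∈ Finset.Ico (n + 1) N, a k ^ 3))
          * Real.exp (C * (clock a n - clock a m)) * a n ^ 2
          * ∫ ω, B ω * absEnergy ν (near m) (density V m ω) ∂P
        ≤ (1 + C) * C * (g * Real.exp (C * (1 + C) * A)) * Real.exp (C * T) * a n ^ 2
          * ∫ ω, B ω * absEnergy ν (near m) (density V m ω) ∂P := by
      have := hA (n + 1) N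
      gcongr
    refine hstep.trans ((add_le_add ih' hbound).trans (le_of_eq ?_))
    rw [hc]; ring

/-- The energy process attached to a kernel and a compensating linear part. -/
noncomputable def _root_.energyProcess (P : Measure Ω) (ν : Measure E) (a : ℕ → ℝ)
    (V u : ℕ → Ω → E → ℂ) (Γ : E × E → ℂ) (N : ℕ) (L : ℕ → Ω → ℝ) (n : ℕ) (ω : Ω) : ℝ :=
  (kernelPairing ν (futureKernel P a V u Γ N n) (density V n ω) (density V n ω)).re + L n ω

lemma integrable_energyProcess (hs : StepSystem P 𝓕 𝓖 a C near V u) (hΓ : PosKernel ν Γ)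
    {M N n : ℕ} (hn : n ≤ N) {L : ℕ → Ω → ℝ} (hL : WeakMartingaleFrom P 𝓕 M L) :
    Integrable (energyProcess P ν a V u Γ N L n) P := by
  obtain ⟨g', hg'⟩ := (hs.posKernel_future hΓ hn).bdd
  exact (((hs.density_field n).integrable_kernelPairing (hs.density_field n)
    (hs.posKernel_future hΓ hn).meas hg').re).add (hL.int n)

lemma measurable_energyProcess (hs : StepSystem P 𝓕 𝓖 a C near V u) (hΓ : PosKernel ν Γ)
    {M N n : ℕ} (hMn : M ≤ n) (hn : n ≤ N) {L : ℕ → Ω → ℝ} (hL : WeakMartingaleFrom P 𝓕 M L) :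
    Measurable[𝓕 n] (energyProcess P ν a V u Γ N L n) :=
  (Complex.measurable_re.comp (measurable_kernelPairing (hs.posKernel_future hΓ hn).meas
    (hs.density_continuous n) (hs.density_measurable n) (hs.density_continuous n)
    (hs.density_measurable n))).add (hL.meas n hMn)

/-- The martingale part drops out when tested against the past, so the energy at n is dominated in
conditional mean by its value at m plus a multiple of the short-range energy. Concavity and (x+y)^s
≤ x^s + y^s then give the bound. -/
lemma energyProcess_block [Nonempty E] (hs : StepSystem P 𝓕 𝓖 a C near V u) (hΓ : PosKernel ν Γ)
    (hg : ∀ z, ‖Γ z‖ ≤ g) {A : ℝ} (hA : ∀ n N, ∑ k ∈ Finset.Ico n N, a k ^ 3 ≤ A) {M m n N : ℕ}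
    (hMm : M ≤ m) (hmn : m ≤ n) (hnN : n ≤ N) {T : ℝ} (hT : clock a n - clock a m ≤ T)
    {L : ℕ → Ω → ℝ} (hL : WeakMartingaleFrom P 𝓕 M L)
    (h0 : ∀ k, M ≤ k → k ≤ N → ∀ ω, 0 ≤ energyProcess P ν a V u Γ N L k ω)
    {s : ℝ} (hs0 : 0 < s) (hs1 : s < 1) :
    ∫ ω, energyProcess P ν a V u Γ N L n ω ^ s ∂P
      ≤ ∫ ω, energyProcess P ν a V u Γ N L m ω ^ s ∂P
        + ((1 + C) * C * (g * Real.exp (C * (1 + C) * A)) * Real.exp (C * T) * T) ^ s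
          * ∫ ω, absEnergy ν (near m) (density V m ω) ^ s ∂P := by
  have hC := hs.C_pos
  have hg0 := nonneg_of_bound hg
  have hT0 : 0 ≤ T := by have := hs.clock_mono.monotone hmn; linarith
  set K : ℝ := (1 + C) * C * (g * Real.exp (C * (1 + C) * A)) * Real.exp (C * T) * T with hK
  have hK0 : 0 ≤ K := by positivity
  set S : Ω → ℝ := fun ω => absEnergy ν (near m) (density V m ω) with hSdef
  have hS0 : ∀ ω, 0 ≤ S ω := fun ω => absEnergy_nonneg (hs.near_nonneg m) _
  have hSi : Integrable S P := (hs.density_field m).integrable_absEnergy (hs.near_meas m)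
    (hs.near_nonneg m) (hs.near_le m)
  have hSm : Measurable[𝓕 m] S := measurable_absEnergy (hs.near_meas m)
    (hs.density_continuous m) (hs.density_measurable m)
  have hΨm := hs.integrable_energyProcess hΓ (hmn.trans hnN) hL
  have hΨn := hs.integrable_energyProcess hΓ hnN hL
  have hΨm0 := h0 m hMm (hmn.trans hnN)
  have hZ : ∫ ω, energyProcess P ν a V u Γ N L n ω ^ s ∂P
      ≤ ∫ ω, (energyProcess P ν a V u Γ N L m ω + K * S ω) ^ s ∂P := by
    refine integral_rpow_le_of_weighted (hs.le m) (h0 n (hMm.trans hmn) hnN)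
      (fun ω => add_nonneg (hΨm0 ω) (mul_nonneg hK0 (hS0 ω))) hΨn (hΨm.add (hSi.const_mul K))
      ((hs.measurable_energyProcess hΓ hMm (hmn.trans hnN) hL).add (hSm.const_mul K)) hs0 hs1 ?_
    rintro B hB hB0 ⟨b, hb⟩
    have hBm : Measurable B := hB.mono (hs.le m) le_rfl
    have bdd : ∀ {X : Ω → ℝ}, Integrable X P → Integrable (fun ω => B ω * X ω) P := fun hX =>
      hX.bdd_mul (c := b) hBm.aestronglyMeasurable
        (ae_of_all _ fun ω => by rw [Real.norm_eq_abs, abs_of_nonneg (hB0 ω)]; exact hb ω)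
    have hLn : ∫ ω, B ω * L n ω ∂P = ∫ ω, B ω * L m ω ∂P := by
      clear hΨn hT hnN
      induction n, hmn using Nat.le_induction with
      | base => rfl
      | succ n hn ih => rw [hL.mart m n hMm hn B hB hB0 ⟨b, hb⟩, ih]
    have hQ : ∀ k, k ≤ N → Integrable (fun ω => (kernelPairing ν (futureKernel P a V u Γ N k)
        (density V k ω) (density V k ω)).re) P := fun k hk => (((hs.density_field k).integrable_kernelPairing
      (hs.density_field k) (hs.posKernel_future hΓ hk).meas
      (hs.posKernel_future hΓ hk).bdd.choose_spec).re)
    have hblock := hs.energy_block hΓ hg hA hmn hnN hT hB hB0 hb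
    have hS' : 0 ≤ ∫ ω, B ω * S ω ∂P := integral_nonneg fun ω => mul_nonneg (hB0 ω) (hS0 ω)
    have e1 : ∫ ω, B ω * energyProcess P ν a V u Γ N L n ω ∂P
        = ∫ ω, B ω * (kernelPairing ν (futureKernel P a V u Γ N n)
          (density V n ω) (density V n ω)).re ∂P + ∫ ω, B ω * L n ω ∂P := by
      rw [← integral_add (bdd (hQ n hnN)) (bdd (hL.int n))]
      refine integral_congr_ae (ae_of_all _ fun ω => ?_)
      simp only [energyProcess]; ring
    have e2 : ∫ ω, B ω * (energyProcess P ν a V u Γ N L m ω + K * S ω) ∂P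
        = ∫ ω, B ω * (kernelPairing ν (futureKernel P a V u Γ N m)
          (density V m ω) (density V m ω)).re ∂P + ∫ ω, B ω * L m ω ∂P
          + K * ∫ ω, B ω * S ω ∂P := by
      have i12 : Integrable (fun ω => B ω * (kernelPairing ν (futureKernel P a V u Γ N m)
          (density V m ω) (density V m ω)).re + B ω * L m ω) P :=
        (bdd (hQ m (hmn.trans hnN))).add (bdd (hL.int m))
      rw [← integral_add (bdd (hQ m (hmn.trans hnN))) (bdd (hL.int m)), ← integral_const_mul,
        ← integral_add i12 ((bdd hSi).const_mul K)]
      refine integral_congr_ae (ae_of_all _ fun ω => ?_)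
      simp only [energyProcess]; ring
    rw [e1, e2, hLn]
    have : (1 + C) * C * (g * Real.exp (C * (1 + C) * A)) * Real.exp (C * T)
          * (clock a n - clock a m) * ∫ ω, B ω * S ω ∂P ≤ K * ∫ ω, B ω * S ω ∂P := by
      rw [hK]; gcongr
    linarith
  refine hZ.trans ?_
  have i1 := integrable_rpow_of_lt_one hΨm0 hΨm hs0 hs1
  have i2 := integrable_rpow_of_lt_one hS0 hSi hs0 hs1
  rw [← integral_const_mul, ← integral_add i1 (i2.const_mul _)]
  refine integral_mono_of_nonneg (ae_of_all _ fun ω => Real.rpow_nonneg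
    (add_nonneg (hΨm0 ω) (mul_nonneg hK0 (hS0 ω))) _) (i1.add (i2.const_mul _))
    (ae_of_all _ fun ω => ?_)
  simp only
  rw [← Real.mul_rpow hK0 (hS0 ω)]
  exact Real.rpow_add_le_add_rpow (hΨm0 ω) (mul_nonneg hK0 (hS0 ω)) hs0.le hs1.le

end StepSystem

end EnergyBlocks

/-! ### Summation over blocks and the Cauchy estimate. -/

section EnergySum

open scoped ENNReal ComplexConjugate

set_option linter.unusedSectionVars false

variable {Ω E : Type*} [mΩ : MeasurableSpace Ω] {P : Measure Ω} [IsProbabilityMeasure P]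
  [MetricSpace E] [CompactSpace E] [SecondCountableTopology E] [MeasurableSpace E] [BorelSpace E]
  {ν : Measure E} [IsProbabilityMeasure ν]

/-- The constant in the summed energy estimate. -/
noncomputable def energyConst (C A D ε s : ℝ) : ℝ :=
  ((1 + C) * C * Real.exp (C * (1 + C) * A) * Real.exp (C * (1 + C ^ 2)) * (1 + C ^ 2)) ^ s
    * D * Real.exp (ε * C ^ 2) * (1 - Real.exp (-ε))⁻¹

/-- The integrated chaos `∫ g W_n dν`. -/
noncomputable def chaosIntegral (ν : Measure E) (V : ℕ → Ω → E → ℂ) (g : E → ℂ) (n : ℕ)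
    (ω : Ω) : ℂ :=
  ∫ x, g x * density V n ω x ∂ν

namespace StepSystem

variable {𝓕 𝓖 : ℕ → MeasurableSpace Ω} {a : ℕ → ℝ} {C : ℝ} {near : ℕ → E × E → ℝ}
  {V u : ℕ → Ω → E → ℂ} {Γ : E × E → ℂ} {g : ℝ}

/-- The power s is taken once per unit of clock time. Taken at every step it would replace a_k² by
a_k^(2s), whose sum is not controlled. Over unit blocks the decay `hD` gives a geometric series. -/
lemma energyProcess_sum [Nonempty E] (hs : StepSystem P 𝓕 𝓖 a C near V u) (hΓ : PosKernel ν Γ)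
    (hg : ∀ z, ‖Γ z‖ ≤ g) {A : ℝ} (hA : ∀ n N, ∑ k ∈ Finset.Ico n N, a k ^ 3 ≤ A) {M N : ℕ}
    (hMN : M ≤ N) {L : ℕ → Ω → ℝ} (hL : WeakMartingaleFrom P 𝓕 M L)
    (h0 : ∀ k, M ≤ k → k ≤ N → ∀ ω, 0 ≤ energyProcess P ν a V u Γ N L k ω)
    {s : ℝ} (hs0 : 0 < s) (hs1 : s < 1) {D ε : ℝ} (hε : 0 < ε) (hD0 : 0 ≤ D)
    (hD : ∀ m, ∫ ω, absEnergy ν (near m) (density V m ω) ^ s ∂P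
      ≤ D * Real.exp (-ε * clock a m)) :
    ∫ ω, energyProcess P ν a V u Γ N L N ω ^ s ∂P
      ≤ ∫ ω, energyProcess P ν a V u Γ N L M ω ^ s ∂P
        + energyConst C A D ε s * g ^ s * Real.exp (-ε * clock a M) := by
  have hC := hs.C_pos
  have hg0 := nonneg_of_bound hg
  set K : ℝ := (1 + C) * C * Real.exp (C * (1 + C) * A) * Real.exp (C * (1 + C ^ 2))
    * (1 + C ^ 2) with hK
  have hK0 : 0 ≤ K := by positivity
  set R : ℝ := K ^ s * g ^ s * D * Real.exp (ε * C ^ 2) * Real.exp (-ε * clock a M) with hR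
  have hR0 : 0 ≤ R := by positivity
  set I : ℕ → ℝ := fun n => ∫ ω, energyProcess P ν a V u Γ N L n ω ^ s ∂P with hI
  have claim : ∀ i n : ℕ, M ≤ n → n ≤ N → clock a n ≤ clock a M + i →
      I n ≤ I M + R * ∑ j ∈ Finset.range i, Real.exp (-ε) ^ j := by
    intro i
    induction i with
    | zero =>
      intro n hMn hnN hn
      have : n = M := by
        refine le_antisymm ?_ hMn
        by_contra hlt
        push Not at hlt
        have := hs.clock_mono hlt
        simp at hn; linarith
      simp [this]
    | succ i ih =>
      intro n hMn hnN hn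
      rcases le_or_gt (clock a n) (clock a M + i) with hcase | hcase
      · refine (ih n hMn hnN hcase).trans ?_
        rw [Finset.sum_range_succ]
        have : 0 ≤ R * Real.exp (-ε) ^ i := by positivity
        linarith
      -- The last time before n with clock at most clock M + i. One step can overshoot by a_m² ≤ C²,
      -- hence the block length 1 + C² and the factor exp(ε C²).
      · obtain ⟨m, hMm, hmn, hm1, hm2⟩ : ∃ m, M ≤ m ∧ m < n ∧ clock a m ≤ clock a M + i ∧
            clock a M + i < clock a (m + 1) := by
          by_contra hcon
          push Not at hcon
          have : ∀ m, M ≤ m → m ≤ n → clock a m ≤ clock a M + i := by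
            intro m hMm
            induction m, hMm using Nat.le_induction with
            | base => intro _; have : (0 : ℝ) ≤ i := by positivity
                      linarith
            | succ m hm ihm => intro h; exact hcon m hm (by omega) (ihm (by omega))
          linarith [this n hMn le_rfl]
        have hc : clock a (m + 1) = clock a m + a m ^ 2 := Finset.sum_range_succ _ _
        have ham : a m ^ 2 ≤ C ^ 2 := by
          have := hs.a_le m; have := (hs.a_pos m).le; gcongr
        push_cast at hn
        have hblock := hs.energyProcess_block hΓ hg hA hMm hmn.le hnN (T := 1 + C ^ 2)
          (by linarith) hL h0 hs0 hs1
        have hS := hD m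
        have e1 : (1 + C) * C * (g * Real.exp (C * (1 + C) * A)) * Real.exp (C * (1 + C ^ 2))
            * (1 + C ^ 2) = K * g := by rw [hK]; ring
        rw [e1, Real.mul_rpow hK0 hg0] at hblock
        have hexp : Real.exp (-ε * clock a m)
            ≤ Real.exp (ε * C ^ 2) * Real.exp (-ε * clock a M) * Real.exp (-ε) ^ i := by
          rw [← Real.exp_nat_mul, ← Real.exp_add, ← Real.exp_add]
          refine Real.exp_le_exp.mpr ?_
          nlinarith
        have hfin : K ^ s * g ^ s * ∫ ω, absEnergy ν (near m) (density V m ω) ^ s ∂P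
            ≤ R * Real.exp (-ε) ^ i := by
          calc _ ≤ K ^ s * g ^ s * (D * (Real.exp (ε * C ^ 2) * Real.exp (-ε * clock a M)
                * Real.exp (-ε) ^ i)) := by
                gcongr
                exact hS.trans (by gcongr)
            _ = _ := by rw [hR]; ring
        rw [Finset.sum_range_succ, mul_add]
        have := ih m hMm (hmn.le.trans hnN) hm1
        linarith
  obtain ⟨i, hi⟩ := exists_nat_ge (clock a N - clock a M)
  have h1 := claim i N hMN le_rfl (by linarith)
  have hε1 : Real.exp (-ε) < 1 := by
    simpa using Real.exp_lt_exp.mpr (show -ε < 0 by linarith)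
  have h2 : ∑ j ∈ Finset.range i, Real.exp (-ε) ^ j ≤ (1 - Real.exp (-ε))⁻¹ := by
    rw [← tsum_geometric_of_lt_one (Real.exp_pos _).le hε1]
    exact (summable_geometric_of_lt_one (Real.exp_pos _).le hε1).sum_le_tsum _
      (fun _ _ => by positivity)
  refine h1.trans ?_
  have h3 : R * ∑ j ∈ Finset.range i, Real.exp (-ε) ^ j ≤ R * (1 - Real.exp (-ε))⁻¹ := by gcongr
  have h4 : R * (1 - Real.exp (-ε))⁻¹
      = energyConst C A D ε s * g ^ s * Real.exp (-ε * clock a M) := by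
    rw [hR, energyConst, ← hK]; ring
  linarith

/-- Concave moments of energies are bounded by the size of the kernel. -/
lemma integral_energy_rpow_le [Nonempty E] (hs : StepSystem P 𝓕 𝓖 a C near V u)
    (hΓ : PosKernel ν Γ) (hg : ∀ z, ‖Γ z‖ ≤ g) {A : ℝ}
    (hA : ∀ n N, ∑ k ∈ Finset.Ico n N, a k ^ 3 ≤ A)
    {s : ℝ} (hs0 : 0 < s) (hs1 : s < 1) {D ε : ℝ} (hε : 0 < ε) (hD0 : 0 ≤ D)
    (hD : ∀ m, ∫ ω, absEnergy ν (near m) (density V m ω) ^ s ∂P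
      ≤ D * Real.exp (-ε * clock a m)) (N : ℕ) :
    ∫ ω, (kernelPairing ν Γ (density V N ω) (density V N ω)).re ^ s ∂P
      ≤ (Real.exp (C * (1 + C) * A) ^ s + energyConst C A D ε s) * g ^ s := by
  have hC := hs.C_pos
  have hg0 := nonneg_of_bound hg
  -- With zero compensator the process is the plain energy. At time 0 the density is 1, so the
  -- initial value is at most the sup of the future kernel.
  have hL : WeakMartingaleFrom P 𝓕 0 (fun _ _ => (0 : ℝ)) :=
    ⟨fun _ _ => measurable_const, fun _ => integrable_const _, fun _ _ _ _ _ _ _ _ => rfl⟩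
  have h0 : ∀ k, 0 ≤ k → k ≤ N → ∀ ω,
      0 ≤ energyProcess P ν a V u Γ N (fun _ _ => (0 : ℝ)) k ω := by
    intro k _ hk ω
    simp only [energyProcess, add_zero]
    exact (hs.posKernel_future hΓ hk).pos _ (hs.density_continuous k ω)
  have h := hs.energyProcess_sum hΓ hg hA (Nat.zero_le N) hL h0 hs0 hs1 hε hD0 hD
  have e1 : ∀ ω, energyProcess P ν a V u Γ N (fun _ _ => (0 : ℝ)) N ω
      = (kernelPairing ν Γ (density V N ω) (density V N ω)).re := by
    intro ω
    have : futureKernel P a V u Γ N N = Γ := by funext z; simp [futureKernel]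
    simp [energyProcess, this]
  simp_rw [e1] at h
  refine h.trans ?_
  have e2 : ∀ ω, energyProcess P ν a V u Γ N (fun _ _ => (0 : ℝ)) 0 ω
      ≤ g * Real.exp (C * (1 + C) * A) := by
    intro ω
    simp only [energyProcess, add_zero, kernelPairing]
    refine (Complex.re_le_norm _).trans ?_
    have := norm_integral_le_of_norm_le_const (μ := ν.prod ν)
      (C := g * Real.exp (C * (1 + C) * A))
      (f := fun z : E × E => futureKernel P a V u Γ N 0 z * (density V 0 ω z.1
        * conj (density V 0 ω z.2))) (ae_of_all _ fun z => ?_)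
    · simpa using this
    · simp only [density, Finset.range_zero, Finset.prod_empty, map_one, mul_one]
      refine (hs.norm_futureKernel_le hg 0 N z).trans ?_
      have := hA 0 N
      gcongr
  have e3 : ∫ ω, energyProcess P ν a V u Γ N (fun _ _ => (0 : ℝ)) 0 ω ^ s ∂P
      ≤ Real.exp (C * (1 + C) * A) ^ s * g ^ s := by
    rw [← Real.mul_rpow (Real.exp_pos _).le hg0]
    calc _ ≤ ∫ _ : Ω, (Real.exp (C * (1 + C) * A) * g) ^ s ∂P := by
          refine integral_mono_of_nonneg (ae_of_all _ fun ω =>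
            Real.rpow_nonneg (h0 0 le_rfl (Nat.zero_le N) ω) _) (integrable_const _)
            (ae_of_all _ fun ω => ?_)
          exact Real.rpow_le_rpow (h0 0 le_rfl (Nat.zero_le N) ω)
            ((e2 ω).trans_eq (mul_comm _ _)) hs0.le
      _ = _ := by simp
  have e4 : clock a 0 = 0 := by simp [clock]
  rw [e4, mul_zero, Real.exp_zero, mul_one]
  linarith

section Chaos

variable {f : E → ℂ}

lemma kernelPairing_rankOne (n k : ℕ) (ω : Ω) :
    kernelPairing ν (fun z => f z.1 * conj (f z.2)) (density V n ω) (density V k ω)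
      = chaosIntegral ν V f n ω * conj (chaosIntegral ν V f k ω) := by
  unfold kernelPairing chaosIntegral
  rw [← integral_conj, ← integral_prod_mul]
  refine integral_congr_ae (ae_of_all _ fun z => ?_)
  simp only [map_mul]; ring

/-- The density at time 0 is 1, so a linear functional is also a kernel pairing and inherits its
measurability and Fubini lemmas. -/
lemma chaosIntegral_eq_kernelPairing (n : ℕ) (ω : Ω) :
    chaosIntegral ν V f n ω
      = kernelPairing ν (fun z => f z.1) (density V n ω) (density V 0 ω) := by
  unfold kernelPairing chaosIntegral
  have := integral_prod_mul (μ := ν) (ν := ν) (fun x => f x * density V n ω x)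
    (fun _ : E => (1 : ℂ))
  simp only [integral_const, probReal_univ, one_smul, mul_one] at this
  rw [← this]
  refine integral_congr_ae (ae_of_all _ fun z => ?_)
  simp [density]

lemma measurable_chaosIntegral (hs : StepSystem P 𝓕 𝓖 a C near V u) (hf : Continuous f) (n : ℕ) :
    Measurable[𝓕 n] (chaosIntegral ν V f n) := by
  have : chaosIntegral ν V f n = fun ω =>
      kernelPairing ν (fun z => f z.1) (density V n ω) (density V 0 ω) :=
    funext fun ω => chaosIntegral_eq_kernelPairing n ω
  rw [this]
  exact measurable_kernelPairing (hf.measurable.comp measurable_fst) (hs.density_continuous n)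
    (hs.density_measurable n) (hs.density_continuous 0)
    fun x => (hs.density_measurable 0 x).mono (hs.mono (Nat.zero_le n)) le_rfl

lemma exists_norm_le (hf : Continuous f) : ∃ c, 0 ≤ c ∧ ∀ x, ‖f x‖ ≤ c := by
  obtain ⟨c, hc⟩ := (isCompact_range hf).isBounded.exists_norm_le
  exact ⟨|c|, abs_nonneg _, fun x => (hc _ ⟨x, rfl⟩).trans (le_abs_self c)⟩

lemma integrable_chaosIntegral (hs : StepSystem P 𝓕 𝓖 a C near V u) (hf : Continuous f) (n : ℕ) :
    Integrable (chaosIntegral ν V f n) P := by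
  have : chaosIntegral ν V f n = fun ω =>
      kernelPairing ν (fun z => f z.1) (density V n ω) (density V 0 ω) :=
    funext fun ω => chaosIntegral_eq_kernelPairing n ω
  rw [this]
  obtain ⟨c, -, hc⟩ := exists_norm_le hf
  exact (hs.density_field n).integrable_kernelPairing (hs.density_field 0)
    (hf.measurable.comp measurable_fst) fun z => hc z.1

/-- The chaos is orthogonal to the past: the martingale property in weak form. -/
lemma integral_mul_chaosIntegral_succ (hs : StepSystem P 𝓕 𝓖 a C near V u) (hf : Continuous f)
    {m k : ℕ} (hmk : m ≤ k) {B : Ω → ℂ} (hB : Measurable[𝓕 m] B) {b : ℝ} (hb : ∀ ω, ‖B ω‖ ≤ b) :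
    ∫ ω, B ω * chaosIntegral ν V f (k + 1) ω ∂P = ∫ ω, B ω * chaosIntegral ν V f k ω ∂P := by
  obtain ⟨c, -, hc⟩ := exists_norm_le hf
  have hBm : Measurable B := hB.mono (hs.le m) le_rfl
  have hfm : Measurable fun z : E × E => f z.1 := hf.measurable.comp measurable_fst
  simp_rw [chaosIntegral_eq_kernelPairing]
  rw [(hs.density_field (k + 1)).integral_mul_kernelPairing (hs.density_field 0)
      hfm (fun z => hc z.1) hBm hb,
    (hs.density_field k).integral_mul_kernelPairing (hs.density_field 0)
      hfm (fun z => hc z.1) hBm hb]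
  refine integral_congr_ae (ae_of_all _ fun z => ?_)
  simp only
  rw [hs.cov_step_left hmk (Nat.zero_le k) hB]

/-- Added to |μ_n|², this process turns the energy of a rank one kernel into |μ_n - μ_M|², and it
does not change in conditional mean after time M. -/
lemma weakMartingale_cross (hs : StepSystem P 𝓕 𝓖 a C near V u) (hf : Continuous f) (M : ℕ) :
    WeakMartingaleFrom P 𝓕 M (fun n ω =>
      ‖chaosIntegral ν V f M ω‖ ^ 2
        - 2 * (chaosIntegral ν V f n ω * conj (chaosIntegral ν V f M ω)).re) := by
  obtain ⟨c, hc0, hc⟩ := exists_norm_le hf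
  have hΓ : Measurable fun z : E × E => f z.1 * conj (f z.2) := by fun_prop
  have hΓb : ∀ z : E × E, ‖f z.1 * conj (f z.2)‖ ≤ c * c := fun z => by
    rw [norm_mul, RCLike.norm_conj]
    have := hc z.1; have := hc z.2
    gcongr
  have hpair : ∀ n ω, chaosIntegral ν V f n ω * conj (chaosIntegral ν V f M ω)
      = kernelPairing ν (fun z => f z.1 * conj (f z.2)) (density V n ω) (density V M ω) :=
    fun n ω => (kernelPairing_rankOne n M ω).symm
  have hint : ∀ n, Integrable (fun ω => chaosIntegral ν V f n ω
      * conj (chaosIntegral ν V f M ω)) P := fun n => by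
    simp_rw [hpair]
    exact (hs.density_field n).integrable_kernelPairing (hs.density_field M) hΓ hΓb
  have hsq : Integrable (fun ω => ‖chaosIntegral ν V f M ω‖ ^ 2) P := by
    refine (hint M).re.congr (ae_of_all _ fun ω => ?_)
    simp only [RCLike.re_eq_complex_re]
    rw [Complex.mul_conj, Complex.ofReal_re, Complex.normSq_eq_norm_sq]
  refine ⟨fun n hn => ?_, fun n => hsq.sub ((hint n).re.const_mul 2), ?_⟩
  · have h1 := hs.measurable_chaosIntegral (ν := ν) hf n
    have h2 : Measurable[𝓕 n] (chaosIntegral ν V f M) :=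
      (hs.measurable_chaosIntegral hf M).mono (hs.mono hn) le_rfl
    exact ((measurable_norm.comp h2).pow_const 2).sub ((Complex.measurable_re.comp
      (h1.mul (Complex.continuous_conj.measurable.comp h2))).const_mul 2)
  · rintro m k hMm hmk B hB hB0 ⟨b, hb⟩
    have hBm : Measurable B := hB.mono (hs.le m) le_rfl
    have hBc : Measurable[𝓕 m] fun ω => (B ω : ℂ) := Complex.measurable_ofReal.comp hB
    have hre : ∀ n, Integrable (fun ω => (chaosIntegral ν V f n ω
      * conj (chaosIntegral ν V f M ω)).re) P := fun n => (hint n).re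
    have hbabs : ∀ ω, |B ω| ≤ b := fun ω => by rw [abs_of_nonneg (hB0 ω)]; exact hb ω
    have bdd : ∀ {X : Ω → ℝ}, Integrable X P → Integrable (fun ω => B ω * X ω) P := fun hX =>
      hX.bdd_mul (c := b) hBm.aestronglyMeasurable (ae_of_all _ hbabs)
    have key : ∀ n, ∫ ω, B ω * (‖chaosIntegral ν V f M ω‖ ^ 2
        - 2 * (chaosIntegral ν V f n ω * conj (chaosIntegral ν V f M ω)).re) ∂P
        = ∫ ω, B ω * ‖chaosIntegral ν V f M ω‖ ^ 2 ∂P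
          - 2 * ∫ ω, B ω * (chaosIntegral ν V f n ω * conj (chaosIntegral ν V f M ω)).re ∂P := by
      intro n
      rw [← integral_const_mul, ← integral_sub (bdd hsq) ((bdd (hre n)).const_mul 2)]
      refine integral_congr_ae (ae_of_all _ fun ω => ?_)
      simp only; ring
    rw [key, key]
    congr 2
    simp_rw [hpair]
    rw [(hs.density_field (k + 1)).integral_mul_re_kernelPairing (hs.density_field M) hΓ hΓb hBm
        hbabs, (hs.density_field k).integral_mul_re_kernelPairing (hs.density_field M) hΓ hΓb hBm
        hbabs]
    congr 1
    refine integral_congr_ae (ae_of_all _ fun z => ?_)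
    simp only
    rw [hs.cov_step_left hmk (hMm.trans hmk) hBc]

/-- Quantitative Cauchy estimate in `L^(2s)`. -/
theorem integral_norm_sub_rpow_le [Nonempty E] (hs : StepSystem P 𝓕 𝓖 a C near V u)
    (hf : Continuous f) {c : ℝ} (hc0 : 0 ≤ c) (hc : ∀ x, ‖f x‖ ≤ c) {A : ℝ}
    (hA : ∀ n N, ∑ k ∈ Finset.Ico n N, a k ^ 3 ≤ A)
    {s : ℝ} (hs0 : 0 < s) (hs1 : s < 1) {D ε : ℝ} (hε : 0 < ε) (hD0 : 0 ≤ D)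
    (hD : ∀ m, ∫ ω, absEnergy ν (near m) (density V m ω) ^ s ∂P
      ≤ D * Real.exp (-ε * clock a m)) {M N : ℕ} (hMN : M ≤ N) {τ : ℝ}
    (hτ : ∑ k ∈ Finset.Ico M N, a k ^ 3 ≤ τ) :
    ∫ ω, ‖chaosIntegral ν V f N ω - chaosIntegral ν V f M ω‖ ^ (2 * s) ∂P
      ≤ (Real.exp (C * (1 + C) * A) ^ s + energyConst C A D ε s)
          * (c * c * (Real.exp (C * (1 + C) * τ) - 1)) ^ s
        + energyConst C A D ε s * (c * c) ^ s * Real.exp (-ε * clock a M) := by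
  have hC := hs.C_pos
  set Γ : E × E → ℂ := fun z => f z.1 * conj (f z.2) with hΓdef
  have hΓ : PosKernel ν Γ := .rankOne hf
  have hΓb : ∀ z : E × E, ‖Γ z‖ ≤ c * c := fun z => by
    rw [hΓdef]; simp only; rw [norm_mul, RCLike.norm_conj]
    have := hc z.1; have := hc z.2
    gcongr
  set L : ℕ → Ω → ℝ := fun n ω => ‖chaosIntegral ν V f M ω‖ ^ 2
        - 2 * (chaosIntegral ν V f n ω * conj (chaosIntegral ν V f M ω)).re with hLdef
  have hL : WeakMartingaleFrom P 𝓕 M L := hs.weakMartingale_cross hf M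
  -- The process is a square plus the pairing with a positive kernel. At n = N the kernel vanishes
  -- and the square is left; at n = M the square vanishes and a small kernel is left.
  have hΨ : ∀ n, n ≤ N → ∀ ω, energyProcess P ν a V u Γ N L n ω
      = ‖chaosIntegral ν V f n ω - chaosIntegral ν V f M ω‖ ^ 2
        + (kernelPairing ν (fun z => futureKernel P a V u Γ N n z - Γ z)
          (density V n ω) (density V n ω)).re := by
    intro n hn ω
    obtain ⟨g', hg'⟩ := (hs.posKernel_future hΓ hn).bdd
    have e : kernelPairing ν (fun z => futureKernel P a V u Γ N n z - Γ z)
          (density V n ω) (density V n ω)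
        = kernelPairing ν (futureKernel P a V u Γ N n) (density V n ω) (density V n ω)
          - kernelPairing ν Γ (density V n ω) (density V n ω) := by
      unfold kernelPairing
      rw [← integral_sub (integrable_kernelPairing_const (hs.posKernel_future hΓ hn).meas hg'
        (hs.density_continuous n ω) (hs.density_continuous n ω))
        (integrable_kernelPairing_const hΓ.meas hΓb (hs.density_continuous n ω)
          (hs.density_continuous n ω))]
      simp_rw [sub_mul]
    rw [e, hΓdef, kernelPairing_rankOne n n ω, ← hΓdef]
    simp only [energyProcess, hLdef]
    rw [Complex.sub_re, Complex.mul_conj, Complex.ofReal_re, ← Complex.normSq_eq_norm_sq,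
      ← Complex.normSq_eq_norm_sq, Complex.normSq_sub]
    ring
  have hpos2 : ∀ n, n ≤ N → ∀ ω, 0 ≤ (kernelPairing ν (fun z => futureKernel P a V u Γ N n z - Γ z)
          (density V n ω) (density V n ω)).re := fun n hn ω =>
    (hs.posKernel_future_sub hΓ hn).pos _ (hs.density_continuous n ω)
  have h0 : ∀ k, M ≤ k → k ≤ N → ∀ ω, 0 ≤ energyProcess P ν a V u Γ N L k ω := by
    intro k _ hk ω
    rw [hΨ k hk]
    have := hpos2 k hk ω
    positivity
  have h := hs.energyProcess_sum hΓ hΓb hA hMN hL h0 hs0 hs1 hε hD0 hD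
  have eN : ∀ ω, energyProcess P ν a V u Γ N L N ω ^ s
      = ‖chaosIntegral ν V f N ω - chaosIntegral ν V f M ω‖ ^ (2 * s) := by
    intro ω
    have e1 : (fun z => futureKernel P a V u Γ N N z - Γ z) = fun _ => 0 := by
      funext z; simp [futureKernel]
    rw [hΨ N le_rfl, e1, Real.rpow_mul (norm_nonneg _)]
    simp [kernelPairing]
  have eM : ∀ ω, energyProcess P ν a V u Γ N L M ω
      = (kernelPairing ν (fun z => futureKernel P a V u Γ N M z - Γ z)
          (density V M ω) (density V M ω)).re := by
    intro ω; rw [hΨ M hMN]; simp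
  simp_rw [eN, eM] at h
  refine h.trans (add_le_add_left ?_ _)
  refine hs.integral_energy_rpow_le (hs.posKernel_future_sub hΓ hMN) (fun z => ?_) hA hs0 hs1 hε
    hD0 hD M
  refine (hs.norm_futureKernel_sub_le hΓb M N z).trans ?_
  gcongr

end Chaos

end StepSystem

end EnergySum

/-! ### Short-range energies by truncation. -/

section ShortRange

open scoped ENNReal

set_option linter.unusedSectionVars false

lemma lintegral_rpow_le_rpow_lintegral {α : Type*} [MeasurableSpace α] {μ : Measure α}
    [IsProbabilityMeasure μ] {f : α → ℝ≥0∞} (hf : Measurable f) {s : ℝ} (hs0 : 0 < s)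
    (hs1 : s ≤ 1) : ∫⁻ x, f x ^ s ∂μ ≤ (∫⁻ x, f x ∂μ) ^ s := by
  have h := eLpNorm'_le_eLpNorm'_of_exponent_le hs0 hs1 μ hf.aestronglyMeasurable
  simp only [eLpNorm', enorm_eq_self, ENNReal.rpow_one, div_one] at h
  rwa [← ENNReal.rpow_le_rpow_iff hs0, ← ENNReal.rpow_mul, one_div, inv_mul_cancel₀ hs0.ne',
    ENNReal.rpow_one] at h

lemma rpow_lintegral_le_lintegral_rpow {α : Type*} [MeasurableSpace α] {μ : Measure α}
    [IsProbabilityMeasure μ] {f : α → ℝ≥0∞} (hf : Measurable f) {p : ℝ} (hp : 1 ≤ p) :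
    (∫⁻ x, f x ∂μ) ^ p ≤ ∫⁻ x, f x ^ p ∂μ := by
  have hp0 : 0 < p := by linarith
  have h := eLpNorm'_le_eLpNorm'_of_exponent_le one_pos hp μ hf.aestronglyMeasurable
  simp only [eLpNorm', enorm_eq_self, ENNReal.rpow_one, div_one] at h
  rwa [← ENNReal.rpow_le_rpow_iff hp0, ← ENNReal.rpow_mul, one_div, inv_mul_cancel₀ hp0.ne',
    ENNReal.rpow_one] at h

variable {Ω E : Type*} [mΩ : MeasurableSpace Ω] {P : Measure Ω} [IsProbabilityMeasure P]
  [MetricSpace E] [CompactSpace E] [SecondCountableTopology E] [MeasurableSpace E] [BorelSpace E]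
  {ν : Measure E} [IsProbabilityMeasure ν]

/-- The truncated second moment estimate for short-range energies. -/
lemma lintegral_shortRange_rpow_le {W : Ω → E → ℝ≥0∞}
    (hW : Measurable fun p : Ω × E => W p.1 p.2) {s η r : ℝ} (hs : 1 / 2 ≤ s) (hs1 : s ≤ 1)
    (hη : 0 ≤ η) {l κ e₁ e₂ e₃ v : ℝ≥0∞} (hl0 : l ≠ 0) (hl : l ≠ ∞)
    (h1 : ∀ x, ∫⁻ ω, W ω x ∂P ≤ e₁) (h2 : ∀ x, ∫⁻ ω, W ω x ^ (2 * s) ∂P ≤ e₂)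
    (h3 : ∀ x, ∫⁻ ω, W ω x ^ (2 * s + η) ∂P ≤ e₃)
    (hv : ∀ x, ν (Metric.closedBall x r) ≤ v) :
    ∫⁻ ω, (∫⁻ z, ({z : E × E | dist z.1 z.2 ≤ r}.indicator 1 z + κ) * (W ω z.1 * W ω z.2)
        ∂(ν.prod ν)) ^ s ∂P
      ≤ (l * e₁ * v) ^ s + e₂ ^ (1 / 2 : ℝ) * (l ^ (-η) * e₃) ^ (1 / 2 : ℝ) + κ ^ s * e₂ := by
  have hs0 : 0 < s := by linarith
  have hWω : ∀ ω, Measurable (W ω) := fun ω => hW.comp measurable_prodMk_left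
  have hWx : ∀ x, Measurable fun ω => W ω x := fun x => hW.comp measurable_prodMk_right
  have hdist : MeasurableSet {z : E × E | dist z.1 z.2 ≤ r} :=
    (isClosed_le continuous_dist continuous_const).measurableSet
  -- Only the second factor of W(x)W(y) is truncated, so that the bounded part needs nothing beyond
  -- a first moment.
  set T : Ω → E → ℝ≥0∞ := fun ω x => if W ω x ≤ l then W ω x else 0 with hT
  set R : Ω → E → ℝ≥0∞ := fun ω x => if W ω x ≤ l then 0 else W ω x with hR
  have hTm : Measurable fun p : Ω × E => T p.1 p.2 :=
    Measurable.ite (measurableSet_le hW measurable_const) hW measurable_const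
  have hRm : Measurable fun p : Ω × E => R p.1 p.2 :=
    Measurable.ite (measurableSet_le hW measurable_const) measurable_const hW
  have hRω : ∀ ω, Measurable (R ω) := fun ω => hRm.comp measurable_prodMk_left
  have hTl : ∀ ω x, T ω x ≤ l := fun ω x => by
    simp only [hT]; split_ifs with h
    · exact h
    · exact zero_le
  have hTR : ∀ ω x, W ω x = T ω x + R ω x := fun ω x => by
    simp only [hT, hR]; split_ifs <;> simp
  -- Where R is nonzero W exceeds l, so η further powers of W may be traded for l^(-η).
  have hRp : ∀ ω x, R ω x ^ (2 * s) ≤ l ^ (-η) * W ω x ^ (2 * s + η) := fun ω x => by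
    simp only [hR]; split_ifs with h
    · rw [ENNReal.zero_rpow_of_pos (by linarith)]; exact zero_le
    · push Not at h
      rw [ENNReal.rpow_add_of_nonneg _ _ (by linarith) hη, mul_comm (W ω x ^ (2 * s)),
        ← mul_assoc]
      refine le_mul_of_one_le_left (zero_le) ?_
      rw [ENNReal.rpow_neg, ← ENNReal.div_eq_inv_mul,
        ENNReal.le_div_iff_mul_le (Or.inl (by
          intro h0; rw [ENNReal.rpow_eq_zero_iff] at h0
          rcases h0 with h0 | h0
          · exact hl0 h0.1
          · exact hl h0.1)) (Or.inl (ENNReal.rpow_ne_top_of_nonneg hη hl)), one_mul]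
      exact ENNReal.rpow_le_rpow h.le hη
  set A₁ : Ω → ℝ≥0∞ := fun ω => ∫⁻ z, {z : E × E | dist z.1 z.2 ≤ r}.indicator 1 z
    * (W ω z.1 * T ω z.2) ∂(ν.prod ν) with hA₁
  have hj1 : Measurable fun p : Ω × (E × E) => W p.1 p.2.1 :=
    hW.comp (measurable_fst.prodMk (measurable_fst.comp measurable_snd))
  have hj2 : Measurable fun p : Ω × (E × E) => T p.1 p.2.2 :=
    hTm.comp (measurable_fst.prodMk (measurable_snd.comp measurable_snd))
  have hind : Measurable ({z : E × E | dist z.1 z.2 ≤ r}.indicator (1 : E × E → ℝ≥0∞)) :=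
    measurable_one.indicator hdist
  have hj3 : Measurable fun p : Ω × (E × E) => {z : E × E | dist z.1 z.2 ≤ r}.indicator 1 p.2
      * (W p.1 p.2.1 * T p.1 p.2.2) := (hind.comp measurable_snd).mul (hj1.mul hj2)
  have hA₁m : Measurable A₁ := hj3.lintegral_prod_right'
  have hIm : Measurable fun ω => ∫⁻ x, W ω x ∂ν := hW.lintegral_prod_right'
  have hJm : Measurable fun ω => ∫⁻ x, R ω x ∂ν := hRm.lintegral_prod_right'
  have hsplit : ∀ ω, ∫⁻ z, ({z : E × E | dist z.1 z.2 ≤ r}.indicator 1 z + κ)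
      * (W ω z.1 * W ω z.2) ∂(ν.prod ν)
      ≤ A₁ ω + (∫⁻ x, W ω x ∂ν) * (∫⁻ x, R ω x ∂ν)
        + κ * ((∫⁻ x, W ω x ∂ν) * (∫⁻ x, W ω x ∂ν)) := by
    intro ω
    have m1 : Measurable fun z : E × E => W ω z.1 * W ω z.2 :=
      ((hWω ω).comp measurable_fst).mul ((hWω ω).comp measurable_snd)
    have m2 : Measurable fun z : E × E => W ω z.1 * R ω z.2 :=
      ((hWω ω).comp measurable_fst).mul ((hRω ω).comp measurable_snd)
    have m3 : Measurable fun z : E × E => {z : E × E | dist z.1 z.2 ≤ r}.indicator 1 z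
        * (W ω z.1 * T ω z.2) := hj3.comp measurable_prodMk_left
    rw [← lintegral_prod_mul (hWω ω).aemeasurable (hRω ω).aemeasurable,
      ← lintegral_prod_mul (hWω ω).aemeasurable (hWω ω).aemeasurable,
      ← lintegral_const_mul _ m1, ← lintegral_add_left m3, ← lintegral_add_right _ (m1.const_mul κ)]
    · refine lintegral_mono fun z => ?_
      rw [add_mul]
      gcongr
      by_cases hz : dist z.1 z.2 ≤ r
      · rw [Set.indicator_of_mem (by exact hz), Pi.one_apply, one_mul, one_mul, ← mul_add,
          ← hTR]
      · rw [Set.indicator_of_notMem (by exact hz)]; simp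
  have hsum : ∀ x y z : ℝ≥0∞, (x + y + z) ^ s ≤ x ^ s + y ^ s + z ^ s := fun x y z =>
    (ENNReal.rpow_add_le_add_rpow _ _ hs0.le hs1).trans
      (add_le_add_left (ENNReal.rpow_add_le_add_rpow _ _ hs0.le hs1) _)
  have hI2 : ∫⁻ ω, (∫⁻ x, W ω x ∂ν) ^ (2 * s) ∂P ≤ e₂ := by
    calc _ ≤ ∫⁻ ω, ∫⁻ x, W ω x ^ (2 * s) ∂ν ∂P :=
          lintegral_mono fun ω => rpow_lintegral_le_lintegral_rpow (hWω ω) (by linarith)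
      _ = ∫⁻ x, ∫⁻ ω, W ω x ^ (2 * s) ∂P ∂ν :=
          lintegral_lintegral_swap (hW.pow_const _).aemeasurable
      _ ≤ ∫⁻ _ : E, e₂ ∂ν := lintegral_mono h2
      _ = e₂ := by simp
  have hJ2 : ∫⁻ ω, (∫⁻ x, R ω x ∂ν) ^ (2 * s) ∂P ≤ l ^ (-η) * e₃ := by
    calc _ ≤ ∫⁻ ω, ∫⁻ x, R ω x ^ (2 * s) ∂ν ∂P :=
          lintegral_mono fun ω => rpow_lintegral_le_lintegral_rpow (hRω ω) (by linarith)
      _ = ∫⁻ x, ∫⁻ ω, R ω x ^ (2 * s) ∂P ∂ν :=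
          lintegral_lintegral_swap (hRm.pow_const _).aemeasurable
      _ ≤ ∫⁻ _ : E, l ^ (-η) * e₃ ∂ν := by
          refine lintegral_mono fun x => ?_
          calc _ ≤ ∫⁻ ω, l ^ (-η) * W ω x ^ (2 * s + η) ∂P := lintegral_mono fun ω => hRp ω x
            _ = l ^ (-η) * ∫⁻ ω, W ω x ^ (2 * s + η) ∂P :=
              lintegral_const_mul _ ((hWx x).pow_const _)
            _ ≤ _ := by gcongr; exact h3 x
      _ = _ := by simp
  have hb1 : ∫⁻ ω, A₁ ω ^ s ∂P ≤ (l * e₁ * v) ^ s := by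
    refine (lintegral_rpow_le_rpow_lintegral hA₁m hs0 hs1).trans ?_
    refine ENNReal.rpow_le_rpow ?_ hs0.le
    simp only [hA₁]
    rw [lintegral_lintegral_swap hj3.aemeasurable]
    calc _ ≤ ∫⁻ z : E × E, {z : E × E | dist z.1 z.2 ≤ r}.indicator 1 z * (l * e₁) ∂(ν.prod ν) := by
          refine lintegral_mono fun z => ?_
          have m1 : Measurable fun ω => W ω z.1 * T ω z.2 :=
            (hWx z.1).mul (hTm.comp measurable_prodMk_right)
          rw [lintegral_const_mul _ m1]
          gcongr
          calc _ ≤ ∫⁻ ω, l * W ω z.1 ∂P := lintegral_mono fun ω => by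
                rw [mul_comm]; gcongr; exact hTl ω z.2
            _ = l * ∫⁻ ω, W ω z.1 ∂P := lintegral_const_mul _ (hWx _)
            _ ≤ _ := by gcongr; exact h1 _
      _ = (ν.prod ν) {z : E × E | dist z.1 z.2 ≤ r} * (l * e₁) := by
          rw [lintegral_mul_const _ hind, lintegral_indicator_one hdist]
      _ ≤ v * (l * e₁) := by
          gcongr
          rw [Measure.prod_apply hdist]
          calc _ ≤ ∫⁻ _ : E, v ∂ν := by
                refine lintegral_mono fun x => ?_
                refine le_trans (measure_mono fun y hy => ?_) (hv x)
                simp only [Metric.mem_closedBall]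
                rw [dist_comm]; exact hy
            _ = v := by simp
      _ = l * e₁ * v := by ring
  -- The indicator is discarded here: Cauchy–Schwarz in ω suffices because the large values of W are
  -- already rare.
  have hb2 : ∫⁻ ω, ((∫⁻ x, W ω x ∂ν) * (∫⁻ x, R ω x ∂ν)) ^ s ∂P
      ≤ e₂ ^ (1 / 2 : ℝ) * (l ^ (-η) * e₃) ^ (1 / 2 : ℝ) := by
    have hh := ENNReal.lintegral_mul_le_Lp_mul_Lq P Real.HolderConjugate.two_two
      (hIm.pow_const s).aemeasurable (hJm.pow_const s).aemeasurable
    simp only [Pi.mul_apply, ← ENNReal.rpow_mul] at hh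
    simp_rw [ENNReal.mul_rpow_of_nonneg _ _ hs0.le]
    refine hh.trans ?_
    rw [mul_comm s 2]
    gcongr
  have hb3 : ∫⁻ ω, (κ * ((∫⁻ x, W ω x ∂ν) * (∫⁻ x, W ω x ∂ν))) ^ s ∂P ≤ κ ^ s * e₂ := by
    have e : ∀ ω, (κ * ((∫⁻ x, W ω x ∂ν) * (∫⁻ x, W ω x ∂ν))) ^ s
        = κ ^ s * (∫⁻ x, W ω x ∂ν) ^ (2 * s) := fun ω => by
      rw [ENNReal.mul_rpow_of_nonneg _ _ hs0.le, ENNReal.rpow_mul, ← sq, ENNReal.rpow_two]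
    simp_rw [e]
    rw [lintegral_const_mul _ (hIm.pow_const _)]
    gcongr
  calc _ ≤ ∫⁻ ω, (A₁ ω ^ s + ((∫⁻ x, W ω x ∂ν) * (∫⁻ x, R ω x ∂ν)) ^ s
        + (κ * ((∫⁻ x, W ω x ∂ν) * (∫⁻ x, W ω x ∂ν))) ^ s) ∂P :=
        lintegral_mono fun ω => (ENNReal.rpow_le_rpow (hsplit ω) hs0.le).trans (hsum _ _ _)
    _ = ∫⁻ ω, A₁ ω ^ s ∂P + ∫⁻ ω, ((∫⁻ x, W ω x ∂ν) * (∫⁻ x, R ω x ∂ν)) ^ s ∂P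
        + ∫⁻ ω, (κ * ((∫⁻ x, W ω x ∂ν) * (∫⁻ x, W ω x ∂ν))) ^ s ∂P := by
        have m3 : Measurable fun ω =>
            (κ * ((∫⁻ x, W ω x ∂ν) * (∫⁻ x, W ω x ∂ν))) ^ s :=
          ((hIm.mul hIm).const_mul κ).pow_const s
        rw [lintegral_add_right _ m3, lintegral_add_left (hA₁m.pow_const s)]
    _ ≤ _ := by gcongr

end ShortRange

/-! ### Exponential decay in clock time of the short-range energy. -/

section ShortRangeDecay

open scoped ENNReal

set_option linter.unusedSectionVars false

variable {Ω E : Type*} [mΩ : MeasurableSpace Ω] {P : Measure Ω} [IsProbabilityMeasure P]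
  [MetricSpace E] [CompactSpace E] [SecondCountableTopology E] [MeasurableSpace E] [BorelSpace E]
  {ν : Measure E} [IsProbabilityMeasure ν]

/-- The short-range kernel: the indicator of a neighbourhood of the diagonal plus a constant. -/
noncomputable def nearKernel (r κ : ℝ) (z : E × E) : ℝ :=
  {z : E × E | dist z.1 z.2 ≤ r}.indicator 1 z + κ

lemma measurable_nearKernel (r κ : ℝ) : Measurable (nearKernel r κ : E × E → ℝ) :=
  (measurable_one.indicator
    (isClosed_le continuous_dist continuous_const).measurableSet).add_const κ

lemma nearKernel_nonneg (r : ℝ) {κ : ℝ} (hκ : 0 ≤ κ) (z : E × E) : 0 ≤ nearKernel r κ z :=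
  add_nonneg (Set.indicator_nonneg (fun _ _ => zero_le_one) z) hκ

lemma nearKernel_le (r κ : ℝ) (z : E × E) : nearKernel r κ z ≤ 1 + κ :=
  add_le_add_left (Set.indicator_le_self' (fun _ _ => zero_le_one) z) κ

/-- Exponential decay of the short-range energy. -/
lemma integral_absEnergy_rpow_le {W : Ω → E → ℂ} (hW : Measurable fun p : Ω × E => W p.1 p.2)
    {s η θ δ d l K B v E₁ E₂ E₃ ε t : ℝ} (hs : 1 / 2 ≤ s) (hs1 : s ≤ 1) (hη : 0 ≤ η)
    (hK : 0 ≤ K) (hB : 0 ≤ B) (hv : 0 ≤ v) (ht : 0 ≤ t)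
    (h1 : ∀ x, ∫⁻ ω, ‖W ω x‖ₑ ∂P ≤ ENNReal.ofReal (B * Real.exp (E₁ * t)))
    (h2 : ∀ x, ∫⁻ ω, ‖W ω x‖ₑ ^ (2 * s) ∂P ≤ ENNReal.ofReal (B * Real.exp (E₂ * t)))
    (h3 : ∀ x, ∫⁻ ω, ‖W ω x‖ₑ ^ (2 * s + η) ∂P ≤ ENNReal.ofReal (B * Real.exp (E₃ * t)))
    (hball : ∀ x, ν (Metric.closedBall x (Real.exp (-(1 - θ) * t)))
      ≤ ENNReal.ofReal (v * Real.exp (-(1 - θ) * d * t)))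
    (c1 : s * (l + E₁ - (1 - θ) * d) ≤ -ε) (c2 : (E₂ + E₃ - η * l) / 2 ≤ -ε)
    (c3 : E₂ - s * (θ * δ) ≤ -ε) :
    ∫ ω, absEnergy ν (nearKernel (Real.exp (-(1 - θ) * t)) (K * Real.exp (-(θ * δ) * t))) (W ω) ^ s
        ∂P
      ≤ ((B * v) ^ s + B + K ^ s * B) * Real.exp (-ε * t) := by
  have hs0 : 0 < s := by linarith
  set r := Real.exp (-(1 - θ) * t) with hr
  set κ := K * Real.exp (-(θ * δ) * t) with hκ
  have hκ0 : 0 ≤ κ := by positivity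
  have hn0 : ∀ z : E × E, 0 ≤ nearKernel r κ z := nearKernel_nonneg r hκ0
  have hlam : ENNReal.ofReal (Real.exp (l * t)) ≠ 0 := by simp [Real.exp_pos]
  have main := lintegral_shortRange_rpow_le (P := P) (ν := ν) (W := fun ω x => ‖W ω x‖ₑ) hW.enorm
    (r := r) hs hs1 hη (l := ENNReal.ofReal (Real.exp (l * t))) (κ := ENNReal.ofReal κ)
    hlam ENNReal.ofReal_ne_top h1 h2 h3 hball
  have hle : ∀ ω, ENNReal.ofReal (absEnergy ν (nearKernel r κ) (W ω) ^ s)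
      ≤ (∫⁻ z, ({z : E × E | dist z.1 z.2 ≤ r}.indicator 1 z + ENNReal.ofReal κ)
        * (‖W ω z.1‖ₑ * ‖W ω z.2‖ₑ) ∂(ν.prod ν)) ^ s := by
    intro ω
    have hm : Measurable (W ω) := hW.comp measurable_prodMk_left
    rw [← ENNReal.ofReal_rpow_of_nonneg (absEnergy_nonneg hn0 _) hs0.le]
    refine ENNReal.rpow_le_rpow ?_ hs0.le
    have hmz : Measurable fun z : E × E => nearKernel r κ z * (‖W ω z.1‖ * ‖W ω z.2‖) :=
      (measurable_nearKernel r κ).mul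
        ((hm.norm.comp measurable_fst).mul (hm.norm.comp measurable_snd))
    rw [absEnergy, integral_eq_lintegral_of_nonneg_ae
      (ae_of_all _ fun z => mul_nonneg (hn0 z) (by positivity)) hmz.aestronglyMeasurable]
    refine ENNReal.ofReal_toReal_le.trans (lintegral_mono fun z => ?_)
    rw [ENNReal.ofReal_mul (hn0 z), ENNReal.ofReal_mul (norm_nonneg _), ofReal_norm,
      ofReal_norm, nearKernel]
    gcongr
    by_cases hz : z ∈ {z : E × E | dist z.1 z.2 ≤ r}
    · rw [Set.indicator_of_mem hz, Set.indicator_of_mem hz, Pi.one_apply, Pi.one_apply,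
        ENNReal.ofReal_add zero_le_one hκ0, ENNReal.ofReal_one]
    · rw [Set.indicator_of_notMem hz, Set.indicator_of_notMem hz, zero_add, zero_add]
  have hSm : Measurable fun ω => absEnergy ν (nearKernel r κ) (W ω) := by
    have h : Measurable fun p : Ω × (E × E) =>
        nearKernel r κ p.2 * (‖W p.1 p.2.1‖ * ‖W p.1 p.2.2‖) :=
      ((measurable_nearKernel r κ).comp measurable_snd).mul
        ((measurable_norm.comp
            (hW.comp (measurable_fst.prodMk (measurable_fst.comp measurable_snd)))).mul
          (measurable_norm.comp
            (hW.comp (measurable_fst.prodMk (measurable_snd.comp measurable_snd)))))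
    exact (h.stronglyMeasurable.integral_prod_right (ν := ν.prod ν)).measurable
  rw [integral_eq_lintegral_of_nonneg_ae
    (ae_of_all _ fun ω => Real.rpow_nonneg (absEnergy_nonneg hn0 _) _)
    (hSm.pow_const s).aestronglyMeasurable]
  refine ENNReal.toReal_le_of_le_ofReal (by positivity) ?_
  refine (lintegral_mono hle).trans (main.trans ?_)
  -- With truncation level e^{lt}, the three terms of the truncation bound decay by the conditions
  -- `c1`, `c2` and `c3` respectively.
  have t1 : (ENNReal.ofReal (Real.exp (l * t)) * ENNReal.ofReal (B * Real.exp (E₁ * t))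
      * ENNReal.ofReal (v * Real.exp (-(1 - θ) * d * t))) ^ s
      ≤ ENNReal.ofReal ((B * v) ^ s * Real.exp (-ε * t)) := by
    rw [← ENNReal.ofReal_mul (by positivity), ← ENNReal.ofReal_mul (by positivity),
      ENNReal.ofReal_rpow_of_nonneg (by positivity) hs0.le]
    refine ENNReal.ofReal_le_ofReal ?_
    have e : Real.exp (l * t) * (B * Real.exp (E₁ * t)) * (v * Real.exp (-(1 - θ) * d * t))
        = (B * v) * Real.exp ((l + E₁ - (1 - θ) * d) * t) := by
      rw [show (l + E₁ - (1 - θ) * d) * t = l * t + E₁ * t + -(1 - θ) * d * t by ring,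
        Real.exp_add, Real.exp_add]; ring
    rw [e, Real.mul_rpow (by positivity) (Real.exp_pos _).le, ← Real.exp_mul]
    refine mul_le_mul_of_nonneg_left (Real.exp_le_exp.mpr ?_) (by positivity)
    calc (l + E₁ - (1 - θ) * d) * t * s = s * (l + E₁ - (1 - θ) * d) * t := by ring
      _ ≤ -ε * t := by gcongr
  have t2 : ENNReal.ofReal (B * Real.exp (E₂ * t)) ^ (1 / 2 : ℝ)
      * (ENNReal.ofReal (Real.exp (l * t)) ^ (-η) * ENNReal.ofReal (B * Real.exp (E₃ * t)))
        ^ (1 / 2 : ℝ) ≤ ENNReal.ofReal (B * Real.exp (-ε * t)) := by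
    rw [ENNReal.ofReal_rpow_of_pos (Real.exp_pos _), ← ENNReal.ofReal_mul (by positivity),
      ENNReal.ofReal_rpow_of_nonneg (by positivity) (by norm_num),
      ENNReal.ofReal_rpow_of_nonneg (by positivity) (by norm_num),
      ← ENNReal.ofReal_mul (by positivity)]
    refine ENNReal.ofReal_le_ofReal ?_
    rw [← Real.mul_rpow (by positivity) (by positivity), ← Real.exp_mul]
    have e : B * Real.exp (E₂ * t) * (Real.exp (l * t * -η) * (B * Real.exp (E₃ * t)))
        = (B * Real.exp ((E₂ + E₃ - η * l) / 2 * t)) ^ 2 := by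
      rw [mul_pow, ← Real.exp_nat_mul,
        show ((2 : ℕ) : ℝ) * ((E₂ + E₃ - η * l) / 2 * t) = E₂ * t + l * t * -η + E₃ * t by
          push_cast; ring, Real.exp_add, Real.exp_add]; ring
    rw [e, ← Real.sqrt_eq_rpow, Real.sqrt_sq (by positivity)]
    gcongr
  have t3 : ENNReal.ofReal κ ^ s * ENNReal.ofReal (B * Real.exp (E₂ * t))
      ≤ ENNReal.ofReal (K ^ s * B * Real.exp (-ε * t)) := by
    rw [ENNReal.ofReal_rpow_of_nonneg hκ0 hs0.le, ← ENNReal.ofReal_mul (by positivity)]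
    refine ENNReal.ofReal_le_ofReal ?_
    rw [hκ, Real.mul_rpow hK (Real.exp_pos _).le, ← Real.exp_mul]
    have e : K ^ s * Real.exp (-(θ * δ) * t * s) * (B * Real.exp (E₂ * t))
        = K ^ s * B * Real.exp ((E₂ - s * (θ * δ)) * t) := by
      rw [show (E₂ - s * (θ * δ)) * t = -(θ * δ) * t * s + E₂ * t by ring, Real.exp_add]; ring
    rw [e]
    gcongr
  calc _ ≤ ENNReal.ofReal ((B * v) ^ s * Real.exp (-ε * t)) + ENNReal.ofReal (B * Real.exp (-ε * t))
        + ENNReal.ofReal (K ^ s * B * Real.exp (-ε * t)) := add_le_add (add_le_add t1 t2) t3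
    _ = _ := by
      rw [← ENNReal.ofReal_add (by positivity) (by positivity),
        ← ENNReal.ofReal_add (by positivity) (by positivity)]
      congr 1; ring

end ShortRangeDecay

/-! ### Arithmetic of the subcritical range. -/

/-- Choice of the parameters of the `L^p` estimate near a subcritical real point. -/
lemma exists_subcritical_parameters {β₀ d δ : ℝ} (hβ : β₀ ^ 2 < 2 * d) (hδ : 0 < δ) :
    ∃ s η θ l ε ρ : ℝ, 1 / 2 < s ∧ s < 1 ∧ 0 < η ∧ 0 < θ ∧ θ < 1 ∧ 0 < ε ∧ 0 < ρ ∧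
      ∀ β ∈ Metric.ball (β₀ : ℂ) ρ,
        s * (l + momentExponent 1 β - (1 - θ) * d) ≤ -ε ∧
        (momentExponent (2 * s) β + momentExponent (2 * s + η) β - η * l) / 2 ≤ -ε ∧
        momentExponent (2 * s) β - s * (θ * δ) ≤ -ε := by
  have hd : 0 < d := by nlinarith [sq_nonneg β₀]
  -- The one place where subcriticality enters. Next, η is taken so small that (1+η)β₀²/2 < l, and θ
  -- so that (1-θ)d is the midpoint of l and d.
  obtain ⟨l, hl1, hl2⟩ := exists_between (show β₀ ^ 2 / 2 < d by linarith)
  have hl0 : 0 < l := by nlinarith [sq_nonneg β₀]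
  set η := (l - β₀ ^ 2 / 2) / (β₀ ^ 2 + 1) with hη
  have hη0 : 0 < η := div_pos (by linarith) (by positivity)
  have hη1 : η * (β₀ ^ 2 + 1) = l - β₀ ^ 2 / 2 := by rw [hη]; field_simp
  have hη2 : (1 + η) * (β₀ ^ 2 / 2) < l := by nlinarith [sq_nonneg β₀]
  set θ := (d - l) / (2 * d) with hθ
  have hθ0 : 0 < θ := div_pos (by linarith) (by linarith)
  have hθd : θ * (2 * d) = d - l := by rw [hθ]; field_simp
  have hθ1 : θ < 1 := by nlinarith
  have hθ2 : l < (1 - θ) * d := by nlinarith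
  let F₁ : ℝ × ℂ → ℝ := fun p => p.1 * (l + momentExponent 1 p.2 - (1 - θ) * d)
  let F₂ : ℝ × ℂ → ℝ := fun p =>
    (momentExponent (2 * p.1) p.2 + momentExponent (2 * p.1 + η) p.2 - η * l) / 2
  let F₃ : ℝ × ℂ → ℝ := fun p => momentExponent (2 * p.1) p.2 - p.1 * (θ * δ)
  have c₁ : Continuous F₁ := by unfold F₁ momentExponent; fun_prop
  have c₂ : Continuous F₂ := by unfold F₂ momentExponent; fun_prop
  have c₃ : Continuous F₃ := by unfold F₃ momentExponent; fun_prop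
  -- At s = 1/2 and real β₀ the first moment exponent is zero, and strictness leaves room for s >
  -- 1/2 and complex β by continuity.
  have n₁ : F₁ (1 / 2, β₀) < 0 := by
    simp only [F₁, momentExponent, Complex.ofReal_re, Complex.ofReal_im]; nlinarith
  have n₂ : F₂ (1 / 2, β₀) < 0 := by
    simp only [F₂, momentExponent, Complex.ofReal_re, Complex.ofReal_im]
    have : η * ((1 + η) * (β₀ ^ 2 / 2)) < η * l := mul_lt_mul_of_pos_left hη2 hη0
    nlinarith
  have n₃ : F₃ (1 / 2, β₀) < 0 := by
    simp only [F₃, momentExponent, Complex.ofReal_re, Complex.ofReal_im]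
    have : 0 < θ * δ := by positivity
    nlinarith
  obtain ⟨ε, hε0, hε⟩ : ∃ ε > 0, F₁ (1 / 2, β₀) < -ε ∧ F₂ (1 / 2, β₀) < -ε ∧
      F₃ (1 / 2, β₀) < -ε := by
    refine ⟨min (-F₁ (1 / 2, β₀)) (min (-F₂ (1 / 2, β₀)) (-F₃ (1 / 2, β₀))) / 2, ?_, ?_⟩
    · have : 0 < min (-F₁ (1 / 2, β₀)) (min (-F₂ (1 / 2, β₀)) (-F₃ (1 / 2, β₀))) :=
        lt_min (by linarith) (lt_min (by linarith) (by linarith))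
      linarith
    · have h0 : 0 < min (-F₁ (1 / 2, β₀)) (min (-F₂ (1 / 2, β₀)) (-F₃ (1 / 2, β₀))) :=
        lt_min (by linarith) (lt_min (by linarith) (by linarith))
      have h1 := min_le_left (-F₁ (1 / 2, β₀)) (min (-F₂ (1 / 2, β₀)) (-F₃ (1 / 2, β₀)))
      have h2 := (min_le_right (-F₁ (1 / 2, β₀)) (min (-F₂ (1 / 2, β₀)) (-F₃ (1 / 2, β₀)))).trans
        (min_le_left _ _)
      have h3 := (min_le_right (-F₁ (1 / 2, β₀)) (min (-F₂ (1 / 2, β₀)) (-F₃ (1 / 2, β₀)))).trans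
        (min_le_right _ _)
      refine ⟨?_, ?_, ?_⟩ <;> linarith
  have hev : ∀ᶠ p in 𝓝 ((1 / 2 : ℝ), (β₀ : ℂ)), F₁ p < -ε ∧ F₂ p < -ε ∧ F₃ p < -ε :=
    (c₁.continuousAt.eventually_lt continuousAt_const hε.1).and
      ((c₂.continuousAt.eventually_lt continuousAt_const hε.2.1).and
        (c₃.continuousAt.eventually_lt continuousAt_const hε.2.2))
  rw [Metric.eventually_nhds_iff_ball] at hev
  obtain ⟨ρ, hρ, hball⟩ := hev
  refine ⟨1 / 2 + min (ρ / 2) (1 / 4), η, θ, l, ε, ρ, ?_, ?_, hη0, hθ0, hθ1, hε0, hρ,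
    fun β hβ => ?_⟩
  · have : 0 < min (ρ / 2) (1 / 4 : ℝ) := lt_min (by linarith) (by norm_num)
    linarith
  · have := min_le_right (ρ / 2) (1 / 4 : ℝ); linarith
  · have hmem : ((1 / 2 + min (ρ / 2) (1 / 4) : ℝ), β) ∈ Metric.ball ((1 / 2 : ℝ), (β₀ : ℂ)) ρ := by
      rw [← ball_prod_same]
      refine Set.mk_mem_prod ?_ hβ
      rw [Metric.mem_ball, Real.dist_eq]
      have h0 : 0 < min (ρ / 2) (1 / 4 : ℝ) := lt_min (by linarith) (by norm_num)
      have := min_le_left (ρ / 2) (1 / 4 : ℝ)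
      rw [show 1 / 2 + min (ρ / 2) (1 / 4) - 1 / 2 = min (ρ / 2) (1 / 4 : ℝ) by ring,
        abs_of_pos h0]
      linarith
    obtain ⟨h1, h2, h3⟩ := hball _ hmem
    exact ⟨h1.le, h2.le, h3.le⟩

/-! ### The unit cube as a compact probability space. -/

section Cube

open scoped ENNReal

lemma unitCube_eq_preimage (d : ℕ) :
    unitCube d = WithLp.ofLp (p := 2) ⁻¹' (Set.univ.pi fun _ : Fin d => Set.Icc (0 : ℝ) 1) := by
  ext x; simp [unitCube, Pi.le_def, forall_and]

lemma isCompact_unitCube (d : ℕ) : IsCompact (unitCube d) := by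
  rw [unitCube_eq_preimage]
  exact (PiLp.homeomorph 2 fun _ : Fin d => ℝ).isCompact_preimage.mpr
    (isCompact_univ_pi fun _ => isCompact_Icc)

lemma measurableSet_unitCube (d : ℕ) : MeasurableSet (unitCube d) :=
  (isCompact_unitCube d).isClosed.measurableSet

lemma volume_unitCube (d : ℕ) : volume (unitCube d) = 1 := by
  rw [unitCube_eq_preimage, (PiLp.volume_preserving_ofLp (Fin d)).measure_preimage
    (MeasurableSet.univ_pi fun _ => measurableSet_Icc).nullMeasurableSet, volume_pi_pi]
  simp

instance compactSpace_unitCube (d : ℕ) : CompactSpace (unitCube d) :=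
  isCompact_iff_compactSpace.mp (isCompact_unitCube d)

instance nonempty_unitCube (d : ℕ) : Nonempty (unitCube d) :=
  ⟨⟨0, fun _ => by simp⟩⟩

/-- Lebesgue measure on the unit cube. -/
noncomputable def cubeMeasure (d : ℕ) : Measure (unitCube d) := volume.comap Subtype.val

instance isProbabilityMeasure_cubeMeasure (d : ℕ) : IsProbabilityMeasure (cubeMeasure d) := by
  constructor
  rw [cubeMeasure, comap_subtype_coe_apply (measurableSet_unitCube d), Set.image_univ,
    Subtype.range_coe, volume_unitCube]

lemma cubeMeasure_closedBall_le (d : ℕ) : ∃ v : ℝ, 0 ≤ v ∧ ∀ (x : unitCube d) (r : ℝ), 0 ≤ r →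
    cubeMeasure d (Metric.closedBall x r) ≤ ENNReal.ofReal (v * r ^ d) := by
  refine ⟨(volume (Metric.ball (0 : EuclideanSpace ℝ (Fin d)) 1)).toReal, ENNReal.toReal_nonneg,
    fun x r hr => ?_⟩
  have hsub : Subtype.val '' Metric.closedBall x r ⊆ Metric.closedBall (x : EuclideanSpace ℝ (Fin d)) r := by
    rintro _ ⟨y, hy, rfl⟩; exact hy
  rw [cubeMeasure, comap_subtype_coe_apply (measurableSet_unitCube d)]
  refine (measure_mono hsub).trans_eq ?_
  rw [Measure.addHaar_closedBall _ _ hr, finrank_euclideanSpace_fin, mul_comm,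
    ENNReal.ofReal_mul ENNReal.toReal_nonneg, ENNReal.ofReal_toReal measure_ball_lt_top.ne]

lemma setIntegral_unitCube {d : ℕ} (F : EuclideanSpace ℝ (Fin d) → ℂ) :
    ∫ x in unitCube d, F x = ∫ x : unitCube d, F x ∂cubeMeasure d :=
  (integral_subtype_comap (measurableSet_unitCube d) F).symm

end Cube

/-! ### The dilated fields as a step system. -/

section Model

open scoped ComplexConjugate

set_option linter.unusedSectionVars false

/-- The standing assumptions on the fields, the amplitudes and the dilation factors. -/
structure ChaosModel {Ω : Type*} [MeasurableSpace Ω] (P : Measure Ω) {d : ℕ}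
    (Y : ℕ → Ω → EuclideanSpace ℝ (Fin d) → ℝ) (f : ℝ → ℝ) (δ : ℝ) (a b c : ℕ → ℝ) : Prop where
  meas : ∀ k x, Measurable (fun ω => Y k ω x)
  cont : ∀ k ω, Continuous (Y k ω)
  indep : iIndepFun Y P
  ident : ∀ k, IdentDistrib (Y k) (Y 0) P P
  stat : ∀ k, IsStationaryField P (Y k)
  centered : ∀ k x, ∫ ω, Y k ω x ∂P = 0
  exp : ∀ k, ∀ l : ℝ, Integrable (fun ω => Real.exp (l * Y k ω 0)) P
  cov : ∀ k x y, ∫ ω, Y k ω x * Y k ω y ∂P = f ‖x - y‖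
  f_zero : f 0 = 1
  delta_pos : 0 < δ
  f_top : f =O[atTop] (fun t : ℝ => t ^ (-δ))
  a_pos : ∀ k, 0 < a k
  a_lim : Tendsto a atTop (𝓝 0)
  a_sq : ¬ Summable (fun k => a k ^ 2)
  a_cube : Summable (fun k => a k ^ 3)
  c_bdd : ∃ C : ℝ, ∀ k, |c k| ≤ C
  b_eq : ∀ k, b k = Real.exp (∑ j ∈ Finset.range (k + 1), a j ^ 2 + c k)

/-- The normalised factor `exp (β X_k(x)) / 𝔼 exp (β X_k(x))`. -/
noncomputable def chaosStep {Ω : Type*} [MeasurableSpace Ω] (P : Measure Ω) {d : ℕ}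
    (Y : ℕ → Ω → EuclideanSpace ℝ (Fin d) → ℝ) (a b : ℕ → ℝ) (β : ℂ) (k : ℕ) (ω : Ω)
    (x : unitCube d) : ℂ :=
  Complex.exp (β * a k * Y k ω (b k • (x : EuclideanSpace ℝ (Fin d)))) /
    complexMGF (fun ω => Y 0 ω 0) P (β * a k)

/-- The linear part `β X_k(x)` of the normalised factor. -/
noncomputable def linearStep {Ω : Type*} {d : ℕ} (Y : ℕ → Ω → EuclideanSpace ℝ (Fin d) → ℝ)
    (a b : ℕ → ℝ) (β : ℂ) (k : ℕ) (ω : Ω) (x : unitCube d) : ℂ :=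
  β * a k * Y k ω (b k • (x : EuclideanSpace ℝ (Fin d)))

/-- The σ-algebra generated by the field `Y k`. -/
@[reducible] def fieldSigma {Ω : Type*} {d : ℕ} (Y : ℕ → Ω → EuclideanSpace ℝ (Fin d) → ℝ) (k : ℕ) :
    MeasurableSpace Ω :=
  ⨆ x : EuclideanSpace ℝ (Fin d), MeasurableSpace.comap (fun ω => Y k ω x) inferInstance

namespace ChaosModel

variable {Ω : Type*} [mΩ : MeasurableSpace Ω] {P : Measure Ω} [IsProbabilityMeasure P] {d : ℕ}
  {Y : ℕ → Ω → EuclideanSpace ℝ (Fin d) → ℝ} {f : ℝ → ℝ} {δ : ℝ} {a b c : ℕ → ℝ}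

/-- Stationarity moves x to the origin and equality of laws moves k to 0, so every one-point
quantity reduces to the single variable Y_0(0). -/
lemma identDistrib (h : ChaosModel P Y f δ a b c) (k : ℕ) (x : EuclideanSpace ℝ (Fin d)) :
    IdentDistrib (fun ω => Y k ω x) (fun ω => Y 0 ω 0) P P := by
  have h1 := (h.stat k x).comp (measurable_pi_apply (0 : EuclideanSpace ℝ (Fin d)))
  have h2 := (h.ident k).comp (measurable_pi_apply (0 : EuclideanSpace ℝ (Fin d)))
  have h3 := h1.trans h2
  simpa [Function.comp_def] using h3

lemma expMoments (h : ChaosModel P Y f δ a b c) : HasExpMoments P fun ω => Y 0 ω 0 :=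
  ⟨h.meas 0 0, h.exp 0⟩

lemma variance_eq_one (h : ChaosModel P Y f δ a b c) : ∫ ω, Y 0 ω 0 ^ 2 ∂P = 1 := by
  have := h.cov 0 0 0
  simp only [sub_self, norm_zero, h.f_zero] at this
  simpa [sq] using this

lemma fieldSigma_eq_comap (Y : ℕ → Ω → EuclideanSpace ℝ (Fin d) → ℝ) (k : ℕ) :
    fieldSigma Y k = MeasurableSpace.comap (Y k) inferInstance := by
  simp only [fieldSigma, MeasurableSpace.pi, MeasurableSpace.comap_iSup, MeasurableSpace.comap_comp]
  rfl

lemma fieldFiltration_apply (h : ChaosModel P Y f δ a b c) (n : ℕ) :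
    fieldFiltration Y h.meas n = ⨆ k ∈ {k : ℕ | k < n}, fieldSigma Y k := rfl

lemma indep_fieldSigma (h : ChaosModel P Y f δ a b c) (n : ℕ) :
    Indep (fieldFiltration Y h.meas n) (fieldSigma Y n) P := by
  have hi : iIndep (fieldSigma Y) P := by
    have := h.indep.iIndep
    simpa only [← fieldSigma_eq_comap] using this
  have h1 := indep_iSup_of_disjoint (fun k => iSup_le fun x => (h.meas k x).comap_le) hi
    (S := {k : ℕ | k < n}) (T := {n}) (by simp)
  rw [h.fieldFiltration_apply]
  rwa [iSup_singleton] at h1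

lemma measurable_fieldSigma (k : ℕ) (x : EuclideanSpace ℝ (Fin d)) :
    Measurable[fieldSigma Y k] fun ω => Y k ω x :=
  measurable_iff_comap_le.mpr (le_iSup (fun x => MeasurableSpace.comap (fun ω => Y k ω x) _) x)

lemma complexMGF_eq (h : ChaosModel P Y f δ a b c) (k : ℕ) (x : EuclideanSpace ℝ (Fin d)) (z : ℂ) :
    ∫ ω, Complex.exp (z * Y k ω x) ∂P = complexMGF (fun ω => Y 0 ω 0) P z := by
  have := (h.identDistrib k x).comp (u := fun y : ℝ => Complex.exp (z * y)) (by fun_prop)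
  exact this.integral_eq

lemma exp_fieldSum (β : ℂ) (n : ℕ) (ω : Ω) (x : EuclideanSpace ℝ (Fin d)) :
    Complex.exp (β * (fieldSum (dilatedField a b Y) n ω x : ℂ))
      = ∏ k ∈ Finset.range n, Complex.exp (β * a k * Y k ω (b k • x)) := by
  rw [← Complex.exp_sum, fieldSum, Complex.ofReal_sum, Finset.mul_sum]
  simp [dilatedField, mul_assoc]

/-- The product form from independence is free of x by stationarity. The denominator thus leaves the
spatial integral, and it is entire in β. -/
lemma chaosNormalizer_eq (h : ChaosModel P Y f δ a b c) (n : ℕ) (β : ℂ)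
    (x : EuclideanSpace ℝ (Fin d)) :
    chaosNormalizer P (dilatedField a b Y) n β x
      = ∏ k ∈ Finset.range n, complexMGF (fun ω => Y 0 ω 0) P (β * a k) := by
  have hi : iIndepFun (fun k ω => Complex.exp (β * a k * Y k ω (b k • x))) P :=
    h.indep.comp (fun k y => Complex.exp (β * a k * y (b k • x))) fun k => by fun_prop
  have hm : ∀ k, Measurable fun ω => Complex.exp (β * a k * Y k ω (b k • x)) := fun k =>
    Complex.measurable_exp.comp ((Complex.measurable_ofReal.comp (h.meas k _)).const_mul _)
  simp only [chaosNormalizer, exp_fieldSum, Finset.prod_range]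
  have hi' : iIndepFun (fun (k : Fin n) ω => Complex.exp (β * a k * Y k ω (b k • x))) P :=
    hi.precomp (g := fun k : Fin n => (k : ℕ)) Fin.val_injective
  rw [hi'.integral_fun_prod_eq_prod_integral fun k => (hm k).aestronglyMeasurable]
  exact Finset.prod_congr rfl fun k _ => h.complexMGF_eq _ _ _

lemma chaos_eq (h : ChaosModel P Y f δ a b c) (n : ℕ) (g : EuclideanSpace ℝ (Fin d) → ℂ) (β : ℂ)
    (ω : Ω) :
    chaos P (dilatedField a b Y) n g β ω
      = chaosIntegral (cubeMeasure d) (chaosStep P Y a b β) (fun x => g x) n ω := by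
  rw [chaos, setIntegral_unitCube, chaosIntegral]
  refine integral_congr_ae (ae_of_all _ fun x => ?_)
  simp only [h.chaosNormalizer_eq, exp_fieldSum, density, chaosStep, Finset.prod_div_distrib]

lemma integrable_field_sq (h : ChaosModel P Y f δ a b c) (k : ℕ) (x : EuclideanSpace ℝ (Fin d)) :
    Integrable (fun ω => Y k ω x ^ 2) P := by
  have h1 := (h.identDistrib k x).comp (u := fun y : ℝ => y ^ 2) (by fun_prop)
  exact h1.integrable_iff.mpr (h.expMoments.integrable_pow 2)

lemma integral_field_sq (h : ChaosModel P Y f δ a b c) (k : ℕ) (x : EuclideanSpace ℝ (Fin d)) :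
    ∫ ω, Y k ω x ^ 2 ∂P = 1 := by
  have := h.cov k x x
  simpa [sq, h.f_zero] using this

lemma abs_covariance_le_one (h : ChaosModel P Y f δ a b c) (k : ℕ)
    (x y : EuclideanSpace ℝ (Fin d)) : |∫ ω, Y k ω x * Y k ω y ∂P| ≤ 1 := by
  have hi : Integrable (fun ω => (Y k ω x ^ 2 + Y k ω y ^ 2) / 2) P :=
    ((h.integrable_field_sq k x).add (h.integrable_field_sq k y)).div_const 2
  have hval : ∫ ω, (Y k ω x ^ 2 + Y k ω y ^ 2) / 2 ∂P = 1 := by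
    rw [integral_div, integral_add (h.integrable_field_sq k x) (h.integrable_field_sq k y),
      h.integral_field_sq, h.integral_field_sq]
    norm_num
  rw [← hval, ← Real.norm_eq_abs]
  refine norm_integral_le_of_norm_le hi (ae_of_all _ fun ω => ?_)
  rw [Real.norm_eq_abs, abs_le]
  constructor <;> nlinarith [sq_nonneg (Y k ω x - Y k ω y), sq_nonneg (Y k ω x + Y k ω y)]

/-- Decay of the covariance of the rescaled fields at the scales that matter. -/
lemma exists_covariance_le (h : ChaosModel P Y f δ a b c) (θ : ℝ) : ∃ K, 0 ≤ K ∧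
    ∀ m k, m ≤ k → ∀ x y : unitCube d,
      |∫ ω, Y k ω (b k • (x : EuclideanSpace ℝ (Fin d))) *
          Y k ω (b k • (y : EuclideanSpace ℝ (Fin d))) ∂P|
        ≤ nearKernel (Real.exp (-(1 - θ) * clock a m)) (K * Real.exp (-(θ * δ) * clock a m))
          (x, y) := by
  obtain ⟨Cc, hCc⟩ := h.c_bdd
  obtain ⟨K₀, hK₀⟩ := h.f_top.bound
  obtain ⟨T, hT⟩ := Filter.eventually_atTop.mp hK₀
  have hδ := h.delta_pos
  set T₁ := max T 1 with hT₁
  have hT₁0 : 0 < T₁ := lt_of_lt_of_le one_pos (le_max_right _ _)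
  -- For r ≤ T₁ the trivial bound 1 is at most T₁^δ r^(-δ), so this constant extends the polynomial
  -- decay to all r > 0.
  set K₁ := max |K₀| (T₁ ^ δ) with hK₁
  have hK₁0 : 0 ≤ K₁ := (abs_nonneg _).trans (le_max_left _ _)
  refine ⟨K₁ * Real.exp (Cc * δ), by positivity, fun m k hmk x y => ?_⟩
  set κ := K₁ * Real.exp (Cc * δ) * Real.exp (-(θ * δ) * clock a m) with hκ
  have hκ0 : 0 ≤ κ := by positivity
  -- Points closer than e^{-(1-θ)t} use the trivial bound 1. For farther points the dilation b_k ≥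
  -- e^{t - Cc} separates the arguments by at least e^{θt - Cc}, and the decay of f gives a multiple
  -- of e^{-θδt}.
  by_cases hd : dist x y ≤ Real.exp (-(1 - θ) * clock a m)
  · refine (h.abs_covariance_le_one k _ _).trans ?_
    rw [nearKernel, Set.indicator_of_mem (by exact hd)]
    simpa using hκ0
  · push Not at hd
    rw [nearKernel, Set.indicator_of_notMem (by simpa using hd), zero_add]
    have hbk : 0 < b k := by rw [h.b_eq]; exact Real.exp_pos _
    set r := ‖b k • (x : EuclideanSpace ℝ (Fin d)) - b k • (y : EuclideanSpace ℝ (Fin d))‖ with hr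
    have hrd : r = b k * dist x y := by
      rw [hr, ← smul_sub, norm_smul, Real.norm_eq_abs, abs_of_pos hbk, Subtype.dist_eq,
        dist_eq_norm]
    have hlow : Real.exp (θ * clock a m - Cc) ≤ r := by
      have h1 : clock a m ≤ ∑ j ∈ Finset.range (k + 1), a j ^ 2 :=
        Finset.sum_le_sum_of_subset_of_nonneg
          (Finset.range_mono (Nat.le_succ_of_le hmk)) fun _ _ _ => sq_nonneg _
      have h2 := (abs_le.mp (hCc k)).1
      calc Real.exp (θ * clock a m - Cc)
          = Real.exp (clock a m - Cc) * Real.exp (-(1 - θ) * clock a m) := by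
            rw [← Real.exp_add]; congr 1; ring
        _ ≤ b k * dist x y := by
            rw [h.b_eq]
            gcongr
            linarith
        _ = r := hrd.symm
    have hr0 : 0 < r := (Real.exp_pos _).trans_le hlow
    have hdecay : |∫ ω, Y k ω (b k • (x : EuclideanSpace ℝ (Fin d))) *
          Y k ω (b k • (y : EuclideanSpace ℝ (Fin d))) ∂P| ≤ K₁ * r ^ (-δ) := by
      rcases le_total T₁ r with hTr | hTr
      · rw [h.cov, ← hr]
        have := hT r ((le_max_left _ _).trans hTr)
        rw [Real.norm_eq_abs, Real.norm_eq_abs, abs_of_pos (Real.rpow_pos_of_pos hr0 _)] at this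
        refine this.trans ?_
        gcongr
        exact (le_abs_self _).trans (le_max_left _ _)
      · refine (h.abs_covariance_le_one k _ _).trans ?_
        rw [Real.rpow_neg hr0.le, ← div_eq_mul_inv, le_div_iff₀ (Real.rpow_pos_of_pos hr0 _),
          one_mul]
        exact (Real.rpow_le_rpow hr0.le hTr hδ.le).trans (le_max_right _ _)
    refine hdecay.trans ?_
    rw [hκ, mul_assoc, ← Real.exp_add]
    gcongr
    rw [show Cc * δ + -(θ * δ) * clock a m = (θ * clock a m - Cc) * (-δ) by ring, Real.exp_mul]
    exact Real.rpow_le_rpow_of_nonpos (Real.exp_pos _) hlow (by linarith)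

lemma linearStep_covariance (β : ℂ) (k : ℕ) (x y : unitCube d) :
    ‖∫ ω, linearStep Y a b β k ω x * conj (linearStep Y a b β k ω y) ∂P‖
      = ‖β‖ ^ 2 * a k ^ 2 * |∫ ω, Y k ω (b k • (x : EuclideanSpace ℝ (Fin d))) *
          Y k ω (b k • (y : EuclideanSpace ℝ (Fin d))) ∂P| := by
  have h1 : ∀ ω, linearStep Y a b β k ω x * conj (linearStep Y a b β k ω y)
      = ((‖β‖ ^ 2 * a k ^ 2 : ℝ) : ℂ) *
        ((Y k ω (b k • (x : EuclideanSpace ℝ (Fin d))) *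
          Y k ω (b k • (y : EuclideanSpace ℝ (Fin d))) : ℝ) : ℂ) := by
    intro ω
    have : β * conj β = ((‖β‖ ^ 2 : ℝ) : ℂ) := by
      rw [Complex.mul_conj, Complex.normSq_eq_norm_sq]
    simp only [linearStep, map_mul, Complex.conj_ofReal]
    push_cast at this ⊢
    rw [← this]; ring
  simp_rw [h1]
  rw [integral_const_mul, integral_complex_ofReal, norm_mul, Complex.norm_real, Complex.norm_real,
    Real.norm_eq_abs, Real.norm_eq_abs, abs_of_nonneg (by positivity)]

lemma exists_amplitude_le (h : ChaosModel P Y f δ a b c) : ∃ A, 0 < A ∧ ∀ k, a k ≤ A := by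
  obtain ⟨A, hA⟩ := h.a_lim.bddAbove_range
  exact ⟨A, (h.a_pos 0).trans_le (hA ⟨0, rfl⟩), fun k => hA ⟨k, rfl⟩⟩

/-- Absolute moments of the normalised factors. -/
lemma exists_moment_bound (h : ChaosModel P Y f δ a b c) (R : ℝ) {c₀ q : ℝ} (hc₀ : 0 < c₀)
    (hq : 0 ≤ q) : ∃ C, 0 ≤ C ∧ ∀ β : ℂ, ‖β‖ ≤ R →
      (∀ k, c₀ ≤ ‖complexMGF (fun ω => Y 0 ω 0) P (β * a k)‖) → ∀ k x,
        Integrable (fun ω => ‖chaosStep P Y a b β k ω x‖ ^ q) P ∧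
        ∫ ω, ‖chaosStep P Y a b β k ω x‖ ^ q ∂P
          ≤ Real.exp (momentExponent q β * a k ^ 2 + C * a k ^ 3) := by
  obtain ⟨A, hA0, hA⟩ := h.exists_amplitude_le
  obtain ⟨C, hC0, hC⟩ := h.expMoments.integral_norm_rpow_le (h.centered 0 0) h.variance_eq_one
    (R := R) hq hc₀
  refine ⟨C, hC0, fun β hβ hβc k x => ?_⟩
  obtain ⟨h1, h2⟩ := hC β hβ (a k) (h.a_pos k).le (hA k) (hβc k)
  have hid := (h.identDistrib k (b k • (x : EuclideanSpace ℝ (Fin d)))).comp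
    (u := fun y : ℝ => ‖Complex.exp (β * a k * y) / complexMGF (fun ω => Y 0 ω 0) P (β * a k)‖ ^ q)
    (by fun_prop)
  exact ⟨hid.integrable_iff.mpr h1, hid.integral_eq.trans_le h2⟩

/-- The fields form a step system, with constants uniform over bounded sets of `β` on which the
normalising factors stay away from `0`. -/
lemma exists_stepSystem (h : ChaosModel P Y f δ a b c) {θ : ℝ} (hθ : 0 ≤ θ) {R : ℝ} (hR : 0 ≤ R)
    {c₀ : ℝ} (hc₀ : 0 < c₀) :
    ∃ K C, 0 ≤ K ∧ ∀ β : ℂ, ‖β‖ ≤ R →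
      (∀ k, c₀ ≤ ‖complexMGF (fun ω => Y 0 ω 0) P (β * a k)‖) →
      StepSystem P (fun n => fieldFiltration Y h.meas n) (fieldSigma Y) a C
        (fun m => nearKernel (Real.exp (-(1 - θ) * clock a m))
          (K * Real.exp (-(θ * δ) * clock a m)))
        (chaosStep P Y a b β) (linearStep Y a b β) := by
  obtain ⟨K, hK0, hK⟩ := h.exists_covariance_le θ
  obtain ⟨A, hA0, hA⟩ := h.exists_amplitude_le
  obtain ⟨C₁, hC₁0, hC₁⟩ := h.exists_moment_bound R hc₀ (q := 2) (by norm_num)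
  obtain ⟨C₂, hC₂0, hC₂⟩ := h.expMoments.integral_norm_sq_normalised_remainder_le (h.centered 0 0)
    h.variance_eq_one (R * A) hc₀
  -- The summands bound, in order, the amplitudes, the second moments of the factors, the remainder,
  -- the short-range kernel and the linear covariance.
  refine ⟨K, A + (R ^ 2 + C₁ * A) + C₂ * R ^ 4 + (1 + K) + R ^ 2, hK0, fun β hβ hβc => ?_⟩
  set C := A + (R ^ 2 + C₁ * A) + C₂ * R ^ 4 + (1 + K) + R ^ 2 with hC
  have p1 : 0 ≤ R ^ 2 + C₁ * A := by positivity
  have p2 : 0 ≤ C₂ * R ^ 4 := by positivity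
  have p3 : 0 ≤ R ^ 2 := by positivity
  have hclock : ∀ m, 0 ≤ clock a m := fun m => Finset.sum_nonneg fun _ _ => sq_nonneg _
  have hmeas : ∀ k (x : unitCube d), Measurable[fieldSigma Y k] fun ω =>
      (Y k ω (b k • (x : EuclideanSpace ℝ (Fin d))) : ℂ) := fun k x =>
    Complex.measurable_ofReal.comp (measurable_fieldSigma k _)
  have hcont : ∀ k ω, Continuous fun x : unitCube d =>
      (Y k ω (b k • (x : EuclideanSpace ℝ (Fin d))) : ℂ) := fun k ω =>
    Complex.continuous_ofReal.comp ((h.cont k ω).comp (by fun_prop))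
  have hrem : ∀ k (x : unitCube d),
      Integrable (fun ω => ‖chaosStep P Y a b β k ω x - 1 - linearStep Y a b β k ω x‖ ^ 2) P ∧
      ∫ ω, ‖chaosStep P Y a b β k ω x - 1 - linearStep Y a b β k ω x‖ ^ 2 ∂P
        ≤ C * a k ^ 4 := by
    intro k x
    have hak := (h.a_pos k).le
    have hn : ‖β * (a k : ℂ)‖ = ‖β‖ * a k := by
      rw [norm_mul, Complex.norm_real, Real.norm_eq_abs, abs_of_nonneg hak]
    obtain ⟨h1, h2⟩ := hC₂ (β * a k) (by rw [hn]; exact mul_le_mul hβ (hA k) hak hR) (hβc k)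
    have hid := (h.identDistrib k (b k • (x : EuclideanSpace ℝ (Fin d)))).comp
      (u := fun y : ℝ => ‖Complex.exp (β * a k * y) / complexMGF (fun ω => Y 0 ω 0) P (β * a k)
        - 1 - β * a k * y‖ ^ 2) (by fun_prop)
    refine ⟨hid.integrable_iff.mpr h1, hid.integral_eq.trans_le (h2.trans ?_)⟩
    rw [hn, mul_pow, ← mul_assoc]
    refine mul_le_mul_of_nonneg_right ?_ (by positivity)
    have : C₂ * ‖β‖ ^ 4 ≤ C₂ * R ^ 4 := by gcongr
    linarith
  have hsq : ∀ k (x : unitCube d), Integrable (fun ω => ‖chaosStep P Y a b β k ω x‖ ^ 2) P ∧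
      ∫ ω, ‖chaosStep P Y a b β k ω x‖ ^ 2 ∂P ≤ Real.exp (C * a k ^ 2) := by
    intro k x
    obtain ⟨h1, h2⟩ := hC₁ β hβ hβc k x
    simp only [Real.rpow_two] at h1 h2
    refine ⟨h1, h2.trans (Real.exp_le_exp.mpr ?_)⟩
    have e1 : momentExponent 2 β = ‖β‖ ^ 2 := by
      rw [← Complex.normSq_eq_norm_sq, Complex.normSq_apply, momentExponent]; ring
    have e2 : ‖β‖ ^ 2 ≤ R ^ 2 := by gcongr
    have e3 : C₁ * a k ≤ C₁ * A := mul_le_mul_of_nonneg_left (hA k) hC₁0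
    rw [e1, pow_succ (a k) 2]
    nlinarith [sq_nonneg (a k)]
  exact
    { mono := fun _ _ hmn => (fieldFiltration Y h.meas).mono hmn
      le := (fieldFiltration Y h.meas).le
      le_succ := fun k => by
        rw [h.fieldFiltration_apply]
        exact le_iSup₂_of_le (f := fun k (_ : k ∈ {j : ℕ | j < _}) => fieldSigma Y k) k
          (Nat.lt_succ_self k) le_rfl
      indep := h.indep_fieldSigma
      a_pos := h.a_pos
      a_le := fun k => (hA k).trans (by linarith)
      V_cont := fun k ω => by
        unfold chaosStep
        exact (Complex.continuous_exp.comp (continuous_const.mul (hcont k ω))).div_const _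
      V_meas := fun k x =>
        (Complex.measurable_exp.comp ((hmeas k x).const_mul _)).div_const _
      V_mean := fun k x => by
        simp only [chaosStep]
        rw [integral_div, h.complexMGF_eq, div_self]
        exact norm_pos_iff.mp (hc₀.trans_le (hβc k))
      V_int := fun k x => (hsq k x).1
      V_sq := fun k x => (hsq k x).2
      u_cont := fun k ω => continuous_const.mul (hcont k ω)
      u_meas := fun k x => (hmeas k x).const_mul _
      h_int := fun k x => (hrem k x).1
      h_sq := fun k x => (hrem k x).2
      near_meas := fun m => measurable_nearKernel _ _
      near_nonneg := fun m => nearKernel_nonneg _ (by positivity)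
      near_le := fun m z => by
        refine (nearKernel_le _ _ z).trans ?_
        have : K * Real.exp (-(θ * δ) * clock a m) ≤ K := by
          refine mul_le_of_le_one_right hK0 (Real.exp_le_one_iff.mpr ?_)
          have := mul_nonneg (mul_nonneg hθ h.delta_pos.le) (hclock m)
          linarith
        linarith
      u_cov := fun m k hmk x y => by
        rw [linearStep_covariance]
        refine mul_le_mul ?_ (hK m k hmk x y) (abs_nonneg _) (by positivity)
        refine mul_le_mul_of_nonneg_right ?_ (sq_nonneg _)
        have : ‖β‖ ^ 2 ≤ R ^ 2 := by gcongr
        linarith }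

/-- Absolute moments of the density. -/
lemma exists_density_moment_bound (h : ChaosModel P Y f δ a b c) (R : ℝ) {c₀ q : ℝ}
    (hc₀ : 0 < c₀) (hq : 0 ≤ q) : ∃ B, 0 ≤ B ∧ ∀ β : ℂ, ‖β‖ ≤ R →
      (∀ k, c₀ ≤ ‖complexMGF (fun ω => Y 0 ω 0) P (β * a k)‖) → ∀ n x,
        ∫⁻ ω, ‖density (chaosStep P Y a b β) n ω x‖ₑ ^ q ∂P
          ≤ ENNReal.ofReal (B * Real.exp (momentExponent q β * clock a n)) := by
  obtain ⟨C, hC0, hC⟩ := h.exists_moment_bound R hc₀ hq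
  -- The cubic errors of all the factors together cost a bounded constant; only the clock term
  -- grows.
  refine ⟨Real.exp (C * ∑' k, a k ^ 3), (Real.exp_pos _).le, fun β hβ hβc n x => ?_⟩
  -- The choice θ = 0 is immaterial: what is used is that the moments factorise by independence.
  obtain ⟨K, C', -, hs⟩ := h.exists_stepSystem le_rfl ((norm_nonneg _).trans hβ) hc₀
  have hM : ∀ k x, ∫⁻ ω, ‖chaosStep P Y a b β k ω x‖ₑ ^ q ∂P
      ≤ ENNReal.ofReal (Real.exp (momentExponent q β * a k ^ 2 + C * a k ^ 3)) := by
    intro k x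
    obtain ⟨h1, h2⟩ := hC β hβ hβc k x
    have h3 : ∀ ω, ‖chaosStep P Y a b β k ω x‖ₑ ^ q
        = ENNReal.ofReal (‖chaosStep P Y a b β k ω x‖ ^ q) := fun ω => by
      rw [← ofReal_norm, ENNReal.ofReal_rpow_of_nonneg (norm_nonneg _) hq]
    simp_rw [h3]
    rw [← ofReal_integral_eq_lintegral_ofReal h1
      (ae_of_all _ fun ω => Real.rpow_nonneg (norm_nonneg _) _)]
    exact ENNReal.ofReal_le_ofReal h2
  refine ((hs β hβ hβc).lintegral_density_rpow_le hq hM n x).trans ?_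
  rw [← ENNReal.ofReal_prod_of_nonneg fun _ _ => (Real.exp_pos _).le, ← Real.exp_sum,
    ← Real.exp_add]
  refine ENNReal.ofReal_le_ofReal (Real.exp_le_exp.mpr ?_)
  rw [Finset.sum_add_distrib, ← Finset.mul_sum, ← Finset.mul_sum, clock, add_comm]
  gcongr
  exact h.a_cube.sum_le_tsum _ fun k _ => pow_nonneg (h.a_pos k).le 3

end ChaosModel

end Model

/-! ### Uniform Cauchy property in L^p near a subcritical point. -/

section CauchyEstimate

open scoped ComplexConjugate ENNReal

set_option linter.unusedSectionVars false

/-- The integrated chaos has finite second moment. -/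
lemma StepSystem.memLp_two_chaosIntegral {Ω E : Type*} [mΩ : MeasurableSpace Ω] {P : Measure Ω}
    [IsProbabilityMeasure P] [MetricSpace E] [CompactSpace E] [SecondCountableTopology E]
    [MeasurableSpace E] [BorelSpace E] {ν : Measure E} [IsProbabilityMeasure ν]
    {𝓕 𝓖 : ℕ → MeasurableSpace Ω} {a : ℕ → ℝ} {C : ℝ} {near : ℕ → E × E → ℝ}
    {V u : ℕ → Ω → E → ℂ} (hs : StepSystem P 𝓕 𝓖 a C near V u) {g : E → ℂ} (hg : Continuous g)
    (n : ℕ) : MemLp (chaosIntegral ν V g n) 2 P := by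
  have hm := (hs.measurable_chaosIntegral (ν := ν) hg n).mono (hs.le n) le_rfl
  refine ⟨hm.aestronglyMeasurable, ?_⟩
  obtain ⟨c, hc0, hc⟩ := StepSystem.exists_norm_le hg
  obtain ⟨B, hB, hBW⟩ := (hs.density_field n).bdd
  have hW := (hs.density_field n).meas
  rw [eLpNorm_lt_top_iff_lintegral_rpow_enorm_lt_top (by norm_num) (by norm_num)]
  simp only [ENNReal.toReal_ofNat, ENNReal.rpow_two]
  have h1 : ∀ ω, ‖chaosIntegral ν V g n ω‖ₑ ^ 2
      ≤ ∫⁻ x, ENNReal.ofReal c ^ 2 * ‖density V n ω x‖ₑ ^ 2 ∂ν := by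
    intro ω
    have hgw : Measurable fun x => ‖g x * density V n ω x‖ₑ :=
      (hg.mul (hs.density_continuous n ω)).measurable.enorm
    have h2 := rpow_lintegral_le_lintegral_rpow (μ := ν) hgw (p := 2) (by norm_num)
    simp only [ENNReal.rpow_two] at h2
    refine (pow_le_pow_left' (enorm_integral_le_lintegral_enorm _) 2).trans (h2.trans ?_)
    refine lintegral_mono fun x => ?_
    rw [enorm_mul, mul_pow]
    gcongr
    rw [← ofReal_norm]
    exact ENNReal.ofReal_le_ofReal (hc x)
  refine (lintegral_mono h1).trans_lt ?_
  rw [lintegral_lintegral_swap ((hW.enorm.pow_const 2).const_mul _).aemeasurable]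
  refine (lintegral_mono (g := fun _ => ENNReal.ofReal c ^ 2 * B) fun x => ?_).trans_lt ?_
  · rw [lintegral_const_mul _ (((hs.density_field n).meas_right x).enorm.pow_const 2)]
    exact mul_le_mul_right (hBW x) _
  · rw [lintegral_const, measure_univ, mul_one]
    exact ENNReal.mul_lt_top (by simp) hB.lt_top

namespace ChaosModel

variable {Ω : Type*} [mΩ : MeasurableSpace Ω] {P : Measure Ω} [IsProbabilityMeasure P] {d : ℕ}
  {Y : ℕ → Ω → EuclideanSpace ℝ (Fin d) → ℝ} {f : ℝ → ℝ} {δ : ℝ} {a b c : ℕ → ℝ}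

lemma tendsto_clock (h : ChaosModel P Y f δ a b c) : Tendsto (clock a) atTop atTop :=
  (not_summable_iff_tendsto_nat_atTop_of_nonneg fun _ => sq_nonneg _).mp h.a_sq

/-- Around every subcritical parameter the chaos is a Cauchy sequence in some `L^p`, `p > 1`,
uniformly in the parameter. -/
lemma exists_ball_cauchy (h : ChaosModel P Y f δ a b c) {t : ℝ} (ht0 : 0 < t)
    (ht : t < Real.sqrt (2 * d)) :
    ∃ r > 0, ∃ p : ℝ, 1 < p ∧ p < 2 ∧ ∃ c₀ > 0,
      (∀ β ∈ Metric.ball (t : ℂ) r, ∀ k,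
        c₀ ≤ ‖complexMGF (fun ω => Y 0 ω 0) P (β * a k)‖) ∧
      ∀ g : unitCube d → ℂ, Continuous g → ∀ e > 0, ∃ M₀, ∀ M N, M₀ ≤ M → M ≤ N →
        ∀ β ∈ Metric.ball (t : ℂ) r,
          ∫ ω, ‖chaosIntegral (cubeMeasure d) (chaosStep P Y a b β) g N ω
            - chaosIntegral (cubeMeasure d) (chaosStep P Y a b β) g M ω‖ ^ p ∂P ≤ e := by
  have htd : t ^ 2 < 2 * (d : ℝ) := (Real.lt_sqrt ht0.le).mp ht
  obtain ⟨ε₁, hε₁, c₀, hc₀, hmgf⟩ := h.expMoments.exists_ball_le_norm_complexMGF t h.a_lim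
  obtain ⟨s, η, θ, l, ε, ρ, hs, hs1, hη, hθ0, hθ1, hε, hρ, hpar⟩ :=
    exists_subcritical_parameters htd h.delta_pos
  set r := min ε₁ ρ with hr
  have hr0 : 0 < r := lt_min hε₁ hρ
  have hbc : ∀ β ∈ Metric.ball (t : ℂ) r, ∀ k,
      c₀ ≤ ‖complexMGF (fun ω => Y 0 ω 0) P (β * a k)‖ := fun β hβ =>
    hmgf β (Metric.ball_subset_ball (min_le_left _ _) hβ)
  refine ⟨r, hr0, 2 * s, by linarith, by linarith, c₀, hc₀, hbc, fun g hg e he => ?_⟩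
  set R := t + r with hR
  have hR0 : 0 ≤ R := by positivity
  have hβR : ∀ β ∈ Metric.ball (t : ℂ) r, ‖β‖ ≤ R := fun β hβ => by
    have h1 := norm_le_norm_add_norm_sub' β (t : ℂ)
    rw [Complex.norm_real, Real.norm_eq_abs, abs_of_pos ht0] at h1
    have h2 := mem_ball_iff_norm.mp hβ
    linarith
  obtain ⟨K, C, hK0, hsys⟩ := h.exists_stepSystem hθ0.le hR0 hc₀
  obtain ⟨B₁, hB₁, h1⟩ := h.exists_density_moment_bound R hc₀ (q := 1) zero_le_one
  obtain ⟨B₂, hB₂, h2⟩ := h.exists_density_moment_bound R hc₀ (q := 2 * s) (by linarith)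
  obtain ⟨B₃, hB₃, h3⟩ := h.exists_density_moment_bound R hc₀ (q := 2 * s + η) (by linarith)
  obtain ⟨v, hv0, hv⟩ := cubeMeasure_closedBall_le d
  set B := B₁ + B₂ + B₃ with hB
  have hB0 : 0 ≤ B := by positivity
  obtain ⟨G, hG0, hG⟩ := StepSystem.exists_norm_le hg
  set D := (B * v) ^ s + B + K ^ s * B with hD
  have hD0 : 0 ≤ D := by positivity
  set A := ∑' k, a k ^ 3 with hA
  have ha3 : ∀ k, 0 ≤ a k ^ 3 := fun k => pow_nonneg (h.a_pos k).le 3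
  have hAsum : ∀ n N, ∑ k ∈ Finset.Ico n N, a k ^ 3 ≤ A := fun n N =>
    h.a_cube.sum_le_tsum _ fun k _ => ha3 k
  set τ : ℕ → ℝ := fun M => ∑' k, a (k + M) ^ 3 with hτ
  have hτsum : ∀ M N, ∑ k ∈ Finset.Ico M N, a k ^ 3 ≤ τ M := fun M N => by
    rw [Finset.sum_Ico_eq_sum_range]
    simp_rw [add_comm M]
    exact ((summable_nat_add_iff M).mpr h.a_cube).sum_le_tsum _ fun k _ => ha3 _
  have hτ0 : Tendsto τ atTop (𝓝 0) := tendsto_sum_nat_add fun k => a k ^ 3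
  have hclock0 : ∀ m, 0 ≤ clock a m := fun m => Finset.sum_nonneg fun _ _ => sq_nonneg _
  have hdecay : ∀ β ∈ Metric.ball (t : ℂ) r, ∀ m,
      ∫ ω, absEnergy (cubeMeasure d) (nearKernel (Real.exp (-(1 - θ) * clock a m))
          (K * Real.exp (-(θ * δ) * clock a m))) (density (chaosStep P Y a b β) m ω) ^ s ∂P
        ≤ D * Real.exp (-ε * clock a m) := by
    intro β hβ m
    obtain ⟨p1, p2, p3⟩ := hpar β (Metric.ball_subset_ball (min_le_right _ _) hβ)
    have hmono : ∀ {B' x : ℝ}, B' ≤ B →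
        ENNReal.ofReal (B' * Real.exp x) ≤ ENNReal.ofReal (B * Real.exp x) := fun hB' =>
      ENNReal.ofReal_le_ofReal (mul_le_mul_of_nonneg_right hB' (Real.exp_pos _).le)
    refine integral_absEnergy_rpow_le ((hsys β (hβR β hβ) (hbc β hβ)).density_field m).meas
      hs.le hs1.le hη.le hK0 hB0 hv0 (hclock0 m) (fun x => ?_) (fun x => ?_) (fun x => ?_)
      (fun x => ?_) p1 p2 p3
    · have := h1 β (hβR β hβ) (hbc β hβ) m x
      simp only [ENNReal.rpow_one] at this
      exact this.trans (hmono (by linarith))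
    · exact (h2 β (hβR β hβ) (hbc β hβ) m x).trans (hmono (by linarith))
    · exact (h3 β (hβR β hβ) (hbc β hβ) m x).trans (hmono (by linarith))
    · refine (hv x _ (Real.exp_pos _).le).trans_eq ?_
      rw [← Real.exp_nat_mul]
      congr 3; ring
  -- The first term vanishes with the tail of ∑ a_k³, the second because the clock diverges. No
  -- constant depends on β within the disc.
  have hlim : Tendsto (fun M => (Real.exp (C * (1 + C) * A) ^ s + energyConst C A D ε s)
      * (G * G * (Real.exp (C * (1 + C) * τ M) - 1)) ^ s
      + energyConst C A D ε s * (G * G) ^ s * Real.exp (-ε * clock a M)) atTop (𝓝 0) := by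
    have l1 : Tendsto (fun M => (G * G * (Real.exp (C * (1 + C) * τ M) - 1)) ^ s) atTop
        (𝓝 0) := by
      have hc : Continuous fun x : ℝ => (G * G * (Real.exp (C * (1 + C) * x) - 1)) ^ s :=
        Continuous.rpow_const (by fun_prop) fun _ => Or.inr (by linarith)
      have := (hc.tendsto 0).comp hτ0
      simpa [Function.comp_def, Real.zero_rpow (show s ≠ 0 by linarith)] using this
    have l2 : Tendsto (fun M => Real.exp (-ε * clock a M)) atTop (𝓝 0) := by
      refine Real.tendsto_exp_atBot.comp ?_
      exact h.tendsto_clock.const_mul_atTop_of_neg (by linarith)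
    simpa using (l1.const_mul _).add (l2.const_mul _)
  obtain ⟨M₀, hM₀⟩ := eventually_atTop.mp (hlim.eventually_le_const he)
  exact ⟨M₀, fun M N hM hMN β hβ =>
    ((hsys β (hβR β hβ) (hbc β hβ)).integral_norm_sub_rpow_le hg hG0 hG hAsum (by linarith) hs1 hε
      hD0 (hdecay β hβ) hMN (hτsum M N)).trans (hM₀ M hM)⟩

end ChaosModel

end CauchyEstimate

/-! ### Doob's inequality for integrated norms of martingale fields. -/

section MaximalInequality

open scoped ENNReal NNReal

set_option linter.unusedSectionVars false

variable {Ω T : Type*} [mΩ : MeasurableSpace Ω] {P : Measure Ω} [IsProbabilityMeasure P]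
  [MetricSpace T] [SecondCountableTopology T] [MeasurableSpace T] [BorelSpace T]
  {μ : Measure T} [IsFiniteMeasure μ]

lemma measurable_integral_norm_field {m : MeasurableSpace Ω} {G : Ω → T → ℂ}
    (hc : ∀ ω, Continuous (G ω)) (hm : ∀ t, Measurable fun ω => G ω t) :
    Measurable fun ω => ∫ t, ‖G ω t‖ ∂μ := by
  have h1 : Measurable fun p : Ω × T => ‖G p.1 p.2‖ :=
    measurable_norm.comp (measurable_uncurry_field hc hm)
  exact (h1.stronglyMeasurable.integral_prod_right (ν := μ)).measurable

lemma integrable_uncurry_field {G : Ω → T → ℂ} (hc : ∀ ω, Continuous (G ω))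
    (hi : ∀ t, Integrable (fun ω => G ω t) P) (hm : ∀ t, Measurable fun ω => G ω t) {e : ℝ}
    (he : ∀ t, ∫ ω, ‖G ω t‖ ∂P ≤ e) :
    Integrable (fun p : Ω × T => ‖G p.1 p.2‖) (P.prod μ) := by
  have h1 : Measurable fun p : Ω × T => ‖G p.1 p.2‖ :=
    measurable_norm.comp (measurable_uncurry_field hc hm)
  rw [integrable_prod_iff' h1.aestronglyMeasurable]
  refine ⟨ae_of_all _ fun t => (hi t).norm, ?_⟩
  have h2 : Measurable fun t => ∫ ω, ‖‖G ω t‖‖ ∂P :=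
    ((h1.norm.comp measurable_swap).stronglyMeasurable.integral_prod_right' (ν := P)).measurable
  refine (integrable_const e).mono' h2.aestronglyMeasurable (ae_of_all _ fun t => ?_)
  simp only [norm_norm]
  rw [Real.norm_of_nonneg (integral_nonneg fun _ => norm_nonneg _)]
  exact he t

/-- The `L¹`-norm of a random field whose values are martingales is a submartingale. -/
lemma submartingale_integral_norm {𝓖 : Filtration ℕ mΩ} {G : ℕ → Ω → T → ℂ}
    (hc : ∀ n ω, Continuous (G n ω)) (hG : ∀ t, Martingale (fun n ω => G n ω t) 𝓖 P) {e : ℝ}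
    (he : ∀ n t, ∫ ω, ‖G n ω t‖ ∂P ≤ e) :
    Submartingale (fun n ω => ∫ t, ‖G n ω t‖ ∂μ) 𝓖 P := by
  have hm : ∀ n t, Measurable[𝓖 n] fun ω => G n ω t := fun n t => ((hG t).1 n).measurable
  have hm' : ∀ n t, Measurable fun ω => G n ω t := fun n t => (hm n t).mono (𝓖.le n) le_rfl
  have hint : ∀ n, Integrable (fun p : Ω × T => ‖G n p.1 p.2‖) (P.prod μ) := fun n =>
    integrable_uncurry_field (hc n) (fun t => (hG t).integrable n) (hm' n) (he n)
  refine submartingale_of_setIntegral_le_succ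
    (fun n => (measurable_integral_norm_field (hc n) (hm n)).stronglyMeasurable)
    (fun n => (hint n).integral_prod_left) fun n s hs => ?_
  have hs' := 𝓖.le n s hs
  have hint' : ∀ n, Integrable (Function.uncurry fun ω t => ‖G n ω t‖)
      ((P.restrict s).prod μ) := fun n => by
    have := (hint n).restrict (s := s ×ˢ Set.univ)
    rwa [← Measure.prod_restrict, Measure.restrict_univ] at this
  rw [integral_integral_swap (hint' n), integral_integral_swap (hint' (n + 1))]
  refine integral_mono (hint' n).integral_prod_right (hint' (n + 1)).integral_prod_right
    fun t => ?_
  -- After Fubini the submartingale inequality is the contraction of conditional expectation, for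
  -- each parameter t separately.
  have h1 := setIntegral_norm_condExp_le (μ := P) hs fun ω => G (n + 1) ω t
  refine le_of_eq_of_le (setIntegral_congr_ae hs' ?_) h1
  filter_upwards [(hG t).condExp_ae_eq (Nat.le_succ n)] with ω hω _
  rw [hω]

/-- A maximal inequality for random fields whose values are martingales. -/
lemma measure_exists_integral_norm_ge_le {𝓖 : Filtration ℕ mΩ} {G : ℕ → Ω → T → ℂ}
    (hc : ∀ n ω, Continuous (G n ω)) (hG : ∀ t, Martingale (fun n ω => G n ω t) 𝓖 P) {e : ℝ}
    (he : ∀ n t, ∫ ω, ‖G n ω t‖ ∂P ≤ e) (l : ℝ≥0) :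
    l * P {ω | ∃ n, (l : ℝ) ≤ ∫ t, ‖G n ω t‖ ∂μ} ≤ ENNReal.ofReal (e * μ.real Set.univ) := by
  have hsub := submartingale_integral_norm (μ := μ) hc hG he
  have hm' : ∀ n t, Measurable fun ω => G n ω t := fun n t =>
    ((hG t).1 n).measurable.mono (𝓖.le n) le_rfl
  have hint : ∀ n, Integrable (fun p : Ω × T => ‖G n p.1 p.2‖) (P.prod μ) := fun n =>
    integrable_uncurry_field (hc n) (fun t => (hG t).integrable n) (hm' n) (he n)
  have hnn : 0 ≤ fun n ω => ∫ t, ‖G n ω t‖ ∂μ := fun n ω => integral_nonneg fun t => norm_nonneg _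
  -- Doob's inequality is applied on finite horizons; the increasing union gives the bound for all
  -- times at once.
  set S : ℕ → Set Ω := fun n => {ω | (l : ℝ) ≤ (Finset.range (n + 1)).sup'
    Finset.nonempty_range_add_one fun k => ∫ t, ‖G k ω t‖ ∂μ} with hS
  have hSmono : Monotone S := fun n m hnm ω hω => by
    have h1 : (l : ℝ) ≤ _ := hω
    exact h1.trans (Finset.sup'_mono _ (Finset.range_mono (by omega)) _)
  have hSU : {ω | ∃ n, (l : ℝ) ≤ ∫ t, ‖G n ω t‖ ∂μ} = ⋃ n, S n := by
    ext ω
    simp only [hS, Set.mem_iUnion, Finset.le_sup'_iff, Finset.mem_range]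
    constructor
    · rintro ⟨n, hn⟩; exact ⟨n, n, by omega, hn⟩
    · rintro ⟨n, k, -, hk⟩; exact ⟨k, hk⟩
  rw [hSU, hSmono.measure_iUnion, ENNReal.mul_iSup]
  refine iSup_le fun n => (maximal_ineq hsub hnn n).trans (ENNReal.ofReal_le_ofReal ?_)
  refine (setIntegral_le_integral (hsub.integrable n) (ae_of_all _ (hnn n))).trans ?_
  rw [integral_integral_swap (hint n)]
  calc ∫ t, ∫ ω, ‖G n ω t‖ ∂P ∂μ ≤ ∫ _, e ∂μ :=
        integral_mono (hint n).integral_prod_right (integrable_const e) (he n)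
    _ = e * μ.real Set.univ := by rw [integral_const, smul_eq_mul, mul_comm]

end MaximalInequality

/-! ### Almost sure uniform convergence of analytic martingales. -/

section AnalyticMartingales

open scoped ENNReal NNReal

/-- Cauchy's estimate on the half disc by the mean over the circle. -/
lemma norm_le_integral_circle {F : ℂ → ℂ} {z₀ w : ℂ} {r : ℝ} (hr : 0 < r)
    (hF : DifferentiableOn ℂ F (Metric.closedBall z₀ r)) (hw : w ∈ Metric.ball z₀ (r / 2)) :
    ‖F w‖ ≤ ∫ θ in Set.Ioc 0 (2 * Real.pi), ‖F (circleMap z₀ r θ)‖ := by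
  have hcont : Continuous fun θ => F (circleMap z₀ r θ) :=
    hF.continuousOn.comp_continuous (continuous_circleMap z₀ r) fun θ =>
      circleMap_mem_closedBall z₀ hr.le θ
  have hwb : w ∈ Metric.ball z₀ r := Metric.ball_subset_ball (by linarith) hw
  have h1 := hF.circleIntegral_sub_inv_smul hwb
  have hpi := Real.pi_gt_three
  have h2 : ‖(2 * Real.pi * Complex.I : ℂ) • F w‖ = 2 * Real.pi * ‖F w‖ := by
    rw [norm_smul]; simp [abs_of_pos Real.pi_pos]
  have h3 : ‖∮ z in C(z₀, r), (z - w)⁻¹ • F z‖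
      ≤ ∫ θ in Set.Ioc 0 (2 * Real.pi), 2 * ‖F (circleMap z₀ r θ)‖ := by
    rw [circleIntegral, intervalIntegral.integral_of_le (by positivity)]
    refine norm_integral_le_of_norm_le ?_ (ae_of_all _ fun θ => ?_)
    · exact ((continuous_const.mul hcont.norm).integrableOn_Icc).mono_set Set.Ioc_subset_Icc_self
    · rw [norm_smul, norm_smul, ← mul_assoc]
      refine mul_le_mul_of_nonneg_right ?_ (norm_nonneg _)
      have h4 : ‖deriv (circleMap z₀ r) θ‖ = r := by
        rw [deriv_circleMap]; simp [abs_of_pos hr]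
      -- The half radius gives |z - w| ≥ r/2 on the circle, so the Cauchy kernel times r is at most
      -- 2; dividing by 2π leaves 1/π < 1.
      have h5 : r / 2 ≤ ‖circleMap z₀ r θ - w‖ := by
        have h6 : dist (circleMap z₀ r θ) z₀ = r := circleMap_mem_sphere z₀ hr.le θ
        have h7 := dist_triangle (circleMap z₀ r θ) w z₀
        have h8 : dist w z₀ < r / 2 := hw
        rw [← dist_eq_norm]; linarith
      rw [h4, norm_inv, ← div_eq_mul_inv, div_le_iff₀ (by linarith)]
      linarith
  rw [h1, h2, integral_const_mul] at h3
  nlinarith [norm_nonneg (F w)]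

/-- Almost sure local uniform Cauchy property of analytic families of martingales that are Cauchy
in `L¹`, uniformly in the parameter. -/
lemma ae_uniformCauchySeqOn_of_martingale {Ω : Type*} [mΩ : MeasurableSpace Ω] {P : Measure Ω}
    [IsProbabilityMeasure P] {𝓕 : Filtration ℕ mΩ} {F : ℕ → ℂ → Ω → ℂ} {z₀ : ℂ} {r : ℝ}
    (hr : 0 < r) (hmart : ∀ z ∈ Metric.closedBall z₀ r, Martingale (fun n => F n z) 𝓕 P)
    (hdiff : ∀ n ω, DifferentiableOn ℂ (fun z => F n z ω) (Metric.closedBall z₀ r))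
    (hcauchy : ∀ e > 0, ∃ M₀, ∀ M N, M₀ ≤ M → M ≤ N → ∀ z ∈ Metric.closedBall z₀ r,
      ∫ ω, ‖F N z ω - F M z ω‖ ∂P ≤ e) :
    ∀ᵐ ω ∂P, UniformCauchySeqOn (fun n z => F n z ω) atTop (Metric.ball z₀ (r / 2)) := by
  -- An L¹ error 4^{-i} against a threshold 2^{-i} leaves probabilities of order 2^{-i}, summable
  -- for Borel–Cantelli.
  choose m hm using fun i : ℕ => hcauchy ((1 / 4) ^ i) (by positivity)
  let μ : Measure ℝ := volume.restrict (Set.Ioc 0 (2 * Real.pi))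
  let G : ℕ → ℕ → Ω → ℝ → ℂ := fun i n ω θ =>
    F (m i + n) (circleMap z₀ r θ) ω - F (m i) (circleMap z₀ r θ) ω
  have hcirc : ∀ θ, circleMap z₀ r θ ∈ Metric.closedBall z₀ r := fun θ =>
    circleMap_mem_closedBall z₀ hr.le θ
  -- The filtration restarted at time m_i, for which the increments F_{m_i+n} - F_{m_i} are
  -- martingales in n.
  let 𝓖 : ℕ → Filtration ℕ mΩ := fun i =>
    { seq := fun n => 𝓕 (m i + n)
      mono' := fun _ _ h => 𝓕.mono (by omega)
      le' := fun n => 𝓕.le _ }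
  have hGc : ∀ i n ω, Continuous (G i n ω) := fun i n ω =>
    ((hdiff _ ω).sub (hdiff _ ω)).continuousOn.comp_continuous (continuous_circleMap z₀ r) hcirc
  have hGm : ∀ i θ, Martingale (fun n ω => G i n ω θ) (𝓖 i) P := fun i θ => by
    have hM := hmart _ (hcirc θ)
    have h1 : Martingale (fun n => F (m i + n) (circleMap z₀ r θ)) (𝓖 i) P :=
      ⟨fun n => hM.1 (m i + n), fun n k hnk => hM.2 _ _ (by omega)⟩
    refine h1.sub (martingale_const_fun (𝓖 i) P ?_ (hM.integrable (m i)))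
    exact hM.1 (m i)
  have hGe : ∀ i n θ, ∫ ω, ‖G i n ω θ‖ ∂P ≤ (1 / 4) ^ i := fun i n θ =>
    hm i _ _ le_rfl (by omega) _ (hcirc θ)
  set A : ℕ → Set Ω := fun i => {ω | ∃ n, (((1 / 2) ^ i : ℝ≥0) : ℝ) ≤ ∫ θ, ‖G i n ω θ‖ ∂μ} with hA
  have hPA : ∀ i, P (A i) ≤ ENNReal.ofReal (μ.real Set.univ * (1 / 2) ^ i) := fun i => by
    have h1 := measure_exists_integral_norm_ge_le (μ := μ) (hGc i) (hGm i) (hGe i) ((1 / 2) ^ i)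
    have h2 : ((((1 / 2) ^ i : ℝ≥0)) : ℝ≥0∞) = ENNReal.ofReal ((1 / 2) ^ i) := by
      rw [← ENNReal.ofReal_coe_nnreal]; simp
    have h3 : ((1 / 4 : ℝ) ^ i) * μ.real Set.univ
        = (1 / 2) ^ i * (μ.real Set.univ * (1 / 2) ^ i) := by
      rw [show (1 / 4 : ℝ) = 1 / 2 * (1 / 2) by norm_num, mul_pow]; ring
    rw [h2, h3, ENNReal.ofReal_mul (by positivity)] at h1
    exact (ENNReal.mul_le_mul_iff_right (by simp) ENNReal.ofReal_ne_top).mp h1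
  have hsum : ∑' i, P (A i) ≠ ∞ := by
    refine ne_top_of_le_ne_top ?_ (ENNReal.tsum_le_tsum hPA)
    have hs : Summable fun i : ℕ => μ.real Set.univ * (1 / 2 : ℝ) ^ i :=
      (summable_geometric_of_lt_one (by norm_num) (by norm_num)).mul_left _
    rw [← ENNReal.ofReal_tsum_of_nonneg (fun i => by positivity) hs]
    exact ENNReal.ofReal_ne_top
  filter_upwards [ae_eventually_notMem hsum] with ω hω
  rw [Metric.uniformCauchySeqOn_iff]
  intro e he
  have hlim : Tendsto (fun i : ℕ => (1 / 2 : ℝ) ^ i) atTop (𝓝 0) :=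
    tendsto_pow_atTop_nhds_zero_of_lt_one (by norm_num) (by norm_num)
  obtain ⟨i, hi, hie⟩ := (hω.and (hlim.eventually_lt_const (half_pos he))).exists
  have hclose : ∀ n ≥ m i, ∀ z ∈ Metric.ball z₀ (r / 2), dist (F n z ω) (F (m i) z ω) < e / 2 := by
    intro n hn z hz
    have h1 : ∫ θ, ‖G i (n - m i) ω θ‖ ∂μ < (1 / 2) ^ i := by
      by_contra hcon
      exact hi ⟨n - m i, by simpa using hcon⟩
    have h2 := norm_le_integral_circle hr ((hdiff n ω).sub (hdiff (m i) ω)) hz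
    have h3 : m i + (n - m i) = n := by omega
    simp only [G, h3] at h1
    rw [dist_eq_norm]
    exact (h2.trans_lt h1).trans hie
  refine ⟨m i, fun k hk n hn z hz => ?_⟩
  have h1 := hclose k hk z hz
  have h2 := hclose n hn z hz
  have h3 := dist_triangle_right (F k z ω) (F n z ω) (F (m i) z ω)
  linarith

end AnalyticMartingales

/-! ### Limits and moments in L^p. -/

section LpLimits

open scoped ENNReal

/-- An almost sure limit of a Cauchy sequence in `L^p` is a limit in `L^p`. -/
lemma memLp_and_tendsto_eLpNorm_of_cauchy {Ω : Type*} [MeasurableSpace Ω] {P : Measure Ω}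
    {p : ℝ} (hp : 1 < p) {F : ℕ → Ω → ℂ} {G : Ω → ℂ} (hF : ∀ n, MemLp (F n) (ENNReal.ofReal p) P)
    (hlim : ∀ᵐ ω ∂P, Tendsto (fun n => F n ω) atTop (𝓝 (G ω)))
    (hcauchy : ∀ e > 0, ∃ M₀, ∀ M N, M₀ ≤ M → M ≤ N → ∫ ω, ‖F N ω - F M ω‖ ^ p ∂P ≤ e) :
    MemLp G (ENNReal.ofReal p) P ∧
      Tendsto (fun n => eLpNorm (F n - G) (ENNReal.ofReal p) P) atTop (𝓝 0) := by
  have hp0 : 0 < p := by linarith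
  have hpn : ENNReal.ofReal p ≠ 0 := by simpa using hp0
  have hGm : AEStronglyMeasurable G P :=
    aestronglyMeasurable_of_tendsto_ae atTop (fun n => (hF n).aestronglyMeasurable) hlim
  have key : ∀ e : ℝ, 0 < e → ∃ M₀, ∀ M ≥ M₀,
      eLpNorm (F M - G) (ENNReal.ofReal p) P ≤ ENNReal.ofReal e := by
    intro e he
    obtain ⟨M₀, hM₀⟩ := hcauchy (e ^ p) (Real.rpow_pos_of_pos he _)
    refine ⟨M₀, fun M hM => ?_⟩
    have h1 : ∀ N ≥ M, eLpNorm (F M - F N) (ENNReal.ofReal p) P ≤ ENNReal.ofReal e := by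
      intro N hN
      rw [eLpNorm_sub_comm, ((hF N).sub (hF M)).eLpNorm_eq_integral_rpow_norm hpn
        ENNReal.ofReal_ne_top, ENNReal.toReal_ofReal hp0.le]
      refine ENNReal.ofReal_le_ofReal ?_
      have h2 : ∫ ω, ‖(F N - F M) ω‖ ^ p ∂P ≤ e ^ p := hM₀ M N hM hN
      calc _ ≤ (e ^ p) ^ p⁻¹ := Real.rpow_le_rpow
            (integral_nonneg fun _ => Real.rpow_nonneg (norm_nonneg _) _) h2 (by positivity)
        _ = e := Real.rpow_rpow_inv he.le hp0.ne'
    -- Fatou's lemma, letting N tend to infinity in the Cauchy bound.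
    refine (Lp.eLpNorm_lim_le_liminf_eLpNorm (f := fun N => F M - F N)
      (fun N => ((hF M).sub (hF N)).aestronglyMeasurable) (F M - G) ?_).trans ?_
    · filter_upwards [hlim] with ω hω using hω.const_sub _
    · exact liminf_le_of_frequently_le'
        ((eventually_atTop.mpr ⟨M, h1⟩).frequently)
  refine ⟨?_, ?_⟩
  · obtain ⟨M, hM⟩ := key 1 one_pos
    have h1 : MemLp (F M - G) (ENNReal.ofReal p) P :=
      ⟨(hF M).aestronglyMeasurable.sub hGm, (hM M le_rfl).trans_lt ENNReal.ofReal_lt_top⟩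
    simpa using (hF M).sub h1
  · rw [ENNReal.tendsto_nhds_zero]
    intro e he
    rcases eq_or_ne e ∞ with rfl | hne
    · exact Eventually.of_forall fun _ => le_top
    · obtain ⟨M, hM⟩ := key e.toReal (ENNReal.toReal_pos he.ne' hne)
      rw [ENNReal.ofReal_toReal hne] at hM
      exact eventually_atTop.mpr ⟨M, hM⟩

/-- Control of the first absolute moment by the `p`-th one. -/
lemma integral_norm_le_add_mul_integral_rpow {Ω : Type*} [MeasurableSpace Ω] {P : Measure Ω}
    [IsProbabilityMeasure P] {p : ℝ} (hp : 1 < p) {X : Ω → ℂ}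
    (hX : MemLp X (ENNReal.ofReal p) P) {e : ℝ} (he : 0 < e) :
    ∫ ω, ‖X ω‖ ∂P ≤ e + e ^ (1 - p) * ∫ ω, ‖X ω‖ ^ p ∂P := by
  have hp0 : 0 < p := by linarith
  have hi : Integrable (fun ω => ‖X ω‖ ^ p) P := by
    have := hX.integrable_norm_rpow (by simpa using hp0) ENNReal.ofReal_ne_top
    rwa [ENNReal.toReal_ofReal hp0.le] at this
  have h1 : Integrable (fun ω => ‖X ω‖) P :=
    (hX.integrable (by simpa using hp.le)).norm
  have h2 : ∫ ω, (e + e ^ (1 - p) * ‖X ω‖ ^ p) ∂P = e + e ^ (1 - p) * ∫ ω, ‖X ω‖ ^ p ∂P := by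
    rw [integral_add (integrable_const e) (hi.const_mul _), integral_const_mul]
    simp
  rw [← h2]
  refine integral_mono h1 ((integrable_const e).add (hi.const_mul _)) fun ω => ?_
  rcases le_total ‖X ω‖ e with h | h
  · exact h.trans (le_add_of_nonneg_right (by positivity))
  · have hx : 0 < ‖X ω‖ := he.trans_le h
    refine le_add_of_nonneg_of_le he.le ?_
    calc ‖X ω‖ = ‖X ω‖ ^ (1 - p) * ‖X ω‖ ^ p := by
          rw [← Real.rpow_add hx]; simp
      _ ≤ e ^ (1 - p) * ‖X ω‖ ^ p := by
          refine mul_le_mul_of_nonneg_right ?_ (by positivity)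
          exact Real.rpow_le_rpow_of_nonpos he h (by linarith)

end LpLimits

/-! ### Martingale, analyticity and convergence on a disc. -/

section Convergence

open scoped ENNReal

set_option linter.unusedSectionVars false

/-- Compactness bounds both g and S, so near any β₀ the β-derivative of the integrand is dominated
by a constant. -/
lemma differentiable_integral_mul_cexp {E : Type*} [TopologicalSpace E] [CompactSpace E]
    [SecondCountableTopology E] [MeasurableSpace E] [BorelSpace E] {ν : Measure E}
    [IsProbabilityMeasure ν] {g : E → ℂ} (hg : Continuous g) {S : E → ℝ} (hS : Continuous S) :
    Differentiable ℂ fun β : ℂ => ∫ x, g x * Complex.exp (β * S x) ∂ν := by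
  intro β₀
  obtain ⟨G, hG⟩ := (isCompact_range hg).isBounded.exists_norm_le
  obtain ⟨B, hB⟩ := (isCompact_range hS).isBounded.exists_norm_le
  have hG' : ∀ x, ‖g x‖ ≤ |G| := fun x => (hG _ ⟨x, rfl⟩).trans (le_abs_self G)
  have hB' : ∀ x, |S x| ≤ |B| := fun x => (hB _ ⟨x, rfl⟩).trans (le_abs_self B)
  have hexp : ∀ (β : ℂ) (x : E), β ∈ Metric.ball β₀ 1 →
      ‖Complex.exp (β * S x)‖ ≤ Real.exp ((‖β₀‖ + 1) * |B|) := fun β x hβ => by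
    refine (Complex.norm_exp_le_exp_norm _).trans (Real.exp_le_exp.mpr ?_)
    rw [norm_mul, Complex.norm_real, Real.norm_eq_abs]
    have h1 := norm_le_norm_add_norm_sub' β β₀
    have h2 := mem_ball_iff_norm.mp hβ
    have h3 : ‖β‖ ≤ ‖β₀‖ + 1 := by linarith
    exact mul_le_mul h3 (hB' x) (abs_nonneg _) (by positivity)
  have hcont : ∀ β : ℂ, Continuous fun x => g x * Complex.exp (β * S x) := fun β => by fun_prop
  have hmeas : ∀ β : ℂ, AEStronglyMeasurable (fun x => g x * Complex.exp (β * S x)) ν := fun β =>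
    (hcont β).aestronglyMeasurable
  have h := hasDerivAt_integral_of_dominated_loc_of_deriv_le (μ := ν) (𝕜 := ℂ)
    (F := fun β x => g x * Complex.exp (β * S x))
    (F' := fun β x => g x * (Complex.exp (β * S x) * S x)) (x₀ := β₀) (s := Metric.ball β₀ 1)
    (bound := fun _ => |G| * (Real.exp ((‖β₀‖ + 1) * |B|) * |B|))
    (Metric.ball_mem_nhds β₀ one_pos) (Eventually.of_forall hmeas)
    ((integrable_const (|G| * Real.exp ((‖β₀‖ + 1) * |B|))).mono' (hmeas β₀)
      (ae_of_all _ fun x => by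
        rw [norm_mul]
        exact mul_le_mul (hG' x) (hexp β₀ x (Metric.mem_ball_self one_pos)) (norm_nonneg _)
          (abs_nonneg _)))
    (Continuous.aestronglyMeasurable (by fun_prop))
    (ae_of_all _ fun x β hβ => by
      rw [norm_mul, norm_mul, Complex.norm_real, Real.norm_eq_abs]
      refine mul_le_mul (hG' x) ?_ (by positivity) (abs_nonneg _)
      exact mul_le_mul (hexp β x hβ) (hB' x) (abs_nonneg _) (Real.exp_pos _).le)
    (integrable_const _)
    (ae_of_all _ fun x β _ => by
      have h1 : HasDerivAt (fun β : ℂ => β * S x) (S x : ℂ) β := by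
        simpa using (hasDerivAt_id β).mul_const (S x : ℂ)
      exact h1.cexp.const_mul (g x))
  exact h.2.differentiableAt

namespace ChaosModel

variable {Ω : Type*} [mΩ : MeasurableSpace Ω] {P : Measure Ω} [IsProbabilityMeasure P] {d : ℕ}
  {Y : ℕ → Ω → EuclideanSpace ℝ (Fin d) → ℝ} {f : ℝ → ℝ} {δ : ℝ} {a b c : ℕ → ℝ}
  {g : EuclideanSpace ℝ (Fin d) → ℂ}

lemma differentiableOn_chaos (h : ChaosModel P Y f δ a b c) (hg : ContinuousOn g (unitCube d))
    {s : Set ℂ} (hs : ∀ β ∈ s, ∀ k, complexMGF (fun ω => Y 0 ω 0) P (β * a k) ≠ 0) (n : ℕ)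
    (ω : Ω) :
    DifferentiableOn ℂ (fun β => chaos P (dilatedField a b Y) n g β ω) s := by
  have hS : Continuous fun x : unitCube d =>
      fieldSum (dilatedField a b Y) n ω (x : EuclideanSpace ℝ (Fin d)) :=
    continuous_finsetSum _ fun k _ => continuous_const.mul ((h.cont k ω).comp (by fun_prop))
  have hnum := differentiable_integral_mul_cexp (ν := cubeMeasure d) hg.domRestrict hS
  have hden : ∀ k, Differentiable ℂ fun β : ℂ => complexMGF (fun ω => Y 0 ω 0) P (β * a k) :=
    fun k => h.expMoments.differentiable_complexMGF.comp (differentiable_id.mul_const _)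
  have hprod : Differentiable ℂ fun β : ℂ =>
      ∏ k ∈ Finset.range n, complexMGF (fun ω => Y 0 ω 0) P (β * a k) :=
    Differentiable.fun_finsetProd fun k _ => hden k
  have heq : (fun β => chaos P (dilatedField a b Y) n g β ω) = fun β =>
      (∫ x : unitCube d, (unitCube d).domRestrict g x * Complex.exp (β *
        (fieldSum (dilatedField a b Y) n ω (x : EuclideanSpace ℝ (Fin d)) : ℂ)) ∂cubeMeasure d)
      / ∏ k ∈ Finset.range n, complexMGF (fun ω => Y 0 ω 0) P (β * a k) := by
    funext β
    rw [chaos, setIntegral_unitCube, ← integral_div]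
    refine integral_congr_ae (ae_of_all _ fun x => ?_)
    simp only [h.chaosNormalizer_eq, Set.domRestrict_apply]
    ring
  rw [heq]
  exact hnum.differentiableOn.div hprod.differentiableOn fun β hβ =>
    Finset.prod_ne_zero_iff.mpr fun k _ => hs β hβ k

lemma martingale_chaos (h : ChaosModel P Y f δ a b c) (hg : ContinuousOn g (unitCube d)) {β : ℂ}
    {c₀ : ℝ} (hc₀ : 0 < c₀) (hβ : ∀ k, c₀ ≤ ‖complexMGF (fun ω => Y 0 ω 0) P (β * a k)‖) :
    Martingale (fun n => chaos P (dilatedField a b Y) n g β) (fieldFiltration Y h.meas) P := by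
  obtain ⟨K, C, -, hsys⟩ := h.exists_stepSystem le_rfl (norm_nonneg β) hc₀
  have hs := hsys β le_rfl hβ
  have hg' : Continuous fun x : unitCube d => g x := hg.domRestrict
  have heq : (fun n => chaos P (dilatedField a b Y) n g β) = fun n =>
      chaosIntegral (cubeMeasure d) (chaosStep P Y a b β) (fun x => g x) n :=
    funext fun n => funext fun ω => h.chaos_eq n g β ω
  rw [heq]
  refine martingale_of_setIntegral_eq_succ
    (fun n => (hs.measurable_chaosIntegral hg' n).stronglyMeasurable)
    (fun n => hs.integrable_chaosIntegral hg' n) fun n A hA => ?_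
  have hA' := (fieldFiltration Y h.meas).le n A hA
  have hB : Measurable[fieldFiltration Y h.meas n] (A.indicator (1 : Ω → ℂ)) :=
    ((show StronglyMeasurable[fieldFiltration Y h.meas n] (1 : Ω → ℂ) from
      stronglyMeasurable_const).indicator hA).measurable
  have h1 := hs.integral_mul_chaosIntegral_succ (ν := cubeMeasure d) hg' (le_refl n)
    (B := A.indicator 1) hB (b := 1) fun ω => by
      by_cases hω : ω ∈ A <;> simp [hω]
  have h2 : ∀ X : Ω → ℂ, ∫ ω, A.indicator (1 : Ω → ℂ) ω * X ω ∂P = ∫ ω in A, X ω ∂P := fun X => by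
    rw [← integral_indicator hA']
    refine integral_congr_ae (ae_of_all _ fun ω => ?_)
    by_cases hω : ω ∈ A <;> simp [hω]
  rw [h2, h2] at h1
  exact h1.symm

lemma memLp_two_chaos (h : ChaosModel P Y f δ a b c) (hg : ContinuousOn g (unitCube d)) {β : ℂ}
    {c₀ : ℝ} (hc₀ : 0 < c₀) (hβ : ∀ k, c₀ ≤ ‖complexMGF (fun ω => Y 0 ω 0) P (β * a k)‖) (n : ℕ) :
    MemLp (chaos P (dilatedField a b Y) n g β) 2 P := by
  obtain ⟨K, C, -, hsys⟩ := h.exists_stepSystem le_rfl (norm_nonneg β) hc₀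
  have heq : chaos P (dilatedField a b Y) n g β =
      chaosIntegral (cubeMeasure d) (chaosStep P Y a b β) (fun x => g x) n :=
    funext fun ω => h.chaos_eq n g β ω
  rw [heq]
  exact (hsys β le_rfl hβ).memLp_two_chaosIntegral hg.domRestrict n

/-- Around every subcritical parameter there is a disc on which the chaos is a martingale that is
Cauchy in a common `L^p` and, almost surely, locally uniformly in the parameter. -/
lemma exists_ball_convergence (h : ChaosModel P Y f δ a b c) {t : ℝ} (ht0 : 0 < t)
    (ht : t < Real.sqrt (2 * d)) : ∃ r > 0, ∃ p : ℝ, 1 < p ∧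
      (∀ β ∈ Metric.ball (t : ℂ) r, ∀ n x,
        chaosNormalizer P (dilatedField a b Y) n β x ≠ 0) ∧
      ∀ g : EuclideanSpace ℝ (Fin d) → ℂ, ContinuousOn g (unitCube d) →
        (∀ β ∈ Metric.ball (t : ℂ) r,
          Martingale (fun n => chaos P (dilatedField a b Y) n g β) (fieldFiltration Y h.meas) P ∧
          (∀ n, MemLp (chaos P (dilatedField a b Y) n g β) (ENNReal.ofReal p) P) ∧
          ∀ e > 0, ∃ M₀, ∀ M N, M₀ ≤ M → M ≤ N →
            ∫ ω, ‖chaos P (dilatedField a b Y) N g β ω - chaos P (dilatedField a b Y) M g β ω‖ ^ p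
              ∂P ≤ e) ∧
        (∀ n ω, DifferentiableOn ℂ (fun β => chaos P (dilatedField a b Y) n g β ω)
          (Metric.ball (t : ℂ) r)) ∧
        ∀ᵐ ω ∂P, UniformCauchySeqOn (fun n β => chaos P (dilatedField a b Y) n g β ω) atTop
          (Metric.ball (t : ℂ) r) := by
  obtain ⟨r, hr, p, hp1, hp2, c₀, hc₀, hmgf, hcauchy⟩ := h.exists_ball_cauchy ht0 ht
  have hne : ∀ β ∈ Metric.ball (t : ℂ) r, ∀ k,
      complexMGF (fun ω => Y 0 ω 0) P (β * a k) ≠ 0 := fun β hβ k =>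
    norm_pos_iff.mp (hc₀.trans_le (hmgf β hβ k))
  have hsub : Metric.ball (t : ℂ) (r / 2 / 2) ⊆ Metric.ball (t : ℂ) r :=
    Metric.ball_subset_ball (by linarith)
  have hsub' : Metric.closedBall (t : ℂ) (r / 2) ⊆ Metric.ball (t : ℂ) r :=
    Metric.closedBall_subset_ball (by linarith)
  -- One halving puts a closed disc inside the disc of estimates; the other is the loss in Cauchy's
  -- formula.
  refine ⟨r / 2 / 2, by positivity, p, hp1, fun β hβ n x => ?_, fun g hg => ?_⟩
  · rw [h.chaosNormalizer_eq]
    exact Finset.prod_ne_zero_iff.mpr fun k _ => hne β (hsub hβ) k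
  have hLp : ∀ β ∈ Metric.ball (t : ℂ) r, ∀ n,
      MemLp (chaos P (dilatedField a b Y) n g β) (ENNReal.ofReal p) P := fun β hβ n =>
    (h.memLp_two_chaos hg hc₀ (hmgf β hβ) n).mono_exponent (by
      rw [← ENNReal.ofReal_ofNat]; exact ENNReal.ofReal_le_ofReal hp2.le)
  have hC : ∀ e > 0, ∃ M₀, ∀ M N, M₀ ≤ M → M ≤ N → ∀ β ∈ Metric.ball (t : ℂ) r,
      ∫ ω, ‖chaos P (dilatedField a b Y) N g β ω - chaos P (dilatedField a b Y) M g β ω‖ ^ p ∂P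
        ≤ e := fun e he => by
    obtain ⟨M₀, hM₀⟩ := hcauchy (fun x => g x) hg.domRestrict e he
    refine ⟨M₀, fun M N hM hMN β hβ => ?_⟩
    simp_rw [h.chaos_eq]
    exact hM₀ M N hM hMN β hβ
  refine ⟨fun β hβ => ⟨h.martingale_chaos hg hc₀ (hmgf β (hsub hβ)), hLp β (hsub hβ),
    fun e he => ?_⟩, fun n ω => (h.differentiableOn_chaos hg hne n ω).mono hsub, ?_⟩
  · obtain ⟨M₀, hM₀⟩ := hC e he
    exact ⟨M₀, fun M N hM hMN => hM₀ M N hM hMN β (hsub hβ)⟩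
  · refine ae_uniformCauchySeqOn_of_martingale (𝓕 := fieldFiltration Y h.meas) (half_pos hr)
      (fun β hβ => h.martingale_chaos hg hc₀ (hmgf β (hsub' hβ)))
      (fun n ω => (h.differentiableOn_chaos hg hne n ω).mono hsub') fun e he => ?_
    have he2 := half_pos he
    -- With cut level e/2 the first moment is at most e/2 + (e/2)^(1-p) times the p-th moment; this
    -- threshold makes the second term at most e/2 as well.
    obtain ⟨M₀, hM₀⟩ := hC (e / 2 / (e / 2) ^ (1 - p)) (by positivity)
    refine ⟨M₀, fun M N hM hMN β hβ => ?_⟩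
    have h1 := integral_norm_le_add_mul_integral_rpow hp1
      ((hLp β (hsub' hβ) N).sub (hLp β (hsub' hβ) M)) he2
    have h2 := hM₀ M N hM hMN β (hsub' hβ)
    rw [le_div_iff₀ (by positivity)] at h2
    simp only [Pi.sub_apply] at h1
    linarith

end ChaosModel

end Convergence

/-! ### Gluing of the local results. -/

theorem theorem3p1 {Ω : Type*} [MeasurableSpace Ω] (P : Measure Ω) [IsProbabilityMeasure P]
    (d : ℕ) (hd : 1 ≤ d)
    -- the random fields: measurable, continuous, i.i.d., stationary and centred
    (Y : ℕ → Ω → EuclideanSpace ℝ (Fin d) → ℝ)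
    (hY_meas : ∀ k x, Measurable (fun ω => Y k ω x))
    (hY_cont : ∀ k ω, Continuous (Y k ω))
    (hY_indep : iIndepFun Y P)
    (hY_ident : ∀ k, IdentDistrib (Y k) (Y 0) P P)
    (hY_stat : ∀ k, IsStationaryField P (Y k))
    (hY_centered : ∀ k x, ∫ ω, Y k ω x ∂P = 0)
    -- exponential moments and regularity of the increments
    (hY_exp : ∀ k, ∀ l : ℝ, Integrable (fun ω => Real.exp (l * Y k ω 0)) P)
    (hY_reg : ∀ r : ℝ, 2 ≤ r → ∃ C : ℝ, ∀ k x y,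
      ∫ ω, |Y k ω x - Y k ω y| ^ r ∂P ≤ C * ‖x - y‖ ^ r)
    -- the covariance function
    (f : ℝ → ℝ)
    (hf_cov : ∀ k x y, ∫ ω, Y k ω x * Y k ω y ∂P = f ‖x - y‖)
    (hf_zero : (fun t => f t - 1) =O[𝓝[≥] 0] (fun t : ℝ => t))
    (δ : ℝ) (hδ : 0 < δ)
    (hf_top : f =O[atTop] (fun t : ℝ => t ^ (-δ)))
    -- the amplitudes and the dilation factors
    (a b c : ℕ → ℝ)
    (ha_pos : ∀ k, 0 < a k)
    (ha_lim : Tendsto a atTop (𝓝 0))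
    (ha_sq : ¬ Summable (fun k => a k ^ 2))
    (ha_cube : Summable (fun k => a k ^ 3))
    (hc : ∃ C : ℝ, ∀ k, |c k| ≤ C)
    (hb : ∀ k, b k = Real.exp (∑ j ∈ Finset.range (k + 1), a j ^ 2 + c k)) :
    ∃ (U : Set ℂ) (M : (EuclideanSpace ℝ (Fin d) → ℂ) → ℂ → Ω → ℂ),
      IsOpen U ∧
      (∀ t : ℝ, 0 < t → t < Real.sqrt (2 * d) → (t : ℂ) ∈ U) ∧
      -- the chaos is well defined on `U`, and it is a martingale there
      (∀ β ∈ U, ∀ n, ∀ x ∈ unitCube d, chaosNormalizer P (dilatedField a b Y) n β x ≠ 0) ∧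
      (∀ β ∈ U, ∀ g : EuclideanSpace ℝ (Fin d) → ℂ, ContinuousOn g (unitCube d) →
        Martingale (fun n => chaos P (dilatedField a b Y) n g β) (fieldFiltration Y hY_meas) P) ∧
      -- convergence in `L^p`, with `p` depending only on the compact set
      (∀ K : Set ℂ, IsCompact K → K ⊆ U → ∃ p : ℝ, 1 < p ∧
        ∀ β ∈ K, ∀ g : EuclideanSpace ℝ (Fin d) → ℂ, ContinuousOn g (unitCube d) →
          (∀ n, MemLp (chaos P (dilatedField a b Y) n g β) (ENNReal.ofReal p) P) ∧
          MemLp (M g β) (ENNReal.ofReal p) P ∧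
          Tendsto (fun n => eLpNorm (chaos P (dilatedField a b Y) n g β - M g β)
            (ENNReal.ofReal p) P) atTop (𝓝 0)) ∧
      -- almost surely, locally uniform convergence on `U` to an analytic function of `β`
      (∀ g : EuclideanSpace ℝ (Fin d) → ℂ, ContinuousOn g (unitCube d) →
        ∀ᵐ ω ∂P,
          (∀ K : Set ℂ, IsCompact K → K ⊆ U →
            TendstoUniformlyOn (fun n β => chaos P (dilatedField a b Y) n g β ω)
              (fun β => M g β ω) atTop K) ∧
          AnalyticOnNhd ℂ (fun β => M g β ω) U) := by
  have h : ChaosModel P Y f δ a b c :=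
    { meas := hY_meas
      cont := hY_cont
      indep := hY_indep
      ident := hY_ident
      stat := hY_stat
      centered := hY_centered
      exp := hY_exp
      cov := hf_cov
      -- The neighbourhood filter is that of [0, ∞) and contains the point 0, so the O(t) bound at t
      -- = 0 forces f(0) = 1.
      f_zero := sub_eq_zero.mp
        (hf_zero.eq_zero_imp.self_of_nhdsWithin (Set.mem_Ici.mpr le_rfl) rfl)
      delta_pos := hδ
      f_top := hf_top
      a_pos := ha_pos
      a_lim := ha_lim
      a_sq := ha_sq
      a_cube := ha_cube
      c_bdd := hc
      b_eq := hb }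
  have hloc : ∀ t : {t : ℝ // 0 < t ∧ t < Real.sqrt (2 * d)}, _ := fun t =>
    h.exists_ball_convergence t.2.1 t.2.2
  choose r hr p hp hne hball using hloc
  set U : Set ℂ := ⋃ t : {t : ℝ // 0 < t ∧ t < Real.sqrt (2 * d)}, Metric.ball ((t : ℝ) : ℂ) (r t)
    with hU
  have hUo : IsOpen U := isOpen_iUnion fun t => Metric.isOpen_ball
  set F : ℕ → (EuclideanSpace ℝ (Fin d) → ℂ) → ℂ → Ω → ℂ := chaos P (dilatedField a b Y) with hF
  -- A pointwise limit, with an arbitrary value where the sequence diverges. As it depends on no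
  -- disc, the local limits agree automatically.
  set M : (EuclideanSpace ℝ (Fin d) → ℂ) → ℂ → Ω → ℂ := fun g β ω =>
    limUnder atTop fun n => F n g β ω with hM
  have hlim : ∀ {g ω s β}, UniformCauchySeqOn (fun n β => F n g β ω) atTop s → β ∈ s →
      Tendsto (fun n => F n g β ω) atTop (𝓝 (M g β ω)) := fun hs hβ =>
    (hs.cauchySeq hβ).tendsto_limUnder
  refine ⟨U, M, hUo, fun t ht0 ht => ?_, fun β hβ n x _ => ?_, fun β hβ g hg => ?_,
    fun K hK hKU => ?_, fun g hg => ?_⟩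
  · exact Set.mem_iUnion.mpr ⟨⟨t, ht0, ht⟩, Metric.mem_ball_self (hr _)⟩
  · obtain ⟨t, ht⟩ := Set.mem_iUnion.mp hβ
    exact hne t β ht n x
  · obtain ⟨t, ht⟩ := Set.mem_iUnion.mp hβ
    exact ((hball t g hg).1 β ht).1
  · obtain ⟨T, hT⟩ := hK.elim_finite_subcover _ (fun t => Metric.isOpen_ball) hKU
    -- An exponent q > 1 below the finitely many local ones; smaller exponents are allowed on a
    -- probability space.
    have hev : ∀ᶠ q in 𝓝[>] (1 : ℝ), ∀ t ∈ T, q < p t :=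
      (Finset.eventually_all T).mpr fun t _ =>
        mem_nhdsWithin_of_mem_nhds (Iio_mem_nhds (hp t))
    obtain ⟨q, hqT, hq1⟩ := (hev.and self_mem_nhdsWithin).exists
    refine ⟨q, hq1, fun β hβ g hg => ?_⟩
    obtain ⟨t, htT, ht⟩ := Set.mem_iUnion₂.mp (hT hβ)
    have hqp : ENNReal.ofReal q ≤ ENNReal.ofReal (p t) :=
      ENNReal.ofReal_le_ofReal (hqT t htT).le
    obtain ⟨-, hLp, hcauchy⟩ := (hball t g hg).1 β ht
    have hconv : ∀ᵐ ω ∂P, Tendsto (fun n => F n g β ω) atTop (𝓝 (M g β ω)) := by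
      filter_upwards [(hball t g hg).2.2] with ω hω using hlim hω ht
    obtain ⟨hML, hMt⟩ := memLp_and_tendsto_eLpNorm_of_cauchy (hp t) hLp hconv hcauchy
    refine ⟨fun n => (hLp n).mono_exponent hqp, hML.mono_exponent hqp, ?_⟩
    exact tendsto_of_tendsto_of_tendsto_of_le_of_le tendsto_const_nhds hMt (fun _ => bot_le)
      fun n => eLpNorm_le_eLpNorm_of_exponent_le hqp
        ((hLp n).aestronglyMeasurable.sub hML.aestronglyMeasurable)
  -- Countably many discs already cover U, so the exceptional sets unite into a single null set.
  · obtain ⟨T, hTc, hTU⟩ := TopologicalSpace.isOpen_iUnion_countable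
      (fun t : {t : ℝ // 0 < t ∧ t < Real.sqrt (2 * d)} => Metric.ball ((t : ℝ) : ℂ) (r t))
      fun t => Metric.isOpen_ball
    have hae : ∀ᵐ ω ∂P, ∀ t ∈ T, UniformCauchySeqOn (fun n β => F n g β ω) atTop
        (Metric.ball ((t : ℝ) : ℂ) (r t)) :=
      (ae_ball_iff hTc).mpr fun t _ => (hball t g hg).2.2
    filter_upwards [hae] with ω hω
    have hloc : TendstoLocallyUniformlyOn (fun n β => F n g β ω) (fun β => M g β ω) atTop U := by
      rw [hU, ← hTU]
      exact tendstoLocallyUniformlyOn_biUnion (fun t _ => Metric.isOpen_ball) fun t ht =>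
        ((hω t ht).tendstoUniformlyOn_of_tendsto
          fun β hβ => hlim (hω t ht) hβ).tendstoLocallyUniformlyOn
    refine ⟨fun K hK hKU =>
      (tendstoLocallyUniformlyOn_iff_forall_isCompact hUo).mp hloc K hKU hK, ?_⟩
    refine DifferentiableOn.analyticOnNhd (hloc.differentiableOn (Eventually.of_forall fun n => ?_)
      hUo) hUo
    intro β hβ
    obtain ⟨t, ht⟩ := Set.mem_iUnion.mp hβ
    exact (((hball t g hg).2.1 n ω).differentiableAt
      (Metric.isOpen_ball.mem_nhds ht)).differentiableWithinAt
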